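/- Let $x_0$ be a real discrete random variable with countable alphabet $\mathcal X=\{x: p(x)>0\}$, probabilities $p(x)$, finite entropy $H(x_0)=-\sum_{x}p(x)\log p(x)$ (natural logarithms throughout) and finite average power $P_x=E x_0^2$, such that $d=\min\{|x-x'| : x,x'\in\mathcal X,\ x\ne x'\}$ exists. Put $d_{\min}=d/\sqrt{P_x}$, the minimal distance of the unit-power input $x_0/\sqrt{P_x}$. Let $h_0,\dots,h_{L-1}$ be real numbers, not all zero, $H(\theta)=\sum_{k=0}^{L-1}h_ke^{-jk\theta}$, and for $N_0>0$ let $$y_k=\sum_{i=0}^{L-1}h_ix_{k-i}+n_k\qquad(k\in\mathbb Z),$$ where the $x_k$ are i.i.d. copies of $x_0$ and the $n_k$ are i.i.d. $\mathcal N(0,N_0)$, independent of the inputs. Define $$\mathcal I=\lim_{N\to\infty}\tfrac1{2N+1}I(x_{-N}^N;y_{-N}^N),\qquad I_{\mathrm{SL}}=I_x(\mathsf{SNR}_{\mathrm{DFE\text{-}U}}),\qquad I_x(\gamma)=I\big(x_0;\sqrt{\gamma N_0/P_x}\,x_0+n_0\big),$$ $$\mathsf{SNR}_{\mathrm{DFE\text{-}U}}=\exp\Big\{\tfrac1{2\pi}\int_{-\pi}^{\pi}\log\big(1+\tfrac{P_x}{N_0}|H(\theta)|^2\big)d\theta\Big\}-1,\qquad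 g_{\mathrm{ZF\text{-}DFE}}=\exp\Big\{\tfrac1{2\pi}\int_{-\pi}^{\pi}\log|H(\theta)|^2d\theta\Big\},$$ $$\delta_{\min}^2=\inf_{N\ge1}\ \inf_{x_0\ne\tilde x_0,\ x_{N-1}\ne\tilde x_{N-1}}\ \sum_{k=0}^{L+N-2}\Big|\sum_{l=0}^{N-1}\frac{x_l-\tilde x_l}{d}\,h_{k-l}\Big|^2,$$ where the inner infimum is over pairs of words $x_0^{N-1},\tilde x_0^{N-1}\in\mathcal X^N$ and $h_k=0$ for $k\notin\{0,\dots,L-1\}$. Then all these information quantities are finite, the limit $\mathcal I$ exists for every $N_0>0$, and the following hold. (1) There is a polynomial $F$, positive on $(0,\infty)$, such that for all $N_0>0$ $$H(x_0)-\mathcal I\le F\Big(\frac{P_x}{N_0}\Big)\exp\Big(-\frac{P_x}{2N_0}\Big(\frac{d_{\min}}2\Big)^2\delta_{\min}^2\Big).$$ (2) $\delta_{\min}^2\ge g_{\mathrm{ZF\text{-}DFE}}$, with strict inequality whenever $|H(\theta)|$ is not constant (that is, whenever there is nonzero ISI). (3) There are a polynomial $G$, positive on $(0,\infty)$, and constants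 $0<\varepsilon<1$, $\hat K>0$ such that for all $N_0>0$ $$H(x_0)-I_{\mathrm{SL}}\ge G\Big(\frac{P_x}{N_0}\Big)\exp\Big(-\frac{P_x}{2N_0}\Big(\frac{d_{\min}}2\Big)^2g_{\mathrm{ZF\text{-}DFE}}-\hat K\Big(\frac{P_x}{N_0}\Big)^{1-\varepsilon}\Big).$$ (4) There is $s_0$ such that $\mathcal I\ge I_{\mathrm{SL}}$ for all $N_0>0$ with $P_x/N_0\ge s_0$. The polynomials and constants depend only on the distribution of $x_0$ and on $h$. -/

import Mathlib

open MeasureTheory ProbabilityTheory Filter Topology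
open scoped ENNReal

noncomputable section

namespace ISI

/-- Mutual information `I(X ; Y)` (in nats) of two random variables on `(Ω, P)`: the
Kullback-Leibler divergence of the joint law from the product of the marginal laws. -/
def mutualInfo {Ω A B : Type*} [MeasurableSpace Ω] [MeasurableSpace A] [MeasurableSpace B]
    (P : Measure Ω) (X : Ω → A) (Y : Ω → B) : ℝ≥0∞ :=
  InformationTheory.klDiv (P.map fun ω => (X ω, Y ω)) ((P.map X).prod (P.map Y))

/-! ### The input distribution -/

/-- The terms `-p(a) log p(a)` of the input entropy. -/
def entropyTerm (p : PMF ℝ) (a : ℝ) : ℝ := Real.negMulLog (p a).toReal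

/-- The input entropy `H(x₀) = -∑ p(a) log p(a)` (meaningful when the terms are summable). -/
def inputEntropy (p : PMF ℝ) : ℝ := ∑' a, entropyTerm p a

/-- The average input power `P_x = E x₀²`. -/
def inputPower (p : PMF ℝ) : ℝ := ∫ a, a ^ 2 ∂p.toMeasure

/-- The distances between different input values. -/
def inputDistances (p : PMF ℝ) : Set ℝ :=
  {r | ∃ a ∈ p.support, ∃ b ∈ p.support, a ≠ b ∧ r = |a - b|}

/-- The minimal distance `d_min` between different input values. -/
def minDist (p : PMF ℝ) : ℝ := sInf (inputDistances p)

/-- The minimal distance between different values of the unit-power input `x₀ / √P_x`. -/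
def normMinDist (p : PMF ℝ) : ℝ := minDist p / √(inputPower p)

/-! ### The channel -/

/-- Zero-mean Gaussian noise of power `N₀`. -/
def noise (N₀ : ℝ) : Measure ℝ := gaussianReal 0 N₀.toNNReal

instance (N₀ : ℝ) : IsProbabilityMeasure (noise N₀) := by
  unfold noise; infer_instance

/-- The joint law of the two-sided i.i.d. input sequence and the two-sided i.i.d. Gaussian noise
sequence, which are independent of each other. -/
def channelLaw (p : PMF ℝ) (N₀ : ℝ) : Measure ((ℤ → ℝ) × (ℤ → ℝ)) :=
  (Measure.infinitePi fun _ : ℤ => p.toMeasure).prod (Measure.infinitePi fun _ : ℤ => noise N₀)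

/-- The channel output `y_k = ∑_{i=0}^{L-1} h_i x_{k-i} + n_k`, as a function of the pair
`ω = (x, n)` of the input and noise sequences. -/
def output {L : ℕ} (h : Fin L → ℝ) (k : ℤ) (ω : (ℤ → ℝ) × (ℤ → ℝ)) : ℝ :=
  ∑ i : Fin L, h i * ω.1 (k - (i : ℤ)) + ω.2 k

/-- `I(x_{-N}^N ; y_{-N}^N)`. -/
def blockInfo {L : ℕ} (p : PMF ℝ) (h : Fin L → ℝ) (N₀ : ℝ) (N : ℕ) : ℝ≥0∞ :=
  mutualInfo (channelLaw p N₀)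
    (fun ω (k : Finset.Icc (-(N : ℤ)) (N : ℤ)) => ω.1 k)
    (fun ω (k : Finset.Icc (-(N : ℤ)) (N : ℤ)) => output h k ω)

/-- `I(x_{-N}^N ; y_{-N}^N) / (2N+1)`. -/
def blockRate {L : ℕ} (p : PMF ℝ) (h : Fin L → ℝ) (N₀ : ℝ) (N : ℕ) : ℝ :=
  (blockInfo p h N₀ N).toReal / (2 * (N : ℝ) + 1)

/-- The achievable rate `𝓘 = lim_{N → ∞} I(x_{-N}^N ; y_{-N}^N) / (2N+1)`. -/
def achievableRate {L : ℕ} (p : PMF ℝ) (h : Fin L → ℝ) (N₀ : ℝ) : ℝ :=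
  limUnder atTop (blockRate p h N₀)

/-- The transfer function `H(θ) = ∑_k h_k e^{-jkθ}`. -/
def transfer {L : ℕ} (h : Fin L → ℝ) (θ : ℝ) : ℂ :=
  ∑ k : Fin L, (h k : ℂ) * Complex.exp (-(Complex.I * ((k : ℕ) : ℂ) * (θ : ℂ)))

/-! ### The Shamai-Laroia expression -/

/-- `I_x(γ) = I(x₀ ; √(γ N₀ / P_x) x₀ + n₀)`. -/
def scalarInfo (p : PMF ℝ) (N₀ γ : ℝ) : ℝ≥0∞ :=
  mutualInfo (p.toMeasure.prod (noise N₀)) (fun ω : ℝ × ℝ => ω.1)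
    (fun ω : ℝ × ℝ => √(γ * N₀ / inputPower p) * ω.1 + ω.2)

/-- The output SNR of the unbiased MMSE decision feedback equalizer,
`exp{(1/2π) ∫_{-π}^{π} log(1 + (P_x/N₀) |H(θ)|²) dθ} - 1`. -/
def snrDFEU {L : ℕ} (p : PMF ℝ) (h : Fin L → ℝ) (N₀ : ℝ) : ℝ :=
  Real.exp (1 / (2 * Real.pi) *
    ∫ θ in (-Real.pi)..Real.pi, Real.log (1 + inputPower p / N₀ * ‖transfer h θ‖ ^ 2)) - 1

/-- The Shamai-Laroia expression `I_SL = I_x(SNR_DFE-U)`. -/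
def shamaiLaroia {L : ℕ} (p : PMF ℝ) (h : Fin L → ℝ) (N₀ : ℝ) : ℝ≥0∞ :=
  scalarInfo p N₀ (snrDFEU p h N₀)

/-! ### The two gain factors -/

/-- The gain factor of the zero-forcing DFE,
`g_ZF-DFE = exp{(1/2π) ∫_{-π}^{π} log(|H(θ)|²) dθ}`. -/
def gZFDFE {L : ℕ} (h : Fin L → ℝ) : ℝ :=
  Real.exp (1 / (2 * Real.pi) *
    ∫ θ in (-Real.pi)..Real.pi, Real.log (‖transfer h θ‖ ^ 2))

/-- The channel coefficient `h_k`, extended by zero to all integers `k`. -/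
def tap {L : ℕ} (h : Fin L → ℝ) (k : ℤ) : ℝ :=
  if hk : 0 ≤ k ∧ k < (L : ℤ) then h ⟨k.toNat, by omega⟩ else 0

/-- The squared distance `δ²` of two input words of length `N`, normalized by `d`:
`∑_{k=0}^{L+N-2} |∑_{l=0}^{N-1} ((x_l - x'_l)/d) h_{k-l}|²`. -/
def wordDist {L N : ℕ} (h : Fin L → ℝ) (d : ℝ) (x x' : Fin N → ℝ) : ℝ :=
  ∑ k ∈ Finset.range (L + N - 1),
    |∑ l : Fin N, ((x l - x' l) / d) * tap h ((k : ℤ) - (l : ℤ))| ^ 2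

/-- `δ²_min`: the infimum of `δ²` over all lengths `N = M + 1 ≥ 1` and all pairs of words over the
input alphabet that differ in their first and in their last letter. -/
def deltaMinSq {L : ℕ} (p : PMF ℝ) (h : Fin L → ℝ) : ℝ :=
  sInf {v | ∃ (M : ℕ) (x x' : Fin (M + 1) → ℝ),
    (∀ l, x l ∈ p.support) ∧ (∀ l, x' l ∈ p.support) ∧
    x 0 ≠ x' 0 ∧ x (Fin.last M) ≠ x' (Fin.last M) ∧ v = wordDist h (minDist p) x x'}

end ISI

end

noncomputable section

namespace ISI

/-! ### Divergence and mutual information: variational bound, entropy bound, superadditivity -/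

section InformationTheory

open InformationTheory

/-! Both sides of the comparison are equivocations. The achievable rate loses at most the
equivocation of a genie-aided sequential decoder, governed by the minimum distance of error events.
The Shamai-Laroia expression loses at least the equivocation of a scalar channel, governed by one
pair of closest letters seen through the zero-forcing gain.

Upper bound on H − 𝓘. By the variational formula for the divergence
(`integral_log_le_toReal_klDiv`), a product of soft decisions, each normalised over its own letter
given the past letters, bounds the mutual information of a window from below. Choosing the posterior
of the current letter given the past and the next outputs gives H − 𝓘 ≤ `condEntropy`. This is at
most a sum of Bhattacharyya coefficients, because x·(−log(x/(x+y))) ≤ 2√(xy), and these are expanded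
letter by letter using subadditivity of the square root. The resulting sum over error events of
every length must converge without spoiling the exponent. Once L consecutive letters agree, the
remaining outputs have the same law, so the event is over and its coefficient is 1. In an unfinished
event the next output carries an offset c from the past, which at most one typical letter difference
e can nearly cancel. If e = 0, different letters are suppressed and the event moves one step closer
to its end. If e ≠ 0, equal letters are suppressed and the surviving weight ∑ √(p(a)p(a−e)) is
uniformly below 1. A weight θ^r, with r the number of agreeing letters since the last difference,
turns both cases into one contraction by κ < 1 (`exists_contraction`, `exp_energy_mul_bhatt_le`).
The contraction uses a fixed share `lam` of the Gaussian exponent 1/(8N₀). This costs only a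
constant factor, so the exponent is exact and the polynomial F may be constant.

Comparison of the gains. A word distance is the squared coefficient norm of P·Q, with P the channel
polynomial and Q the normalised difference polynomial, whose first and last coefficients have
modulus at least 1. Reflecting the roots of P in the unit disc preserves this norm and makes the
modulus of the constant coefficient equal to the Mahler measure of P, whose square is g_ZF-DFE. If P
has a nonzero root, the reflected polynomial is not constant, and its leading coefficient adds a
positive amount independent of the words. Otherwise there is a single tap and |H| is constant.

Lower bound on H − I_SL. Near the midpoint of two closest letters both are about equally likely, so
the scalar equivocation is at least c/(1+β)·exp(−β²/8) with β² = SNR·d_min². The equalizer SNR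
exceeds s·g_ZF-DFE by at most K·s^(1−κ), where s = P_x/N₀, because small negative powers of |H| are
integrable.

Finally, if δ²_min > g_ZF-DFE, the exponents differ by a term linear in s, which dominates s^(1−κ).
For a single tap the two quantities are compared directly. -/

theorem rnDeriv_toReal_pos_ae {α : Type*} [MeasurableSpace α] {μ ν : Measure α}
    [SigmaFinite μ] [SigmaFinite ν] (hac : μ ≪ ν) : ∀ᵐ x ∂μ, 0 < (μ.rnDeriv ν x).toReal := by
  filter_upwards [Measure.rnDeriv_pos hac, hac.ae_le (Measure.rnDeriv_lt_top μ ν)] with x h0 h1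
  exact ENNReal.toReal_pos h0.ne' h1.ne

/-- Variational lower bound on the Kullback-Leibler divergence. -/
theorem integral_log_le_toReal_klDiv {α : Type*} [MeasurableSpace α] {μ ν : Measure α}
    [IsProbabilityMeasure μ] [IsProbabilityMeasure ν] (hkl : klDiv μ ν ≠ ∞) {ψ : α → ℝ≥0∞}
    (hψm : Measurable ψ) (hψ : ∫⁻ x, ψ x ∂ν ≤ 1) (hψ0 : ∀ᵐ x ∂μ, ψ x ≠ 0)
    (hint : Integrable (fun x => Real.log (ψ x).toReal) μ) :
    ∫ x, Real.log (ψ x).toReal ∂μ ≤ (klDiv μ ν).toReal := by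
  obtain ⟨hac, hllr⟩ := klDiv_ne_top_iff.1 hkl
  rw [toReal_klDiv_of_measure_eq hac (by simp)]
  have hψtop : ∀ᵐ x ∂μ, ψ x ≠ ∞ := by
    refine hac.ae_le ?_
    filter_upwards [ae_lt_top hψm (hψ.trans_lt ENNReal.one_lt_top).ne] with x hx using hx.ne
  -- The claim then follows by integrating log t ≤ t − 1 with t = ψ/(dμ/dν).
  have hquot : ∫⁻ x, ψ x / μ.rnDeriv ν x ∂μ ≤ 1 := by
    calc ∫⁻ x, ψ x / μ.rnDeriv ν x ∂μ
        = ∫⁻ x, μ.rnDeriv ν x * (ψ x / μ.rnDeriv ν x) ∂ν := by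
          rw [lintegral_rnDeriv_mul hac (by fun_prop)]
      _ ≤ ∫⁻ x, ψ x ∂ν := lintegral_mono fun x => ENNReal.mul_div_le
      _ ≤ 1 := hψ
  have hm : Measurable fun x => ψ x / μ.rnDeriv ν x := by fun_prop
  have hqi : Integrable (fun x => (ψ x / μ.rnDeriv ν x).toReal) μ :=
    integrable_toReal_of_lintegral_ne_top hm.aemeasurable (hquot.trans_lt ENNReal.one_lt_top).ne
  have hq1 : ∫ x, (ψ x / μ.rnDeriv ν x).toReal ∂μ ≤ 1 := by
    rw [integral_toReal hm.aemeasurable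
      (ae_lt_top hm (hquot.trans_lt ENNReal.one_lt_top).ne)]
    exact ENNReal.toReal_le_of_le_ofReal zero_le_one (by simpa using hquot)
  have key : ∫ x, (Real.log (ψ x).toReal - llr μ ν x) ∂μ
      ≤ ∫ x, ((ψ x / μ.rnDeriv ν x).toReal - 1) ∂μ := by
    refine integral_mono_ae (hint.sub hllr) (hqi.sub (integrable_const _)) ?_
    filter_upwards [hψ0, hψtop, rnDeriv_toReal_pos_ae hac] with x h0 ht hr
    have hp : 0 < (ψ x).toReal := ENNReal.toReal_pos h0 ht
    simp only [llr_def]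
    rw [← Real.log_div hp.ne' hr.ne', ENNReal.toReal_div]
    exact Real.log_le_sub_one_of_pos (div_pos hp hr)
  rw [integral_sub hint hllr, integral_sub hqi (integrable_const _), integral_const,
    probReal_univ, one_smul] at key
  linarith

variable {Ω A B : Type*} [MeasurableSpace Ω] [MeasurableSpace A] [MeasurableSpace B]

/-- The mutual information of a discrete random variable with any other one is at most its
entropy. -/
theorem mutualInfo_le_entropy [MeasurableSingletonClass A] {P : Measure Ω} [IsProbabilityMeasure P]
    {X : Ω → A} {Y : Ω → B} (hX : Measurable X) (hY : Measurable Y) {S : Set A} (hS : S.Countable)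
    (hXS : ∀ᵐ ω ∂P, X ω ∈ S) {I : A → ℝ} (hIm : Measurable I)
    (hI : ∀ a, P.map X {a} ≠ 0 → I a = -Real.log (P.map X {a}).toReal)
    (hint : Integrable I (P.map X)) :
    mutualInfo P X Y ≠ ∞ ∧ (mutualInfo P X Y).toReal ≤ ∫ a, I a ∂(P.map X) := by
  set μ := P.map X
  set ν := P.map Y
  set J := P.map fun ω => (X ω, Y ω)
  have : IsProbabilityMeasure μ := Measure.isProbabilityMeasure_map hX.aemeasurable
  have : IsProbabilityMeasure ν := Measure.isProbabilityMeasure_map hY.aemeasurable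
  have hXY : Measurable fun ω => (X ω, Y ω) := hX.prodMk hY
  have : IsProbabilityMeasure J := Measure.isProbabilityMeasure_map hXY.aemeasurable
  have hmapfst : J.map Prod.fst = μ := by
    rw [Measure.map_map measurable_fst hXY]; rfl
  have hμS : ∀ᵐ a ∂μ, a ∈ S := (ae_map_iff hX.aemeasurable hS.measurableSet).2 hXS
  have hwm : Measurable fun z : A × B => ENNReal.ofReal (Real.exp (I z.1)) := by fun_prop
  have hatom : ∀ a, μ {a} ≠ 0 → ENNReal.ofReal (Real.exp (I a)) * μ {a} = 1 := by
    intro a ha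
    have hpos : 0 < (μ {a}).toReal := ENNReal.toReal_pos ha (measure_ne_top _ _)
    rw [hI a ha, Real.exp_neg, Real.exp_log hpos, ENNReal.ofReal_inv_of_pos hpos,
      ENNReal.ofReal_toReal (measure_ne_top _ _), ENNReal.inv_mul_cancel ha (measure_ne_top _ _)]
  -- Since P(X = a, Y ∈ F) ≤ P(Y ∈ F), the joint law has density at most 1/P(X = a) with respect to
  -- the product of the marginals.
  have hle : ∀ E : Set (A × B), MeasurableSet E →
      J E ≤ ∫⁻ z in E, ENNReal.ofReal (Real.exp (I z.1)) ∂(μ.prod ν) := by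
    intro E hE
    have hR : ∫⁻ z in E, ENNReal.ofReal (Real.exp (I z.1)) ∂(μ.prod ν)
        = ∫⁻ a, ENNReal.ofReal (Real.exp (I a)) * ν (Prod.mk a ⁻¹' E) ∂μ := by
      rw [← lintegral_indicator hE, lintegral_prod _ (hwm.indicator hE).aemeasurable]
      refine lintegral_congr fun a => ?_
      have : (fun y => E.indicator (fun z : A × B => ENNReal.ofReal (Real.exp (I z.1))) (a, y))
          = (Prod.mk a ⁻¹' E).indicator fun _ => ENNReal.ofReal (Real.exp (I a)) := by
        ext y
        by_cases hy : (a, y) ∈ E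
        · rw [Set.indicator_of_mem hy, Set.indicator_of_mem (by exact hy)]
        · rw [Set.indicator_of_notMem hy, Set.indicator_of_notMem (by exact hy)]
      rw [this, lintegral_indicator (measurable_prodMk_left hE)]
      simp
    rw [hR, ← Measure.restrict_eq_self_of_ae_mem hμS, lintegral_countable _ hS]
    have hJE : J E ≤ ∑' a : S, P (X ⁻¹' {(a : A)} ∩ Y ⁻¹' (Prod.mk (a : A) ⁻¹' E)) := by
      rw [Measure.map_apply hXY hE]
      have : Countable S := hS.to_subtype
      refine le_trans ?_ (measure_iUnion_le _)
      refine measure_mono_ae ?_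
      filter_upwards [hXS] with ω hω hE'
      exact Set.mem_iUnion.2 ⟨⟨X ω, hω⟩, rfl, hE'⟩
    refine hJE.trans (ENNReal.tsum_le_tsum fun a => ?_)
    by_cases ha : μ {(a : A)} = 0
    · refine le_trans (measure_mono Set.inter_subset_left) ?_
      rw [← Measure.map_apply hX (measurableSet_singleton _)]
      exact ha.le.trans zero_le
    · rw [mul_right_comm, hatom _ ha, one_mul]
      exact (measure_mono Set.inter_subset_right).trans_eq
        (Measure.map_apply hY (measurable_prodMk_left hE)).symm
  have hac : J ≪ μ.prod ν := by
    refine Measure.AbsolutelyContinuous.mk fun E hE h0 => ?_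
    refine le_antisymm ((hle E hE).trans ?_) zero_le
    rw [setLIntegral_measure_zero _ _ h0]
  have hr : ∀ᵐ z ∂(μ.prod ν), J.rnDeriv (μ.prod ν) z ≤ ENNReal.ofReal (Real.exp (I z.1)) := by
    refine ae_le_of_forall_setLIntegral_le_of_sigmaFinite (Measure.measurable_rnDeriv _ _) ?_
    intro E hE _
    rw [Measure.setLIntegral_rnDeriv hac]
    exact hle E hE
  have hintJ : Integrable (fun z : A × B => I z.1) J := by
    rw [← hmapfst] at hint
    exact (integrable_map_measure hIm.aestronglyMeasurable measurable_fst.aemeasurable).1 hint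
  have hfin : mutualInfo P X Y ≠ ∞ := by
    unfold mutualInfo
    rw [klDiv_eq_lintegral_klFun_of_ac hac]
    -- Integrability of the log-likelihood ratio is not yet available, so finiteness goes through
    -- the nonnegative integrand t log t + 1 − t, where log t ≤ |I|.
    have hb : ∀ᵐ z ∂(μ.prod ν), ENNReal.ofReal (klFun (J.rnDeriv (μ.prod ν) z).toReal)
        ≤ J.rnDeriv (μ.prod ν) z * ENNReal.ofReal |I z.1| + 1 := by
      filter_upwards [hr] with z hz
      have hrt : J.rnDeriv (μ.prod ν) z ≠ ∞ := (hz.trans_lt ENNReal.ofReal_lt_top).ne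
      rw [← ENNReal.ofReal_toReal hrt, ENNReal.toReal_ofReal ENNReal.toReal_nonneg,
        ← ENNReal.ofReal_mul ENNReal.toReal_nonneg, ← ENNReal.ofReal_one,
        ← ENNReal.ofReal_add (by positivity) zero_le_one]
      refine ENNReal.ofReal_le_ofReal ?_
      have hz' : (J.rnDeriv (μ.prod ν) z).toReal ≤ Real.exp (I z.1) :=
        ENNReal.toReal_le_of_le_ofReal (Real.exp_pos _).le hz
      set t := (J.rnDeriv (μ.prod ν) z).toReal
      have ht0 : 0 ≤ t := ENNReal.toReal_nonneg
      rw [klFun_apply]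
      rcases ht0.eq_or_lt with h | h
      · rw [← h]; simp
      · have : Real.log t ≤ |I z.1| :=
          ((Real.log_le_iff_le_exp h).2 hz').trans (le_abs_self _)
        nlinarith
    refine ((lintegral_mono_ae hb).trans_lt ?_).ne
    rw [lintegral_add_right _ measurable_const, lintegral_rnDeriv_mul hac (by fun_prop)]
    simp only [lintegral_const, measure_univ, mul_one]
    refine ENNReal.add_lt_top.2 ⟨?_, ENNReal.one_lt_top⟩
    have := hintJ.2
    simpa [HasFiniteIntegral, ← ofReal_norm] using this
  refine ⟨hfin, ?_⟩
  obtain ⟨_, hllr⟩ := klDiv_ne_top_iff.1 hfin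
  unfold mutualInfo
  rw [toReal_klDiv_of_measure_eq hac (by simp)]
  have hIJ : ∫ a, I a ∂μ = ∫ z, I z.1 ∂J := by
    rw [← hmapfst, integral_map measurable_fst.aemeasurable hIm.aestronglyMeasurable]
  rw [hIJ]
  refine integral_mono_ae hllr hintJ ?_
  filter_upwards [hac.ae_le hr, rnDeriv_toReal_pos_ae hac] with z hz hpos
  exact (Real.log_le_iff_le_exp hpos).2 (ENNReal.toReal_le_of_le_ofReal (Real.exp_pos _).le hz)

/-- Data processing: divergence does not grow under a measurable map, and a product map sends the
product of the marginals to the product of the new marginals. -/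
theorem mutualInfo_comp_le {A' B' : Type*} [MeasurableSpace A'] [MeasurableSpace B']
    {P : Measure Ω} [IsProbabilityMeasure P] {X : Ω → A} {Y : Ω → B} (hX : Measurable X)
    (hY : Measurable Y) {f : A → A'} {g : B → B'} (hf : Measurable f) (hg : Measurable g) :
    mutualInfo P (fun ω => f (X ω)) (fun ω => g (Y ω)) ≤ mutualInfo P X Y := by
  have : IsProbabilityMeasure (P.map X) := Measure.isProbabilityMeasure_map hX.aemeasurable
  have : IsProbabilityMeasure (P.map Y) := Measure.isProbabilityMeasure_map hY.aemeasurable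
  have : IsProbabilityMeasure (P.map fun ω => (X ω, Y ω)) :=
    Measure.isProbabilityMeasure_map (hX.prodMk hY).aemeasurable
  have h := klDiv_map_le (P.map fun ω => (X ω, Y ω)) ((P.map X).prod (P.map Y))
    (hf.prodMap hg)
  rw [Measure.map_map (hf.prodMap hg) (hX.prodMk hY), ← Measure.map_prod_map _ _ hf hg,
    Measure.map_map hf hX, Measure.map_map hg hY] at h
  exact h

/-- Test by integrating over sets of second coordinates, on which J has mass ν(S). This fibrewise
normalisation allows products of densities as test functions in the variational bound. -/
theorem lintegral_rnDeriv_fst_le_one {J : Measure (A × B)} {μ : Measure A} {ν : Measure B}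
    [IsProbabilityMeasure J] [IsProbabilityMeasure μ] [IsProbabilityMeasure ν]
    (hJ : J.map Prod.snd = ν) :
    ∀ᵐ b ∂ν, ∫⁻ a, J.rnDeriv (μ.prod ν) (a, b) ∂μ ≤ 1 := by
  have hm : Measurable fun b => ∫⁻ a, J.rnDeriv (μ.prod ν) (a, b) ∂μ :=
    (Measure.measurable_rnDeriv _ _).lintegral_prod_left'
  refine ae_le_of_forall_setLIntegral_le_of_sigmaFinite hm fun S hS _ => ?_
  calc ∫⁻ b in S, ∫⁻ a, J.rnDeriv (μ.prod ν) (a, b) ∂μ ∂ν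
      = ∫⁻ z in Set.univ ×ˢ S, J.rnDeriv (μ.prod ν) z ∂(μ.prod ν) := by
        rw [← Measure.prod_restrict, Measure.restrict_univ,
          lintegral_prod_symm' _ (Measure.measurable_rnDeriv _ _)]
    _ ≤ J (Set.univ ×ˢ S) := Measure.setLIntegral_rnDeriv_le _
    _ = ∫⁻ b in S, 1 ∂ν := by
        rw [← hJ, setLIntegral_one, Measure.map_apply measurable_snd hS]
        congr 1; ext z; simp

/-- Superadditivity of mutual information over independent input blocks. -/
theorem mutualInfo_add_le {A₁ A₂ B₁ B₂ : Type*} [MeasurableSpace A₁] [MeasurableSpace A₂]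
    [MeasurableSpace B₁] [MeasurableSpace B₂] {P : Measure Ω} [IsProbabilityMeasure P]
    {X : Ω → A} {Y : Ω → B} (hX : Measurable X) (hY : Measurable Y)
    {f₁ : A → A₁} {f₂ : A → A₂} {g₁ : B → B₁} {g₂ : B → B₂} (hf₁ : Measurable f₁)
    (hf₂ : Measurable f₂) (hg₁ : Measurable g₁) (hg₂ : Measurable g₂)
    (hind : IndepFun (fun ω => f₁ (X ω)) (fun ω => f₂ (X ω)) P)
    (h : mutualInfo P X Y ≠ ∞) :
    (mutualInfo P (fun ω => f₁ (X ω)) (fun ω => g₁ (Y ω))).toReal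
      + (mutualInfo P (fun ω => f₂ (X ω)) (fun ω => g₂ (Y ω))).toReal
      ≤ (mutualInfo P X Y).toReal := by
  have hXY : Measurable fun ω => (X ω, Y ω) := hX.prodMk hY
  have hX₁ : Measurable fun ω => f₁ (X ω) := hf₁.comp hX
  have hX₂ : Measurable fun ω => f₂ (X ω) := hf₂.comp hX
  have hY₁ : Measurable fun ω => g₁ (Y ω) := hg₁.comp hY
  have hY₂ : Measurable fun ω => g₂ (Y ω) := hg₂.comp hY
  have h₁ := ((mutualInfo_comp_le (P := P) hX hY hf₁ hg₁).trans_lt h.lt_top).ne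
  have h₂ := ((mutualInfo_comp_le (P := P) hX hY hf₂ hg₂).trans_lt h.lt_top).ne
  have : IsProbabilityMeasure (P.map X) := Measure.isProbabilityMeasure_map hX.aemeasurable
  have : IsProbabilityMeasure (P.map Y) := Measure.isProbabilityMeasure_map hY.aemeasurable
  have : IsProbabilityMeasure (P.map fun ω => f₁ (X ω)) :=
    Measure.isProbabilityMeasure_map hX₁.aemeasurable
  have : IsProbabilityMeasure (P.map fun ω => f₂ (X ω)) :=
    Measure.isProbabilityMeasure_map hX₂.aemeasurable
  have : IsProbabilityMeasure (P.map fun ω => g₁ (Y ω)) :=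
    Measure.isProbabilityMeasure_map hY₁.aemeasurable
  have : IsProbabilityMeasure (P.map fun ω => g₂ (Y ω)) :=
    Measure.isProbabilityMeasure_map hY₂.aemeasurable
  have : IsProbabilityMeasure (P.map fun ω => (X ω, Y ω)) :=
    Measure.isProbabilityMeasure_map hXY.aemeasurable
  have hXY₁ : Measurable fun ω => (f₁ (X ω), g₁ (Y ω)) := hX₁.prodMk hY₁
  have hXY₂ : Measurable fun ω => (f₂ (X ω), g₂ (Y ω)) := hX₂.prodMk hY₂
  have : IsProbabilityMeasure (P.map fun ω => (f₁ (X ω), g₁ (Y ω))) :=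
    Measure.isProbabilityMeasure_map hXY₁.aemeasurable
  have : IsProbabilityMeasure (P.map fun ω => (f₂ (X ω), g₂ (Y ω))) :=
    Measure.isProbabilityMeasure_map hXY₂.aemeasurable
  obtain ⟨hac₁, hllr₁⟩ := klDiv_ne_top_iff.1 h₁
  obtain ⟨hac₂, hllr₂⟩ := klDiv_ne_top_iff.1 h₂
  set r₁ := (P.map fun ω => (f₁ (X ω), g₁ (Y ω))).rnDeriv
    ((P.map fun ω => f₁ (X ω)).prod (P.map fun ω => g₁ (Y ω))) with hr₁
  set r₂ := (P.map fun ω => (f₂ (X ω), g₂ (Y ω))).rnDeriv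
    ((P.map fun ω => f₂ (X ω)).prod (P.map fun ω => g₂ (Y ω))) with hr₂
  have hm₁ : Measurable r₁ := Measure.measurable_rnDeriv _ _
  have hm₂ : Measurable r₂ := Measure.measurable_rnDeriv _ _
  have hlog₁ : Integrable (fun ω => Real.log (r₁ (f₁ (X ω), g₁ (Y ω))).toReal) P :=
    (integrable_map_measure (by fun_prop) hXY₁.aemeasurable).1 hllr₁
  have hlog₂ : Integrable (fun ω => Real.log (r₂ (f₂ (X ω), g₂ (Y ω))).toReal) P :=
    (integrable_map_measure (by fun_prop) hXY₂.aemeasurable).1 hllr₂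
  have hpos₁ : ∀ᵐ ω ∂P, 0 < (r₁ (f₁ (X ω), g₁ (Y ω))).toReal :=
    ae_of_ae_map hXY₁.aemeasurable (rnDeriv_toReal_pos_ae hac₁)
  have hpos₂ : ∀ᵐ ω ∂P, 0 < (r₂ (f₂ (X ω), g₂ (Y ω))).toReal :=
    ae_of_ae_map hXY₂.aemeasurable (rnDeriv_toReal_pos_ae hac₂)
  -- The test function is the product of the two block densities. For fixed outputs its integral
  -- over the inputs factors by independence of the input blocks, and each factor is at most 1.
  set ψ : A × B → ℝ≥0∞ := fun z => r₁ (f₁ z.1, g₁ z.2) * r₂ (f₂ z.1, g₂ z.2) with hψ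
  have hψm : Measurable ψ := by fun_prop
  have hlog : (fun ω => Real.log (ψ (X ω, Y ω)).toReal) =ᵐ[P] fun ω =>
      Real.log (r₁ (f₁ (X ω), g₁ (Y ω))).toReal + Real.log (r₂ (f₂ (X ω), g₂ (Y ω))).toReal := by
    filter_upwards [hpos₁, hpos₂] with ω h1 h2
    simp only [hψ, ENNReal.toReal_mul]
    exact Real.log_mul h1.ne' h2.ne'
  have hψ1 : ∫⁻ z, ψ z ∂((P.map X).prod (P.map Y)) ≤ 1 := by
    rw [lintegral_prod_symm' _ hψm]
    have hb₁ : ∀ᵐ y ∂(P.map Y), ∫⁻ a, r₁ (a, g₁ y) ∂(P.map fun ω => f₁ (X ω)) ≤ 1 := by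
      refine ae_of_ae_map (f := g₁)
        (p := fun b => ∫⁻ a, r₁ (a, b) ∂(P.map fun ω => f₁ (X ω)) ≤ 1) hg₁.aemeasurable ?_
      rw [Measure.map_map hg₁ hY]
      refine lintegral_rnDeriv_fst_le_one ?_
      rw [Measure.map_map measurable_snd hXY₁]; rfl
    have hb₂ : ∀ᵐ y ∂(P.map Y), ∫⁻ a, r₂ (a, g₂ y) ∂(P.map fun ω => f₂ (X ω)) ≤ 1 := by
      refine ae_of_ae_map (f := g₂)
        (p := fun b => ∫⁻ a, r₂ (a, b) ∂(P.map fun ω => f₂ (X ω)) ≤ 1) hg₂.aemeasurable ?_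
      rw [Measure.map_map hg₂ hY]
      refine lintegral_rnDeriv_fst_le_one ?_
      rw [Measure.map_map measurable_snd hXY₂]; rfl
    calc ∫⁻ y, ∫⁻ x, ψ (x, y) ∂(P.map X) ∂(P.map Y) ≤ ∫⁻ y, 1 ∂(P.map Y) := by
          refine lintegral_mono_ae ?_
          filter_upwards [hb₁, hb₂] with y h1 h2
          rw [lintegral_map (by fun_prop) hX]
          simp only [hψ]
          rw [lintegral_map (by fun_prop) hX₁] at h1
          rw [lintegral_map (by fun_prop) hX₂] at h2
          have hi : IndepFun (fun ω => r₁ (f₁ (X ω), g₁ y)) (fun ω => r₂ (f₂ (X ω), g₂ y)) P :=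
            hind.comp (φ := fun a => r₁ (a, g₁ y)) (ψ := fun a => r₂ (a, g₂ y))
              (by fun_prop) (by fun_prop)
          rw [lintegral_mul_eq_lintegral_mul_lintegral_of_indepFun'' (by fun_prop) (by fun_prop) hi]
          exact mul_le_one' h1 h2
      _ = 1 := by simp
  have hint : Integrable (fun ω => Real.log (ψ (X ω, Y ω)).toReal) P :=
    (integrable_congr hlog).2 (hlog₁.add hlog₂)
  have hψlog : Measurable fun z => Real.log (ψ z).toReal :=
    Real.measurable_log.comp hψm.ennreal_toReal
  have hmain := integral_log_le_toReal_klDiv h hψm hψ1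
    ((ae_map_iff hXY.aemeasurable (hψm (measurableSet_singleton 0).compl)).2 (by
      filter_upwards [hpos₁, hpos₂] with ω h1 h2
      exact mul_ne_zero (fun h0 => by simp [h0] at h1) (fun h0 => by simp [h0] at h2)))
    ((integrable_map_measure hψlog.aestronglyMeasurable hXY.aemeasurable).2 hint)
  rw [integral_map hXY.aemeasurable hψlog.aestronglyMeasurable, integral_congr_ae hlog,
    integral_add hlog₁ hlog₂] at hmain
  refine le_trans (le_of_eq ?_) hmain
  unfold mutualInfo
  rw [toReal_klDiv_of_measure_eq hac₁ (by simp), toReal_klDiv_of_measure_eq hac₂ (by simp),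
    integral_map hXY₁.aemeasurable (by fun_prop), integral_map hXY₂.aemeasurable (by fun_prop)]
  rfl

end InformationTheory

/-! ### The channel: stationarity, existence of the rate, bounds from sequential decoders -/

section Model

variable (p : PMF ℝ)

/-- The self-information `-log p(a)` of an input value. -/
def selfInfo (a : ℝ) : ℝ := -Real.log (p a).toReal

theorem selfInfo_nonneg (a : ℝ) : 0 ≤ selfInfo p a :=
  neg_nonneg.2 (Real.log_nonpos ENNReal.toReal_nonneg
    (ENNReal.toReal_le_of_le_ofReal zero_le_one (by simpa using p.coe_le_one a)))

/-- Such a function differs from a constant only on a countable set. For `selfInfo` the vanishing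
off the support comes from the convention log 0 = 0. -/
theorem measurable_of_support {f : ℝ → ℝ} (hf : ∀ a ∉ p.support, f a = 0) : Measurable f := by
  refine (measurable_const (a := (0 : ℝ))).measurable_of_countable_ne
    (p.support_countable.mono fun a ha => ?_)
  by_contra h
  exact ha (hf a h).symm

theorem measurable_selfInfo : Measurable (selfInfo p) :=
  measurable_of_support p fun a ha => by
    rw [PMF.mem_support_iff, not_not] at ha
    simp [selfInfo, ha]

instance : Countable p.support := p.support_countable.to_subtype

theorem lintegral_toMeasure (f : ℝ → ℝ≥0∞) :
    ∫⁻ a, f a ∂p.toMeasure = ∑' a : p.support, p a * f a := by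
  rw [← p.restrict_toMeasure_support, lintegral_countable _ p.support_countable]
  refine tsum_congr fun a => ?_
  rw [p.toMeasure_apply_singleton _ (measurableSet_singleton _), mul_comm]

theorem tsum_support : ∑' a : p.support, p a = 1 := by
  have := lintegral_toMeasure p 1
  simpa using this.symm

theorem ae_mem_support : ∀ᵐ a ∂p.toMeasure, a ∈ p.support := by
  rw [ae_iff]
  refine (p.toMeasure_apply_eq_zero_iff p.support_countable.measurableSet.compl).2 ?_
  exact disjoint_compl_right

theorem integrable_selfInfo (hentropy : Summable (entropyTerm p)) :
    Integrable (selfInfo p) p.toMeasure := by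
  refine ⟨(measurable_selfInfo p).aestronglyMeasurable, ?_⟩
  have : ∀ a : p.support, p a * ‖selfInfo p a‖ₑ = ENNReal.ofReal (entropyTerm p a) := by
    intro a
    have h0 := selfInfo_nonneg p a
    have h1 : entropyTerm p a = (p a).toReal * selfInfo p a := by
      simp only [selfInfo, entropyTerm, Real.negMulLog]
      ring
    rw [Real.enorm_eq_ofReal h0, h1, ENNReal.ofReal_mul ENNReal.toReal_nonneg,
      ENNReal.ofReal_toReal (p.apply_ne_top (a : ℝ))]
  rw [HasFiniteIntegral, lintegral_toMeasure]
  simp_rw [this]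
  exact (hentropy.subtype _).tsum_ofReal_lt_top

theorem inputEntropy_eq (hentropy : Summable (entropyTerm p)) :
    inputEntropy p = ∫ a, selfInfo p a ∂p.toMeasure := by
  rw [PMF.integral_eq_tsum p _ (integrable_selfInfo p hentropy)]
  refine tsum_congr fun a => ?_
  simp only [selfInfo, entropyTerm, Real.negMulLog, smul_eq_mul]
  ring

theorem inputEntropy_nonneg (hentropy : Summable (entropyTerm p)) : 0 ≤ inputEntropy p := by
  rw [inputEntropy_eq p hentropy]
  exact integral_nonneg (selfInfo_nonneg p)

variable {L : ℕ} (h : Fin L → ℝ) (N₀ : ℝ)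

instance : IsProbabilityMeasure (channelLaw p N₀) := by
  unfold channelLaw; infer_instance

theorem measurable_output (k : ℤ) : Measurable (output h k) := by
  unfold output; fun_prop

/-- The time shift of the input and noise sequences. -/
def shift (k : ℤ) (ω : (ℤ → ℝ) × (ℤ → ℝ)) : (ℤ → ℝ) × (ℤ → ℝ) :=
  (fun i => ω.1 (i + k), fun i => ω.2 (i + k))

theorem measurable_shift (k : ℤ) : Measurable (shift k) := by
  unfold shift; fun_prop

/-- For i.i.d. sequences every injective choice of coordinates has the same kind of law. Shift
invariance and the laws of finite windows are both instances. -/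
theorem map_coords_channelLaw {ι κ : Type*} {f : ι → ℤ} {g : κ → ℤ}
    (hf : Function.Injective f) (hg : Function.Injective g) :
    (channelLaw p N₀).map (fun ω => ((fun i => ω.1 (f i) : ι → ℝ), (fun i => ω.2 (g i) : κ → ℝ)))
      = (Measure.infinitePi fun _ : ι => p.toMeasure).prod
        (Measure.infinitePi fun _ : κ => noise N₀) := by
  rw [← Measure.map_infinitePi_infinitePi_of_inj (P := fun _ : ℤ => p.toMeasure) hf,
    ← Measure.map_infinitePi_infinitePi_of_inj (P := fun _ : ℤ => noise N₀) hg,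
    Measure.map_prod_map _ _ (by fun_prop) (by fun_prop)]
  rfl

theorem map_shift_channelLaw (k : ℤ) : (channelLaw p N₀).map (shift k) = channelLaw p N₀ :=
  map_coords_channelLaw p N₀ (add_left_injective k) (add_left_injective k)

theorem output_shift (k i : ℤ) (ω : (ℤ → ℝ) × (ℤ → ℝ)) :
    output h i (shift k ω) = output h (i + k) ω := by
  simp only [output, shift]
  congr 1
  refine Finset.sum_congr rfl fun j _ => ?_
  rw [sub_add_eq_add_sub]

/-- The inputs in a finite window. -/
def windowIn (s : Finset ℤ) (ω : (ℤ → ℝ) × (ℤ → ℝ)) (k : s) : ℝ := ω.1 k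

/-- The outputs in a finite window. -/
def windowOut (s : Finset ℤ) (ω : (ℤ → ℝ) × (ℤ → ℝ)) (k : s) : ℝ := output h k ω

theorem measurable_windowIn (s : Finset ℤ) : Measurable (windowIn s) := by
  unfold windowIn; fun_prop

theorem measurable_windowOut (s : Finset ℤ) : Measurable (windowOut h s) :=
  measurable_pi_lambda _ fun k => measurable_output h k

/-- The mutual information of the inputs and the outputs in a finite window. -/
def windowInfo (s : Finset ℤ) : ℝ≥0∞ :=
  mutualInfo (channelLaw p N₀) (windowIn s) (windowOut h s)

theorem map_windowIn (s : Finset ℤ) :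
    (channelLaw p N₀).map (windowIn s) = Measure.pi fun _ : s => p.toMeasure := by
  have h1 : (channelLaw p N₀).map (windowIn s)
      = ((channelLaw p N₀).map Prod.fst).map (fun x (k : s) => x k) := by
    rw [Measure.map_map (by fun_prop) measurable_fst]; rfl
  rw [h1, channelLaw, Measure.map_fst_prod, measure_univ, one_smul,
    Measure.map_infinitePi_infinitePi_of_inj (P := fun _ : ℤ => p.toMeasure)
      (Subtype.val_injective), Measure.infinitePi_eq_pi]

theorem windowInfo_le (hentropy : Summable (entropyTerm p)) (s : Finset ℤ) :
    windowInfo p h N₀ s ≠ ∞ ∧ (windowInfo p h N₀ s).toReal ≤ s.card * inputEntropy p := by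
  have hmap := map_windowIn p N₀ s
  have hi : ∀ k : s, Integrable (fun a : s → ℝ => selfInfo p (a k))
      (Measure.pi fun _ : s => p.toMeasure) := fun k =>
    (measurePreserving_eval (fun _ : s => p.toMeasure) k).integrable_comp_of_integrable
      (integrable_selfInfo p hentropy)
  have hval : ∫ a : s → ℝ, ∑ k, selfInfo p (a k) ∂(Measure.pi fun _ : s => p.toMeasure)
      = s.card * inputEntropy p := by
    rw [integral_finsetSum _ fun k _ => hi k]
    have : ∀ k : s, ∫ a : s → ℝ, selfInfo p (a k) ∂(Measure.pi fun _ : s => p.toMeasure)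
        = inputEntropy p := by
      intro k
      rw [inputEntropy_eq p hentropy]
      conv_rhs => rw [← (measurePreserving_eval (fun _ : s => p.toMeasure) k).map_eq]
      rw [integral_map (measurable_pi_apply k).aemeasurable
        (measurable_selfInfo p).aestronglyMeasurable]
    simp [this]
  rw [← hval, ← hmap]
  refine mutualInfo_le_entropy (measurable_windowIn s) (measurable_windowOut h s)
    (S := {a | ∀ k, a k ∈ p.support}) ?_ ?_ ?_ ?_ ?_
  · exact Set.countable_pi fun _ : s => p.support_countable
  · refine ae_of_ae_map (measurable_windowIn s).aemeasurable
      (p := fun a : s → ℝ => ∀ k, a k ∈ p.support) ?_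
    rw [hmap]
    refine ae_all_iff.2 fun k => ?_
    exact (measurePreserving_eval (fun _ : s => p.toMeasure) k).quasiMeasurePreserving.ae
      (ae_mem_support p)
  · have := measurable_selfInfo p
    fun_prop
  · intro a ha
    have hs : (Measure.pi fun _ : s => p.toMeasure) {a} = ∏ k, p (a k) := by
      rw [Measure.pi_singleton]
      exact Finset.prod_congr rfl fun k _ =>
        p.toMeasure_apply_singleton _ (measurableSet_singleton _)
    rw [hmap, hs] at ha ⊢
    rw [ENNReal.toReal_prod, Real.log_prod]
    · simp [selfInfo]
    · intro k hk
      refine (ENNReal.toReal_pos (fun h0 => ha ?_) (p.apply_ne_top _)).ne'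
      exact Finset.prod_eq_zero hk h0
  · rw [hmap]
    exact integrable_finsetSum _ fun k _ => hi k

theorem windowInfo_add_le (hentropy : Summable (entropyTerm p)) {s t : Finset ℤ}
    (hst : Disjoint s t) :
    (windowInfo p h N₀ s).toReal + (windowInfo p h N₀ t).toReal
      ≤ (windowInfo p h N₀ (s ∪ t)).toReal := by
  have hind : IndepFun (windowIn s) (windowIn t) (channelLaw p N₀) := by
    have h0 : iIndepFun (fun (i : ℤ) (x : ℤ → ℝ) => x i)
        (Measure.infinitePi fun _ : ℤ => p.toMeasure) :=
      iIndepFun_infinitePi (X := fun (_ : ℤ) (x : ℝ) => x) (fun _ => measurable_id)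
    have h1 := h0.indepFun_finset s t hst (fun i => measurable_pi_apply i)
    have h2 : (channelLaw p N₀).map Prod.fst = Measure.infinitePi fun _ : ℤ => p.toMeasure := by
      rw [channelLaw, Measure.map_fst_prod, measure_univ, one_smul]
    have h3 : MeasurePreserving Prod.fst (channelLaw p N₀)
        (Measure.infinitePi fun _ : ℤ => p.toMeasure) := ⟨measurable_fst, h2⟩
    have hms : Measurable fun (x : ℤ → ℝ) (i : s) => x i := by fun_prop
    have hmt : Measurable fun (x : ℤ → ℝ) (i : t) => x i := by fun_prop
    rw [indepFun_iff_measure_inter_preimage_eq_mul] at h1 ⊢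
    intro u v hu hv
    have := h1 u v hu hv
    rw [← h3.measure_preimage ((hms hu).inter (hmt hv)).nullMeasurableSet,
      ← h3.measure_preimage (hms hu).nullMeasurableSet,
      ← h3.measure_preimage (hmt hv).nullMeasurableSet] at this
    exact this
  exact mutualInfo_add_le (measurable_windowIn (s ∪ t)) (measurable_windowOut h (s ∪ t))
    (f₁ := Finset.restrict₂ (π := fun _ => ℝ) Finset.subset_union_left)
    (f₂ := Finset.restrict₂ (π := fun _ => ℝ) Finset.subset_union_right)
    (g₁ := Finset.restrict₂ (π := fun _ => ℝ) Finset.subset_union_left)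
    (g₂ := Finset.restrict₂ (π := fun _ => ℝ) Finset.subset_union_right)
    (Finset.measurable_restrict₂ _) (Finset.measurable_restrict₂ _)
    (Finset.measurable_restrict₂ _) (Finset.measurable_restrict₂ _) hind
    (windowInfo_le p h N₀ hentropy _).1

theorem mutualInfo_comp_measurePreserving {Ω Ω' A B : Type*} [MeasurableSpace Ω]
    [MeasurableSpace Ω'] [MeasurableSpace A] [MeasurableSpace B] {P : Measure Ω} {Q : Measure Ω'}
    {φ : Ω → Ω'} (hφ : MeasurePreserving φ P Q) {X : Ω' → A} {Y : Ω' → B} (hX : Measurable X)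
    (hY : Measurable Y) :
    mutualInfo P (fun ω => X (φ ω)) (fun ω => Y (φ ω)) = mutualInfo Q X Y := by
  unfold mutualInfo
  rw [← hφ.map_eq, Measure.map_map hX hφ.measurable, Measure.map_map hY hφ.measurable,
    Measure.map_map (hX.prodMk hY) hφ.measurable]
  rfl

/-- A shifted window is a relabelling of the original one under a law-preserving shift, so data
processing applies. Using it in both directions yields equality. -/
theorem windowInfo_Ico_le (a k : ℤ) (n : ℕ) :
    windowInfo p h N₀ (Finset.Ico a (a + n)) ≤ windowInfo p h N₀ (Finset.Ico (a + k) (a + k + n)) := by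
  have hmp : MeasurePreserving (shift k) (channelLaw p N₀) (channelLaw p N₀) :=
    ⟨measurable_shift k, map_shift_channelLaw p N₀ k⟩
  unfold windowInfo
  rw [← mutualInfo_comp_measurePreserving hmp (measurable_windowIn _) (measurable_windowOut h _)]
  let f : (Finset.Ico (a + k) (a + k + n) → ℝ) → (Finset.Ico a (a + n) → ℝ) := fun x i =>
    x ⟨i + k, by
      have := Finset.mem_Ico.1 i.2
      exact Finset.mem_Ico.2 ⟨by omega, by omega⟩⟩
  have hf : Measurable f := by fun_prop
  have hin : (fun ω => windowIn (Finset.Ico a (a + n)) (shift k ω))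
      = fun ω => f (windowIn (Finset.Ico (a + k) (a + k + n)) ω) := rfl
  have hout : (fun ω => windowOut h (Finset.Ico a (a + n)) (shift k ω))
      = fun ω => f (windowOut h (Finset.Ico (a + k) (a + k + n)) ω) := by
    funext ω i
    exact output_shift h k i ω
  rw [hin, hout]
  exact mutualInfo_comp_le (measurable_windowIn _) (measurable_windowOut h _) hf hf

theorem windowInfo_Ico (a b : ℤ) (n : ℕ) :
    windowInfo p h N₀ (Finset.Ico a (a + n)) = windowInfo p h N₀ (Finset.Ico b (b + n)) := by
  refine le_antisymm ?_ ?_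
  · have := windowInfo_Ico_le p h N₀ a (b - a) n
    rwa [add_sub_cancel] at this
  · have := windowInfo_Ico_le p h N₀ b (a - b) n
    rwa [add_sub_cancel] at this

theorem blockInfo_eq_windowInfo (N : ℕ) :
    blockInfo p h N₀ N = windowInfo p h N₀ (Finset.Icc (-(N : ℤ)) N) := rfl

/-- Fekete's lemma: window information is superadditive and shift invariant, and at most the entropy
times the length. The symmetric blocks form the subsequence of odd lengths. -/
theorem tendsto_blockRate (hentropy : Summable (entropyTerm p)) :
    Tendsto (blockRate p h N₀) atTop (𝓝 (achievableRate p h N₀)) := by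
  let u : ℕ → ℝ := fun n => -(windowInfo p h N₀ (Finset.Ico 0 (0 + (n : ℤ)))).toReal
  have hsub : Subadditive u := by
    intro m n
    have hd : Disjoint (Finset.Ico (0 : ℤ) (0 + (m : ℤ))) (Finset.Ico (m : ℤ) (m + n)) := by
      rw [Finset.disjoint_left]
      intro x hx hx'
      rw [Finset.mem_Ico] at hx hx'
      omega
    have hU : Finset.Ico (0 : ℤ) (0 + (m : ℤ)) ∪ Finset.Ico (m : ℤ) (m + n)
        = Finset.Ico (0 : ℤ) (0 + ((m + n : ℕ) : ℤ)) := by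
      ext x
      simp only [Finset.mem_union, Finset.mem_Ico]
      omega
    have := windowInfo_add_le p h N₀ hentropy hd
    rw [hU, windowInfo_Ico p h N₀ m 0 n] at this
    simp only [u]
    linarith
  have hbdd : BddBelow (Set.range fun n => u n / n) := by
    refine ⟨-inputEntropy p, ?_⟩
    rintro _ ⟨n, rfl⟩
    have h1 := (windowInfo_le p h N₀ hentropy (Finset.Ico 0 (0 + (n : ℤ)))).2
    have h2 : (Finset.Ico (0 : ℤ) (0 + (n : ℤ))).card = n := by simp
    rw [h2] at h1
    rcases Nat.eq_zero_or_pos n with rfl | hn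
    · simpa using inputEntropy_nonneg p hentropy
    · have hn' : (0 : ℝ) < n := by exact_mod_cast hn
      simp only [u]
      rw [le_div_iff₀ hn']
      linarith
  have hlim : Tendsto (blockRate p h N₀) atTop (𝓝 (-hsub.lim)) := by
    have h1 := ((hsub.tendsto_lim hbdd).neg).comp
      (tendsto_atTop_mono (fun n => by dsimp only [id]; omega) tendsto_id : Tendsto (fun N : ℕ => 2 * N + 1) atTop atTop)
    refine h1.congr fun N => ?_
    have h2 : Finset.Icc (-(N : ℤ)) N = Finset.Ico (-(N : ℤ)) (-(N : ℤ) + ((2 * N + 1 : ℕ) : ℤ)) := by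
      ext x
      simp only [Finset.mem_Icc, Finset.mem_Ico]
      omega
    simp only [Function.comp, u, blockRate]
    rw [blockInfo_eq_windowInfo, h2, windowInfo_Ico p h N₀ (-(N : ℤ)) 0]
    push_cast
    ring
  unfold achievableRate
  rwa [hlim.limUnder_eq]

/-- The largest coordinate is integrated out first: only the factor with that index depends on it,
and this factor integrates to at most 1. -/
theorem lmarginal_prod_le_one {ι : Type*} [Fintype ι] [LinearOrder ι] (μ : Measure ℝ)
    [IsProbabilityMeasure μ] (ψ : ι → (ι → ℝ) → ℝ≥0∞) (T : Finset ι)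
    (hm : ∀ k ∈ T, Measurable (ψ k))
    (hpast : ∀ k ∈ T, ∀ i, k < i → ∀ x v, ψ k (Function.update x i v) = ψ k x)
    (hone : ∀ k ∈ T, ∀ x, ∫⁻ v, ψ k (Function.update x k v) ∂μ ≤ 1) (x : ι → ℝ) :
    (∫⋯∫⁻_T, (fun x => ∏ k ∈ T, ψ k x) ∂(fun _ => μ)) x ≤ 1 := by
  induction T using Finset.induction_on_max generalizing x with
  | empty => simp
  | insert a s ha ih =>
    have has : a ∉ s := fun h => lt_irrefl _ (ha a h)
    have hms : ∀ k ∈ s, Measurable (ψ k) := fun k hk => hm k (Finset.mem_insert_of_mem hk)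
    have hmp : Measurable fun x => ∏ k ∈ insert a s, ψ k x :=
      Finset.measurable_fun_prod _ fun k hk => hm k hk
    rw [lmarginal_insert' _ hmp has]
    refine le_trans (lmarginal_mono (fun x => ?_) x)
      (ih hms (fun k hk => hpast k (Finset.mem_insert_of_mem hk))
        (fun k hk => hone k (Finset.mem_insert_of_mem hk)) x)
    have hma := hm a (Finset.mem_insert_self a s)
    calc ∫⁻ v, ∏ k ∈ insert a s, ψ k (Function.update x a v) ∂μ
        = ∫⁻ v, ψ a (Function.update x a v) * ∏ k ∈ s, ψ k x ∂μ := by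
          refine lintegral_congr fun v => ?_
          rw [Finset.prod_insert has]
          congr 1
          exact Finset.prod_congr rfl fun k hk =>
            hpast k (Finset.mem_insert_of_mem hk) a (ha k hk) x v
      _ = (∫⁻ v, ψ a (Function.update x a v) ∂μ) * ∏ k ∈ s, ψ k x :=
          lintegral_mul_const _ (hma.comp (measurable_update x))
      _ ≤ ∏ k ∈ s, ψ k x := mul_le_of_le_one_left' (hone a (Finset.mem_insert_self a s) x)

theorem lintegral_pi_prod_le_one {ι : Type*} [Fintype ι] [LinearOrder ι] (μ : Measure ℝ)
    [IsProbabilityMeasure μ] (ψ : ι → (ι → ℝ) → ℝ≥0∞) (T : Finset ι)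
    (hm : ∀ k ∈ T, Measurable (ψ k))
    (hpast : ∀ k ∈ T, ∀ i, k < i → ∀ x v, ψ k (Function.update x i v) = ψ k x)
    (hone : ∀ k ∈ T, ∀ x, ∫⁻ v, ψ k (Function.update x k v) ∂μ ≤ 1) :
    ∫⁻ x, ∏ k ∈ T, ψ k x ∂(Measure.pi fun _ => μ) ≤ 1 := by
  have hmp : Measurable fun x => ∏ k ∈ T, ψ k x := Finset.measurable_fun_prod _ hm
  rw [lintegral_eq_lmarginal_univ (μ := fun _ => μ) 0,
    ← Finset.sdiff_union_of_subset (Finset.subset_univ T),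
    lmarginal_union _ _ hmp Finset.sdiff_disjoint]
  refine le_trans (lmarginal_mono (g := fun _ => 1)
    (fun x => lmarginal_prod_le_one μ ψ T hm hpast hone x) 0) ?_
  unfold lmarginal
  rw [lintegral_const, measure_univ, mul_one]

/-- The information in a window is at least what a sequential soft decoder `ψ`, which uses past
decisions and all outputs in the window, extracts. -/
theorem sum_integral_log_le_windowInfo (hentropy : Summable (entropyTerm p)) (s : Finset ℤ)
    (T : Finset s) (ψ : s → (s → ℝ) × (s → ℝ) → ℝ≥0∞) (hm : ∀ k ∈ T, Measurable (ψ k))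
    (hpast : ∀ k ∈ T, ∀ i, k < i → ∀ x v y, ψ k (Function.update x i v, y) = ψ k (x, y))
    (hone : ∀ k ∈ T, ∀ x y, ∫⁻ v, ψ k (Function.update x k v, y) ∂p.toMeasure ≤ 1)
    (h0 : ∀ k ∈ T, ∀ z, ψ k z ≠ 0)
    (hint : ∀ k ∈ T, Integrable (fun ω => Real.log (ψ k (windowIn s ω, windowOut h s ω)).toReal)
      (channelLaw p N₀)) :
    ∑ k ∈ T, ∫ ω, Real.log (ψ k (windowIn s ω, windowOut h s ω)).toReal ∂(channelLaw p N₀)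
      ≤ (windowInfo p h N₀ s).toReal := by
  have hX := measurable_windowIn s
  have hY := measurable_windowOut h s
  have hXY : Measurable fun ω => (windowIn s ω, windowOut h s ω) := hX.prodMk hY
  have hpX : IsProbabilityMeasure ((channelLaw p N₀).map (windowIn s)) :=
    Measure.isProbabilityMeasure_map hX.aemeasurable
  have hpY : IsProbabilityMeasure ((channelLaw p N₀).map (windowOut h s)) :=
    Measure.isProbabilityMeasure_map hY.aemeasurable
  have hpXY : IsProbabilityMeasure
      ((channelLaw p N₀).map fun ω => (windowIn s ω, windowOut h s ω)) :=
    Measure.isProbabilityMeasure_map hXY.aemeasurable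
  have hfin := (windowInfo_le p h N₀ hentropy s).1
  set Ψ : (s → ℝ) × (s → ℝ) → ℝ≥0∞ := fun z => ∏ k ∈ T, ψ k z with hΨ
  have hΨm : Measurable Ψ := Finset.measurable_fun_prod _ fun k hk => hm k hk
  have hΨ1 : ∫⁻ z, Ψ z ∂(((channelLaw p N₀).map (windowIn s)).prod
      ((channelLaw p N₀).map (windowOut h s))) ≤ 1 := by
    rw [lintegral_prod_symm' _ hΨm]
    calc _ ≤ ∫⁻ _, 1 ∂((channelLaw p N₀).map (windowOut h s)) := by
          refine lintegral_mono fun y => ?_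
          rw [map_windowIn]
          exact lintegral_pi_prod_le_one p.toMeasure (fun k x => ψ k (x, y)) T
            (fun k hk => (hm k hk).comp measurable_prodMk_right)
            (fun k hk i hi x v => hpast k hk i hi x v y) (fun k hk x => hone k hk x y)
      _ = 1 := by simp
  -- A factor may take the value ∞, but only on a null set of the product law, hence of the joint
  -- law. Finiteness lets the logarithm of the product split.
  have hae : ∀ k ∈ T, ∀ᵐ ω ∂(channelLaw p N₀),
      ψ k (windowIn s ω, windowOut h s ω) ≠ ∞ := by
    intro k hk
    obtain ⟨hac, -⟩ := InformationTheory.klDiv_ne_top_iff.1 hfin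
    refine ae_of_ae_map (p := fun z => ψ k z ≠ ∞) hXY.aemeasurable (hac.ae_le ?_)
    have hk1 : ∫⁻ z, ψ k z ∂(((channelLaw p N₀).map (windowIn s)).prod
        ((channelLaw p N₀).map (windowOut h s))) ≤ 1 := by
      rw [lintegral_prod_symm' _ (hm k hk)]
      calc _ ≤ ∫⁻ _, 1 ∂((channelLaw p N₀).map (windowOut h s)) := by
            refine lintegral_mono fun y => ?_
            rw [map_windowIn]
            have := lintegral_pi_prod_le_one p.toMeasure (fun k x => ψ k (x, y)) {k}
              (fun j hj => by
                rw [Finset.mem_singleton.1 hj]; exact (hm k hk).comp measurable_prodMk_right)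
              (fun j hj i hi x v => by
                rw [Finset.mem_singleton.1 hj] at hi ⊢; exact hpast k hk i hi x v y)
              (fun j hj x => by rw [Finset.mem_singleton.1 hj]; exact hone k hk x y)
            simpa using this
        _ = 1 := by simp
    filter_upwards [ae_lt_top (hm k hk) (hk1.trans_lt ENNReal.one_lt_top).ne] with z hz using hz.ne
  have hlog : (fun ω => Real.log (Ψ (windowIn s ω, windowOut h s ω)).toReal)
      =ᵐ[channelLaw p N₀] fun ω =>
        ∑ k ∈ T, Real.log (ψ k (windowIn s ω, windowOut h s ω)).toReal := by
    filter_upwards [(Finset.eventually_all T).2 hae] with ω hω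
    simp only [hΨ, ENNReal.toReal_prod]
    exact Real.log_prod fun k hk => (ENNReal.toReal_pos (h0 k hk _) (hω k hk)).ne'
  have hint' : Integrable (fun ω => Real.log (Ψ (windowIn s ω, windowOut h s ω)).toReal)
      (channelLaw p N₀) := (integrable_congr hlog).2 (integrable_finsetSum _ hint)
  have hΨlog : Measurable fun z => Real.log (Ψ z).toReal :=
    Real.measurable_log.comp hΨm.ennreal_toReal
  have hmain := integral_log_le_toReal_klDiv hfin hΨm hΨ1
    (Eventually.of_forall fun z => Finset.prod_ne_zero_iff.2 fun k hk => h0 k hk z)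
    ((integrable_map_measure hΨlog.aestronglyMeasurable hXY.aemeasurable).2 hint')
  rw [integral_map hXY.aemeasurable hΨlog.aestronglyMeasurable, integral_congr_ae hlog,
    integral_finsetSum _ hint] at hmain
  exact hmain

end Model

/-! ### Square roots of mixtures and of Gaussian densities -/

section Auxiliary

/-- Used with exponent 1/2, where it acts as a union bound: the Bhattacharyya coefficient of two
mixtures is at most the sum over pairs of components. -/
theorem rpow_tsum_le_tsum_rpow {ι : Type*} (f : ι → ℝ≥0∞) {r : ℝ} (h0 : 0 ≤ r) (h1 : r ≤ 1)
    (hr : 0 < r) : (∑' i, f i) ^ r ≤ ∑' i, f i ^ r := by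
  have hfin : ∀ s : Finset ι, (∑ i ∈ s, f i) ^ r ≤ ∑ i ∈ s, f i ^ r := fun s =>
    Finset.le_sum_of_subadditive (fun x : ℝ≥0∞ => x ^ r) (ENNReal.zero_rpow_of_pos hr).le
      (fun a b => ENNReal.rpow_add_le_add_rpow a b h0 h1) s f
  have hlim : Tendsto (fun s : Finset ι => (∑ i ∈ s, f i) ^ r) atTop (𝓝 ((∑' i, f i) ^ r)) :=
    (ENNReal.continuous_rpow_const.tendsto _).comp ENNReal.summable.hasSum
  exact le_of_tendsto hlim (Eventually.of_forall fun s => (hfin s).trans (ENNReal.sum_le_tsum s))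

theorem lintegral_pi_succ (μ : Measure ℝ) [SigmaFinite μ] {m : ℕ} {f : (Fin (m + 1) → ℝ) → ℝ≥0∞}
    (hf : Measurable f) :
    ∫⁻ z, f z ∂(Measure.pi fun _ => μ)
      = ∫⁻ a, ∫⁻ z, f (Fin.cons a z) ∂(Measure.pi fun _ => μ) ∂μ := by
  have hmp := (measurePreserving_piFinSuccAbove (fun _ : Fin (m + 1) => μ) 0).symm
  rw [← hmp.lintegral_comp_emb (MeasurableEquiv.measurableEmbedding _)]
  have hm : Measurable fun q : ℝ × (Fin m → ℝ) =>
      f ((MeasurableEquiv.piFinSuccAbove (fun _ : Fin (m + 1) => ℝ) 0).symm q) :=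
    hf.comp (MeasurableEquiv.measurable _)
  have hc : ∀ q : ℝ × (Fin m → ℝ),
      (MeasurableEquiv.piFinSuccAbove (fun _ : Fin (m + 1) => ℝ) 0).symm q = Fin.cons q.1 q.2 := by
    intro q
    rw [MeasurableEquiv.piFinSuccAbove_symm_apply, Fin.insertNthEquiv_zero]
    rfl
  refine (lintegral_prod (μ := μ) (ν := Measure.pi fun _ : Fin m => μ) _ hm.aemeasurable).trans ?_
  simp only [hc]

theorem lintegral_volume_succ {m : ℕ} {f : (Fin (m + 1) → ℝ) → ℝ≥0∞} (hf : Measurable f) :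
    ∫⁻ z, f z = ∫⁻ a, ∫⁻ z, f (Fin.cons a z) :=
  lintegral_pi_succ volume hf

theorem measurable_finCons {m : ℕ} :
    Measurable fun q : ℝ × (Fin m → ℝ) => (Fin.cons q.1 q.2 : Fin (m + 1) → ℝ) := by
  refine measurable_pi_lambda _ fun i => ?_
  refine Fin.cases ?_ (fun j => ?_) i
  · simpa using measurable_fst
  · simp only [Fin.cons_succ]
    fun_prop

/-- Completing the square about the midpoint of the means. This is the origin of the constant 8 in
the error exponents. -/
theorem gaussianPDF_mul_rpow_half (μ₁ μ₂ : ℝ) (v : NNReal) (hv : v ≠ 0) (x : ℝ) :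
    (gaussianPDF μ₁ v x * gaussianPDF μ₂ v x) ^ (1 / 2 : ℝ)
      = ENNReal.ofReal (Real.exp (-(μ₁ - μ₂) ^ 2 / (8 * v)))
        * gaussianPDF ((μ₁ + μ₂) / 2) v x := by
  have hv' : (0 : ℝ) < v := by positivity
  simp only [gaussianPDF]
  rw [← ENNReal.ofReal_mul (gaussianPDFReal_nonneg _ _ _),
    ENNReal.ofReal_rpow_of_nonneg (mul_nonneg (gaussianPDFReal_nonneg _ _ _)
      (gaussianPDFReal_nonneg _ _ _)) (by norm_num),
    ← ENNReal.ofReal_mul (Real.exp_pos _).le]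
  congr 1
  rw [← Real.sqrt_eq_rpow, Real.sqrt_eq_iff_eq_sq (mul_nonneg (gaussianPDFReal_nonneg _ _ _)
    (gaussianPDFReal_nonneg _ _ _)) (mul_nonneg (Real.exp_pos _).le (gaussianPDFReal_nonneg _ _ _))]
  simp only [gaussianPDFReal]
  set C := (√(2 * Real.pi * v))⁻¹
  have : ∀ a b c d : ℝ, a + b = 2 * (c + d) →
      C * Real.exp a * (C * Real.exp b) = (Real.exp c * (C * Real.exp d)) ^ 2 := by
    intro a b c d h
    have h2 : Real.exp a * Real.exp b = (Real.exp c * Real.exp d) ^ 2 := by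
      rw [← Real.exp_add, ← Real.exp_add, h, ← Real.exp_nat_mul]
      norm_num
    calc _ = C ^ 2 * (Real.exp a * Real.exp b) := by ring
      _ = _ := by rw [h2]; ring
  apply this
  field_simp
  ring

theorem lintegral_gaussianPDF_mul_rpow_half (μ₁ μ₂ : ℝ) (v : NNReal) (hv : v ≠ 0) :
    ∫⁻ x, (gaussianPDF μ₁ v x * gaussianPDF μ₂ v x) ^ (1 / 2 : ℝ)
      = ENNReal.ofReal (Real.exp (-(μ₁ - μ₂) ^ 2 / (8 * v))) := by
  simp_rw [gaussianPDF_mul_rpow_half μ₁ μ₂ v hv]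
  rw [lintegral_const_mul _ (measurable_gaussianPDF _ _), lintegral_gaussianPDF_eq_one _ hv, mul_one]

theorem gaussianPDF_le (μ : ℝ) (v : NNReal) (x : ℝ) :
    gaussianPDF μ v x ≤ ENNReal.ofReal (√(2 * Real.pi * v))⁻¹ := by
  refine ENNReal.ofReal_le_ofReal ?_
  simp only [gaussianPDFReal]
  refine mul_le_of_le_one_right (by positivity) (Real.exp_le_one_iff.2 ?_)
  rw [neg_div]
  exact neg_nonpos.2 (by positivity)

theorem measurable_gaussianPDF_comp {α : Type*} [MeasurableSpace α] {f g : α → ℝ}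
    (hf : Measurable f) (hg : Measurable g) (v : NNReal) :
    Measurable fun a => gaussianPDF (f a) v (g a) :=
  measurable_uncurry_gaussianPDF.comp (hf.prodMk (measurable_const.prodMk hg))

/-- Passes from entropy to Bhattacharyya coefficients. Writing −log(x/(x+y)) as 2 log √((x+y)/x) and
using log s ≤ s − 1 leaves 2(√(x(x+y)) − x), and √(x(x+y)) ≤ x + √(xy). -/
theorem mul_neg_log_div_le {x y : ℝ≥0∞} (hx : x ≠ ∞) (hy : y ≠ ∞) :
    x * ENNReal.ofReal (-Real.log (x / (x + y)).toReal) ≤ 2 * (x * y) ^ (1 / 2 : ℝ) := by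
  rcases eq_or_ne x 0 with rfl | hx0
  · simp
  lift x to NNReal using hx
  lift y to NNReal using hy
  have hxpos : (0 : ℝ) < x := by
    have : x ≠ 0 := by exact_mod_cast hx0
    positivity
  have hy0 : (0 : ℝ) ≤ y := y.2
  have hr : ((x : ℝ≥0∞) / ((x : ℝ≥0∞) + y)).toReal = (x : ℝ) / (x + y) := by
    rw [ENNReal.toReal_div, ENNReal.toReal_add ENNReal.coe_ne_top ENNReal.coe_ne_top]
    rfl
  rw [hr]
  have e1 : (x : ℝ≥0∞) = ENNReal.ofReal x := (ENNReal.ofReal_coe_nnreal).symm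
  have e2 : (y : ℝ≥0∞) = ENNReal.ofReal y := (ENNReal.ofReal_coe_nnreal).symm
  have e3 : (2 : ℝ≥0∞) = ENNReal.ofReal 2 := by simp
  rw [e1, e2, e3, ← ENNReal.ofReal_mul hxpos.le, ← ENNReal.ofReal_mul hxpos.le,
    ENNReal.ofReal_rpow_of_nonneg (by positivity) (by norm_num), ← ENNReal.ofReal_mul (by norm_num),
    ← Real.sqrt_eq_rpow]
  refine ENNReal.ofReal_le_ofReal ?_
  set a : ℝ := (x : ℝ)
  set b : ℝ := (y : ℝ)
  have hab : 0 < a + b := by positivity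
  have hs : 0 < √((a + b) / a) := Real.sqrt_pos.2 (by positivity)
  have h1 : -Real.log (a / (a + b)) ≤ 2 * (√((a + b) / a) - 1) := by
    have h2 : -Real.log (a / (a + b)) = 2 * Real.log √((a + b) / a) := by
      rw [Real.log_sqrt (by positivity), ← Real.log_inv, inv_div]
      ring
    rw [h2]
    have := Real.log_le_sub_one_of_pos hs
    linarith
  have h3 : a * √((a + b) / a) ≤ a + √(a * b) := by
    have h4 : a * √((a + b) / a) = √(a * (a + b)) := by
      rw [← Real.sqrt_sq hxpos.le, ← Real.sqrt_mul (by positivity), Real.sqrt_sq hxpos.le]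
      congr 1
      field_simp
    rw [h4]
    refine Real.sqrt_le_iff.2 ⟨by positivity, ?_⟩
    have h5 := Real.sq_sqrt (show 0 ≤ a * b by positivity)
    nlinarith [Real.sqrt_nonneg (a * b)]
  nlinarith

end Auxiliary

/-! ### Estimating one letter from finitely many outputs -/

section WindowProblem

/-- The noiseless output at time `n` of the filter `t` with input `x` started at time `0`. -/
def convAt (t : ℕ → ℝ) (n : ℕ) (x : ℕ → ℝ) : ℝ := ∑ j ∈ Finset.range (n + 1), t (n - j) * x j

/-- The likelihood of the `m` outputs after time `n`, given the inputs `x 0, …, x (n - 1)`, when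
the later inputs are drawn from `p`. -/
def likelihood (p : PMF ℝ) (t : ℕ → ℝ) (v : NNReal) :
    (m n : ℕ) → (ℕ → ℝ) → (Fin m → ℝ) → ℝ≥0∞
  | 0, _, _, _ => 1
  | m + 1, n, x, z => ∑' a : p.support, p a *
      (gaussianPDF (convAt t n (Function.update x n a)) v (z 0) *
        likelihood p t v m (n + 1) (Function.update x n a) (Fin.tail z))

/-- The input sequence with the first `n` values from `x` and then the `m` values `u`. -/
def glue (n : ℕ) (x : ℕ → ℝ) {m : ℕ} (u : Fin m → ℝ) (j : ℕ) : ℝ :=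
  if j < n then x j else if h : j - n < m then u ⟨j - n, h⟩ else 0

variable (p : PMF ℝ) (t : ℕ → ℝ) (v : NNReal)

theorem measurable_convAt (n : ℕ) : Measurable (convAt t n) := by
  unfold convAt; fun_prop

theorem convAt_congr {n : ℕ} {x y : ℕ → ℝ} (h : ∀ j ≤ n, x j = y j) :
    convAt t n x = convAt t n y :=
  Finset.sum_congr rfl fun j hj => by rw [h j (by simpa [Nat.lt_succ_iff] using hj)]

theorem convAt_sub (n : ℕ) (x y : ℕ → ℝ) :
    convAt t n x - convAt t n y = convAt t n (x - y) := by
  simp [convAt, ← Finset.sum_sub_distrib, mul_sub]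

theorem measurable_glue (n : ℕ) (x : ℕ → ℝ) {m : ℕ} :
    Measurable fun u : Fin m → ℝ => glue n x u := by
  refine measurable_pi_lambda _ fun j => ?_
  unfold glue
  split_ifs <;> fun_prop

theorem measurable_likelihood (m n : ℕ) :
    Measurable fun q : (ℕ → ℝ) × (Fin m → ℝ) => likelihood p t v m n q.1 q.2 := by
  induction m generalizing n with
  | zero => exact measurable_const
  | succ m ih =>
    simp only [likelihood]
    refine Measurable.tsum fun a => ?_
    have hu : Measurable fun q : (ℕ → ℝ) × (Fin (m + 1) → ℝ) =>
        Function.update q.1 n (a : ℝ) := by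
      refine measurable_pi_lambda _ fun j => ?_
      by_cases hj : j = n
      · subst hj; simp
      · simp only [Function.update_of_ne hj]; fun_prop
    have ht : Measurable fun q : (ℕ → ℝ) × (Fin (m + 1) → ℝ) => (Fin.tail q.2 : Fin m → ℝ) := by
      unfold Fin.tail; fun_prop
    refine Measurable.const_mul (Measurable.mul ?_ ((ih (n + 1)).comp (hu.prodMk ht))) _
    exact measurable_gaussianPDF_comp ((measurable_convAt t n).comp hu) (by fun_prop) v

theorem measurable_likelihood_right (m n : ℕ) (x : ℕ → ℝ) :
    Measurable (likelihood p t v m n x) :=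
  (measurable_likelihood p t v m n).comp measurable_prodMk_left

theorem likelihood_ne_zero (hv : v ≠ 0) (m n : ℕ) (x : ℕ → ℝ) (z : Fin m → ℝ) :
    likelihood p t v m n x z ≠ 0 := by
  induction m generalizing n x with
  | zero => simp [likelihood]
  | succ m ih =>
    obtain ⟨a, ha⟩ := p.support_nonempty
    simp only [likelihood]
    intro h
    have := ENNReal.tsum_eq_zero.1 h ⟨a, ha⟩
    refine absurd this (mul_ne_zero ((p.mem_support_iff a).1 ha) (mul_ne_zero ?_ (ih _ _ _)))
    exact (gaussianPDF_pos _ hv _).ne'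

theorem likelihood_le (m n : ℕ) (x : ℕ → ℝ) (z : Fin m → ℝ) :
    likelihood p t v m n x z ≤ (ENNReal.ofReal (√(2 * Real.pi * v))⁻¹) ^ m := by
  induction m generalizing n x with
  | zero => simp [likelihood]
  | succ m ih =>
    simp only [likelihood]
    calc _ ≤ ∑' a : p.support, p a * (ENNReal.ofReal (√(2 * Real.pi * v))⁻¹) ^ (m + 1) := by
          refine ENNReal.tsum_le_tsum fun a => mul_le_mul_right ?_ _
          rw [pow_succ']
          exact mul_le_mul' (gaussianPDF_le _ _ _) (ih _ _ _)
      _ = _ := by rw [ENNReal.tsum_mul_right, tsum_support, one_mul]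

theorem likelihood_ne_top (m n : ℕ) (x : ℕ → ℝ) (z : Fin m → ℝ) :
    likelihood p t v m n x z ≠ ∞ :=
  ((likelihood_le p t v m n x z).trans_lt (ENNReal.pow_lt_top ENNReal.ofReal_lt_top)).ne

/-- The filter has memory shorter than L, so later outputs see only the most recent letters. This is
what ends an error event after L agreeing letters. -/
theorem likelihood_congr {L : ℕ} (ht : ∀ i, L ≤ i → t i = 0) (m : ℕ) {n : ℕ} {x y : ℕ → ℝ}
    (hxy : ∀ j, j < n → n < j + L → x j = y j) (z : Fin m → ℝ) :
    likelihood p t v m n x z = likelihood p t v m n y z := by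
  induction m generalizing n x y with
  | zero => rfl
  | succ m ih =>
    simp only [likelihood]
    refine tsum_congr fun a => ?_
    have h1 : convAt t n (Function.update x n a) = convAt t n (Function.update y n a) := by
      refine Finset.sum_congr rfl fun j hj => ?_
      have hj' : j ≤ n := by simpa [Nat.lt_succ_iff] using hj
      rcases eq_or_lt_of_le hj' with rfl | hlt
      · simp
      · rw [Function.update_of_ne hlt.ne, Function.update_of_ne hlt.ne]
        by_cases hL : n < j + L
        · rw [hxy j hlt hL]
        · rw [ht (n - j) (by omega), zero_mul, zero_mul]
    rw [h1, ih (n := n + 1) (x := Function.update x n a) (y := Function.update y n a)]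
    intro j hj hL
    rcases eq_or_lt_of_le (Nat.lt_succ_iff.1 hj) with rfl | hlt
    · simp
    · rw [Function.update_of_ne hlt.ne, Function.update_of_ne hlt.ne, hxy j hlt (by omega)]

theorem lintegral_noise_add (hv : v ≠ 0) (c : ℝ) {f : ℝ → ℝ≥0∞} (hf : Measurable f) :
    ∫⁻ e, f (c + e) ∂(gaussianReal 0 v) = ∫⁻ y, gaussianPDF c v y * f y := by
  rw [← lintegral_map hf (by fun_prop : Measurable fun e : ℝ => c + e),
    gaussianReal_map_const_add, zero_add, gaussianReal_of_var_ne_zero _ hv,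
    lintegral_withDensity_eq_lintegral_mul _ (measurable_gaussianPDF _ _) hf]
  rfl

theorem glue_cons (n : ℕ) (x : ℕ → ℝ) {m : ℕ} (a : ℝ) (u : Fin m → ℝ) :
    glue n x (Fin.cons a u : Fin (m + 1) → ℝ) = glue (n + 1) (Function.update x n a) u := by
  funext j
  unfold glue
  rcases lt_trichotomy j n with h | h | h
  · simp [h, h.trans (Nat.lt_succ_self n), Function.update_of_ne h.ne]
  · subst h
    simp
  · have h1 : ¬ j < n := by omega
    have h2 : ¬ j < n + 1 := by omega
    simp only [h1, h2, if_false]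
    by_cases h3 : j - (n + 1) < m
    · have h4 : j - n < m + 1 := by omega
      simp only [h3, h4, dif_pos]
      have : (⟨j - n, h4⟩ : Fin (m + 1)) = Fin.succ ⟨j - (n + 1), h3⟩ := by
        ext; simp; omega
      rw [this, Fin.cons_succ]
    · have h4 : ¬ j - n < m + 1 := by omega
      simp only [h3, h4, dif_neg, not_false_iff]

/-- The outputs of the window problem. -/
def windowObs (n : ℕ) (x : ℕ → ℝ) {m : ℕ} (u e : Fin m → ℝ) (i : Fin m) : ℝ :=
  convAt t (n + i) (glue n x u) + e i

theorem measurable_windowObs (n : ℕ) (x : ℕ → ℝ) {m : ℕ} :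
    Measurable fun q : (Fin m → ℝ) × (Fin m → ℝ) => windowObs t n x q.1 q.2 := by
  refine measurable_pi_lambda _ fun i => ?_
  have h1 : Measurable fun q : (Fin m → ℝ) × (Fin m → ℝ) => glue n x q.1 :=
    (measurable_glue n x).comp measurable_fst
  have h2 := (measurable_convAt t (n + i)).comp h1
  have h3 : Measurable fun q : (Fin m → ℝ) × (Fin m → ℝ) => q.2 i := by fun_prop
  exact h2.add h3

theorem measurable_windowObs_right (n : ℕ) (x : ℕ → ℝ) {m : ℕ} (u : Fin m → ℝ) :
    Measurable (windowObs t n x u) := by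
  refine measurable_pi_lambda _ fun i => ?_
  unfold windowObs
  fun_prop

theorem windowObs_cons (n : ℕ) (x : ℕ → ℝ) {m : ℕ} (a e₀ : ℝ) (u e : Fin m → ℝ) :
    windowObs t n x (Fin.cons a u : Fin (m + 1) → ℝ) (Fin.cons e₀ e : Fin (m + 1) → ℝ)
      = (Fin.cons (convAt t n (Function.update x n a) + e₀)
          (windowObs t (n + 1) (Function.update x n a) u e) : Fin (m + 1) → ℝ) := by
  funext i
  refine Fin.cases ?_ (fun j => ?_) i
  · simp only [windowObs, glue_cons, Fin.cons_zero, Fin.val_zero, add_zero]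
    congr 1
    refine convAt_congr t fun j hj => ?_
    simp [glue, hj]
  · simp only [windowObs, glue_cons, Fin.cons_succ, Fin.val_succ]
    congr 2
    omega

theorem lintegral_windowObs_cons (hv : v ≠ 0) (m n : ℕ) (x : ℕ → ℝ) (c : ℝ)
    (ih : ∀ G : (Fin m → ℝ) → ℝ≥0∞, Measurable G →
      ∫⁻ u, ∫⁻ e, G (windowObs t n x u e) ∂(Measure.pi fun _ => gaussianReal 0 v)
          ∂(Measure.pi fun _ => p.toMeasure)
        = ∫⁻ z, likelihood p t v m n x z * G z)
    (H : (Fin (m + 1) → ℝ) → ℝ≥0∞) (hH : Measurable H) :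
    ∫⁻ u : Fin m → ℝ, ∫⁻ e₀, ∫⁻ e, H (Fin.cons (c + e₀) (windowObs t n x u e))
        ∂(Measure.pi fun _ => gaussianReal 0 v) ∂(gaussianReal 0 v)
        ∂(Measure.pi fun _ => p.toMeasure)
      = ∫⁻ z : Fin (m + 1) → ℝ,
          gaussianPDF c v (z 0) * likelihood p t v m n x (Fin.tail z) * H z := by
  have hHc : Measurable fun q : ℝ × (Fin m → ℝ) => H (Fin.cons q.1 q.2) :=
    hH.comp measurable_finCons
  have hHy : ∀ y : ℝ, Measurable fun z : Fin m → ℝ => H (Fin.cons y z) := fun y =>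
    hHc.comp measurable_prodMk_left
  have hlik := measurable_likelihood_right p t v m n x
  have h1 : Measurable fun r : ((Fin m → ℝ) × ℝ) × (Fin m → ℝ) =>
      H (Fin.cons (c + r.1.2) (windowObs t n x r.1.1 r.2)) := by
    have ha : Measurable fun r : ((Fin m → ℝ) × ℝ) × (Fin m → ℝ) => (r.1.1, r.2) := by fun_prop
    have hb := (measurable_windowObs t n x (m := m)).comp ha
    have hc : Measurable fun r : ((Fin m → ℝ) × ℝ) × (Fin m → ℝ) => c + r.1.2 := by fun_prop
    exact hHc.comp (hc.prodMk hb)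
  have h2 : Measurable fun y : ℝ => ∫⁻ z, likelihood p t v m n x z * H (Fin.cons y z) :=
    Measurable.lintegral_prod_right' (f := fun q : ℝ × (Fin m → ℝ) =>
      likelihood p t v m n x q.2 * H (Fin.cons q.1 q.2)) ((hlik.comp measurable_snd).mul hHc)
  have h3 : Measurable fun z : Fin (m + 1) → ℝ =>
      gaussianPDF c v (z 0) * likelihood p t v m n x (Fin.tail z) * H z :=
    (((measurable_gaussianPDF c v).comp (measurable_pi_apply 0)).mul
      (hlik.comp (by unfold Fin.tail; fun_prop))).mul hH
  rw [lintegral_lintegral_swap (f := fun u e₀ => ∫⁻ e : Fin m → ℝ,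
    H (Fin.cons (c + e₀) (windowObs t n x u e)) ∂(Measure.pi fun _ => gaussianReal 0 v))
    h1.lintegral_prod_right'.aemeasurable]
  have h4 : ∀ e₀ : ℝ, ∫⁻ u : Fin m → ℝ, ∫⁻ e : Fin m → ℝ,
      H (Fin.cons (c + e₀) (windowObs t n x u e)) ∂(Measure.pi fun _ => gaussianReal 0 v)
        ∂(Measure.pi fun _ => p.toMeasure)
      = ∫⁻ z, likelihood p t v m n x z * H (Fin.cons (c + e₀) z) := fun e₀ => ih _ (hHy _)
  simp_rw [h4]
  rw [lintegral_noise_add v hv c h2, lintegral_volume_succ h3]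
  refine lintegral_congr fun y => ?_
  rw [← lintegral_const_mul' _ _ gaussianPDF_ne_top]
  refine lintegral_congr fun z => ?_
  simp only [Fin.cons_zero, Fin.tail_cons, mul_assoc]

/-- One letter and one noise sample are split off. The first letter stays visible as an argument of
G, since the conditional entropy depends jointly on it and on the outputs, while the later letters
are averaged. -/
theorem lintegral_windowObs_succ (hv : v ≠ 0) (m n : ℕ) (x : ℕ → ℝ)
    (ih : ∀ (x : ℕ → ℝ) (G : (Fin m → ℝ) → ℝ≥0∞), Measurable G →
      ∫⁻ u, ∫⁻ e, G (windowObs t (n + 1) x u e) ∂(Measure.pi fun _ => gaussianReal 0 v)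
          ∂(Measure.pi fun _ => p.toMeasure)
        = ∫⁻ z, likelihood p t v m (n + 1) x z * G z)
    (G : ℝ → (Fin (m + 1) → ℝ) → ℝ≥0∞) (hG : Measurable (Function.uncurry G)) :
    ∫⁻ u, ∫⁻ e, G (u 0) (windowObs t n x u e) ∂(Measure.pi fun _ => gaussianReal 0 v)
        ∂(Measure.pi fun _ => p.toMeasure)
      = ∑' a : p.support, p a * ∫⁻ z : Fin (m + 1) → ℝ,
          gaussianPDF (convAt t n (Function.update x n a)) v (z 0) *
            likelihood p t v m (n + 1) (Function.update x n a) (Fin.tail z) * G a z := by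
  have hW := measurable_windowObs t n x (m := m + 1)
  have hGW : Measurable fun q : (Fin (m + 1) → ℝ) × (Fin (m + 1) → ℝ) =>
      G (q.1 0) (windowObs t n x q.1 q.2) := by
    have h0 : Measurable fun q : (Fin (m + 1) → ℝ) × (Fin (m + 1) → ℝ) => q.1 0 := by fun_prop
    exact hG.comp (h0.prodMk hW)
  have hGi : Measurable fun u : Fin (m + 1) → ℝ =>
      ∫⁻ e, G (u 0) (windowObs t n x u e) ∂(Measure.pi fun _ => gaussianReal 0 v) :=
    hGW.lintegral_prod_right'
  rw [lintegral_pi_succ _ hGi, lintegral_toMeasure]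
  refine tsum_congr fun a => ?_
  congr 1
  have hGa : Measurable (G a) := hG.comp measurable_prodMk_left
  have hGu : ∀ w : Fin (m + 1) → ℝ, Measurable fun e : Fin (m + 1) → ℝ =>
      G a (windowObs t n x w e) := fun w => by
    exact hGa.comp (measurable_windowObs_right t n x w)
  have key : ∀ u : Fin m → ℝ, ∫⁻ e : Fin (m + 1) → ℝ,
      G ((Fin.cons (a : ℝ) u : Fin (m + 1) → ℝ) 0)
        (windowObs t n x (Fin.cons (a : ℝ) u : Fin (m + 1) → ℝ) e)
        ∂(Measure.pi fun _ => gaussianReal 0 v)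
      = ∫⁻ e₀, ∫⁻ e : Fin m → ℝ, G a (Fin.cons (convAt t n (Function.update x n a) + e₀)
          (windowObs t (n + 1) (Function.update x n a) u e))
          ∂(Measure.pi fun _ => gaussianReal 0 v) ∂(gaussianReal 0 v) := by
    intro u
    simp only [Fin.cons_zero]
    rw [lintegral_pi_succ _ (hGu _)]
    simp only [windowObs_cons]
  rw [lintegral_congr key]
  exact lintegral_windowObs_cons p t v hv m (n + 1) (Function.update x n a) _ (ih _) _ hGa

/-- Identifies `likelihood`, defined by recursion, as the density of the observed vector. -/
theorem lintegral_windowObs (hv : v ≠ 0) (m n : ℕ) (x : ℕ → ℝ) (G : (Fin m → ℝ) → ℝ≥0∞)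
    (hG : Measurable G) :
    ∫⁻ u, ∫⁻ e, G (windowObs t n x u e) ∂(Measure.pi fun _ => gaussianReal 0 v)
        ∂(Measure.pi fun _ => p.toMeasure)
      = ∫⁻ z, likelihood p t v m n x z * G z := by
  induction m generalizing n x with
  | zero =>
    have h1 : ∀ u e : Fin 0 → ℝ, windowObs t n x u e = 0 := fun u e => Subsingleton.elim _ _
    have h2 : ∀ z : Fin 0 → ℝ, G z = G 0 := fun z => by rw [Subsingleton.elim z 0]
    simp [likelihood, h2, volume_pi]
  | succ m ih =>
    rw [lintegral_windowObs_succ p t v hv m n x (fun x G hG => ih (n + 1) x G hG) (fun _ => G)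
      (hG.comp measurable_snd)]
    simp only [likelihood]
    have hlik : ∀ a : p.support, Measurable fun z : Fin (m + 1) → ℝ =>
        gaussianPDF (convAt t n (Function.update x n a)) v (z 0) *
          likelihood p t v m (n + 1) (Function.update x n a) (Fin.tail z) := fun a =>
      ((measurable_gaussianPDF _ v).comp (measurable_pi_apply 0)).mul
        ((measurable_likelihood_right p t v m (n + 1) _).comp (by unfold Fin.tail; fun_prop))
    simp_rw [← ENNReal.tsum_mul_right]
    have hlik' : ∀ a : p.support, Measurable fun z : Fin (m + 1) → ℝ => p a *
        (gaussianPDF (convAt t n (Function.update x n a)) v (z 0) *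
          likelihood p t v m (n + 1) (Function.update x n a) (Fin.tail z)) * G z := fun a =>
      ((hlik a).const_mul _).mul hG
    rw [lintegral_tsum fun a => (hlik' a).aemeasurable]
    refine tsum_congr fun a => ?_
    rw [← lintegral_const_mul' _ _ (p.apply_ne_top _)]
    simp only [mul_assoc]

theorem lintegral_likelihood (hv : v ≠ 0) (m n : ℕ) (x : ℕ → ℝ) :
    ∫⁻ z, likelihood p t v m n x z = 1 := by
  have := lintegral_windowObs p t v hv m n x (fun _ => 1) measurable_const
  simpa using this.symm

/-- The Bhattacharyya coefficient of the output laws after two different input histories. -/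
def bhatt (m n : ℕ) (x y : ℕ → ℝ) : ℝ≥0∞ :=
  ∫⁻ z, (likelihood p t v m n x z * likelihood p t v m n y z) ^ (1 / 2 : ℝ)

/-- The weight of a pair of input letters. -/
def pairWeight (a b : ℝ) : ℝ≥0∞ := (p a * p b) ^ (1 / 2 : ℝ)

theorem bhatt_eq_one (hv : v ≠ 0) {L : ℕ} (ht : ∀ i, L ≤ i → t i = 0) (m : ℕ) {n : ℕ}
    {x y : ℕ → ℝ} (hxy : ∀ j, j < n → n < j + L → x j = y j) : bhatt p t v m n x y = 1 := by
  unfold bhatt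
  rw [← lintegral_likelihood p t v hv m n y]
  refine lintegral_congr fun z => ?_
  rw [likelihood_congr p t v ht m hxy, ← sq, ← ENNReal.rpow_natCast, ← ENNReal.rpow_mul]
  norm_num

theorem bhatt_zero (n : ℕ) (x y : ℕ → ℝ) : bhatt p t v 0 n x y = 1 := by
  have h := bhatt_eq_one p 0 1 one_ne_zero (L := 0) (fun _ _ => rfl) 0 (n := 0) (x := x) (y := x)
    (fun _ _ _ => rfl)
  simpa [bhatt, likelihood] using h

theorem rpow_half_integrand (m n : ℕ) (x y : ℕ → ℝ) (a b : ℝ) (z : Fin (m + 1) → ℝ) :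
    ((p a * (gaussianPDF (convAt t n x) v (z 0) * likelihood p t v m (n + 1) x (Fin.tail z))) *
      (p b * (gaussianPDF (convAt t n y) v (z 0) * likelihood p t v m (n + 1) y (Fin.tail z))))
        ^ (1 / 2 : ℝ)
      = pairWeight p a b *
        ((gaussianPDF (convAt t n x) v (z 0) * gaussianPDF (convAt t n y) v (z 0)) ^ (1 / 2 : ℝ) *
        (likelihood p t v m (n + 1) x (Fin.tail z) *
          likelihood p t v m (n + 1) y (Fin.tail z)) ^ (1 / 2 : ℝ)) := by
  unfold pairWeight
  rw [← ENNReal.mul_rpow_of_nonneg _ _ (by norm_num), ← ENNReal.mul_rpow_of_nonneg _ _ (by norm_num)]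
  congr 1
  ring

theorem lintegral_rpow_half_integrand (hv : v ≠ 0) (m n : ℕ) (x y : ℕ → ℝ) (a b : ℝ) :
    ∫⁻ z : Fin (m + 1) → ℝ,
      ((p a * (gaussianPDF (convAt t n x) v (z 0) * likelihood p t v m (n + 1) x (Fin.tail z))) *
      (p b * (gaussianPDF (convAt t n y) v (z 0) * likelihood p t v m (n + 1) y (Fin.tail z))))
        ^ (1 / 2 : ℝ)
      = pairWeight p a b *
        (ENNReal.ofReal (Real.exp (-(convAt t n x - convAt t n y) ^ 2 / (8 * v))) *
          bhatt p t v m (n + 1) x y) := by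
  simp_rw [rpow_half_integrand]
  have h1 : Measurable fun y₀ : ℝ =>
      (gaussianPDF (convAt t n x) v y₀ * gaussianPDF (convAt t n y) v y₀) ^ (1 / 2 : ℝ) :=
    ((measurable_gaussianPDF _ v).mul (measurable_gaussianPDF _ v)).pow_const _
  have h2 : Measurable fun z : Fin m → ℝ => (likelihood p t v m (n + 1) x z *
      likelihood p t v m (n + 1) y z) ^ (1 / 2 : ℝ) :=
    ((measurable_likelihood_right p t v m (n + 1) x).mul
      (measurable_likelihood_right p t v m (n + 1) y)).pow_const _
  have htail : Measurable fun z : Fin (m + 1) → ℝ => (Fin.tail z : Fin m → ℝ) := by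
    unfold Fin.tail; fun_prop
  have h3 : Measurable fun z : Fin (m + 1) → ℝ =>
      (gaussianPDF (convAt t n x) v (z 0) * gaussianPDF (convAt t n y) v (z 0)) ^ (1 / 2 : ℝ) *
        (likelihood p t v m (n + 1) x (Fin.tail z) *
          likelihood p t v m (n + 1) y (Fin.tail z)) ^ (1 / 2 : ℝ) :=
    (h1.comp (measurable_pi_apply (0 : Fin (m + 1)))).mul (h2.comp htail)
  rw [lintegral_const_mul _ h3, lintegral_volume_succ h3]
  congr 1
  simp only [Fin.cons_zero, Fin.tail_cons]
  simp_rw [lintegral_const_mul _ h2]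
  rw [lintegral_mul_const _ h1, lintegral_gaussianPDF_mul_rpow_half _ _ v hv]
  rfl

theorem measurable_integrand (m n : ℕ) (x : ℕ → ℝ) (a : ℝ) :
    Measurable fun z : Fin (m + 1) → ℝ =>
      p a * (gaussianPDF (convAt t n x) v (z 0) * likelihood p t v m (n + 1) x (Fin.tail z)) :=
  (((measurable_gaussianPDF _ v).comp (measurable_pi_apply 0)).mul
    ((measurable_likelihood_right p t v m (n + 1) _).comp (by unfold Fin.tail; fun_prop))).const_mul _

/-- Each likelihood is a sum over the next letter. Subadditivity of the square root, applied to both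
sums, reduces to pairs of letters. For a fixed pair the first output integrates to the Gaussian
coefficient, and the remaining outputs give a Bhattacharyya coefficient one step later. -/
theorem bhatt_succ_le (hv : v ≠ 0) (m n : ℕ) (x y : ℕ → ℝ) :
    bhatt p t v (m + 1) n x y ≤ ∑' a : p.support, ∑' b : p.support, pairWeight p a b *
      (ENNReal.ofReal (Real.exp (-(convAt t n (Function.update x n a)
          - convAt t n (Function.update y n b)) ^ 2 / (8 * v))) *
        bhatt p t v m (n + 1) (Function.update x n a) (Function.update y n b)) := by
  have hm : ∀ a b : p.support, Measurable fun z : Fin (m + 1) → ℝ =>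
      ((p a * (gaussianPDF (convAt t n (Function.update x n a)) v (z 0) *
          likelihood p t v m (n + 1) (Function.update x n a) (Fin.tail z))) *
        (p b * (gaussianPDF (convAt t n (Function.update y n b)) v (z 0) *
          likelihood p t v m (n + 1) (Function.update y n b) (Fin.tail z)))) ^ (1 / 2 : ℝ) :=
    fun a b => ((measurable_integrand p t v m n _ a).mul
      (measurable_integrand p t v m n _ b)).pow_const _
  simp_rw [← lintegral_rpow_half_integrand p t v hv]
  calc bhatt p t v (m + 1) n x y
      ≤ ∫⁻ z : Fin (m + 1) → ℝ, ∑' a : p.support, ∑' b : p.support,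
        ((p a * (gaussianPDF (convAt t n (Function.update x n a)) v (z 0) *
          likelihood p t v m (n + 1) (Function.update x n a) (Fin.tail z))) *
        (p b * (gaussianPDF (convAt t n (Function.update y n b)) v (z 0) *
          likelihood p t v m (n + 1) (Function.update y n b) (Fin.tail z)))) ^ (1 / 2 : ℝ) := by
        refine lintegral_mono fun z => ?_
        simp only [likelihood]
        rw [← ENNReal.tsum_mul_right]
        refine (rpow_tsum_le_tsum_rpow _ (by norm_num) (by norm_num) (by norm_num)).trans ?_
        refine ENNReal.tsum_le_tsum fun a => ?_
        rw [← ENNReal.tsum_mul_left]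
        exact rpow_tsum_le_tsum_rpow _ (by norm_num) (by norm_num) (by norm_num)
    _ = _ := by
        rw [lintegral_tsum fun a => (Measurable.tsum fun b => hm a b).aemeasurable]
        refine tsum_congr fun a => ?_
        rw [lintegral_tsum fun b => (hm a b).aemeasurable]

/-- The likelihood ratio of the first input letter, given `m + 1` outputs. -/
def decoder (m : ℕ) (a : ℝ) (z : Fin (m + 1) → ℝ) : ℝ≥0∞ :=
  gaussianPDF (t 0 * a) v (z 0) * likelihood p t v m 1 (Function.update 0 0 a) (Fin.tail z) /
    likelihood p t v (m + 1) 0 0 z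

theorem convAt_zero_update (a : ℝ) : convAt t 0 (Function.update 0 0 a) = t 0 * a := by
  simp [convAt]

theorem measurable_decoder (m : ℕ) : Measurable (Function.uncurry (decoder p t v m)) := by
  unfold decoder Function.uncurry
  have hu : Measurable fun q : ℝ × (Fin (m + 1) → ℝ) => Function.update (0 : ℕ → ℝ) 0 q.1 :=
    (measurable_update 0).comp measurable_fst
  have ht : Measurable fun q : ℝ × (Fin (m + 1) → ℝ) => (Fin.tail q.2 : Fin m → ℝ) := by
    unfold Fin.tail; fun_prop
  refine Measurable.div (Measurable.mul ?_ ?_) ?_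
  · exact measurable_gaussianPDF_comp (by fun_prop) (by fun_prop) v
  · exact (measurable_likelihood p t v m 1).comp (hu.prodMk ht)
  · exact (measurable_likelihood_right p t v (m + 1) 0 0).comp measurable_snd

theorem decoder_ne_zero (hv : v ≠ 0) (m : ℕ) (a : ℝ) (z : Fin (m + 1) → ℝ) :
    decoder p t v m a z ≠ 0 :=
  ENNReal.div_ne_zero.2 ⟨mul_ne_zero (gaussianPDF_pos _ hv _).ne' (likelihood_ne_zero p t v hv _ _ _ _),
    likelihood_ne_top p t v _ _ _ _⟩

theorem decoder_ne_top (hv : v ≠ 0) (m : ℕ) (a : ℝ) (z : Fin (m + 1) → ℝ) :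
    decoder p t v m a z ≠ ∞ :=
  ENNReal.div_ne_top (ENNReal.mul_ne_top gaussianPDF_ne_top (likelihood_ne_top p t v _ _ _ _))
    (likelihood_ne_zero p t v hv _ _ _ _)

/-- By Bayes' rule the summands are the posterior probabilities of the letters, which is why the
decoder is an admissible test function. -/
theorem tsum_decoder (hv : v ≠ 0) (m : ℕ) (z : Fin (m + 1) → ℝ) :
    ∑' a : p.support, p a * decoder p t v m a z = 1 := by
  unfold decoder
  simp_rw [← mul_div_assoc, div_eq_mul_inv]
  rw [ENNReal.tsum_mul_right, ← div_eq_mul_inv]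
  have : likelihood p t v (m + 1) 0 0 z = ∑' a : p.support, p a * (gaussianPDF (t 0 * a) v (z 0) *
      likelihood p t v m 1 (Function.update 0 0 a) (Fin.tail z)) := by
    simp only [likelihood, convAt_zero_update, zero_add]
  rw [← this]
  exact ENNReal.div_self (likelihood_ne_zero p t v hv _ _ _ _) (likelihood_ne_top p t v _ _ _ _)

theorem lintegral_decoder (hv : v ≠ 0) (m : ℕ) (z : Fin (m + 1) → ℝ) :
    ∫⁻ a, decoder p t v m a z ∂p.toMeasure = 1 := by
  rw [lintegral_toMeasure, tsum_decoder p t v hv]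

/-- The conditional entropy of the first input letter, given `m + 1` outputs. -/
def condEntropy (m : ℕ) : ℝ≥0∞ :=
  ∫⁻ u, ∫⁻ e, ENNReal.ofReal (-Real.log (p (u 0) * decoder p t v m (u 0)
      (windowObs t 0 0 u e)).toReal) ∂(Measure.pi fun _ : Fin (m + 1) => gaussianReal 0 v)
    ∂(Measure.pi fun _ : Fin (m + 1) => p.toMeasure)

/-- For the true letter a, let x be its weighted likelihood and y the total of all other letters.
The posterior is x/(x+y), so `mul_neg_log_div_le` bounds its contribution by 2√(xy), and √y splits
over the competing letters b. -/
theorem condEntropy_le (hv : v ≠ 0) (m : ℕ) :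
    condEntropy p t v m ≤ 2 * ∑' a : p.support, ∑' b : p.support, if a = b then 0 else
      pairWeight p a b * (ENNReal.ofReal (Real.exp (-(t 0 * a - t 0 * b) ^ 2 / (8 * v))) *
        bhatt p t v m 1 (Function.update 0 0 (a : ℝ)) (Function.update 0 0 (b : ℝ))) := by
  have hpm : Measurable fun a : ℝ => p a := by
    refine (measurable_const (a := (0 : ℝ≥0∞))).measurable_of_countable_ne
      (p.support_countable.mono fun a ha => ?_)
    exact (p.mem_support_iff a).2 (Ne.symm ha)
  have hG : Measurable (Function.uncurry fun (a : ℝ) (z : Fin (m + 1) → ℝ) =>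
      ENNReal.ofReal (-Real.log (p a * decoder p t v m a z).toReal)) := by
    have := ((hpm.comp measurable_fst).mul (measurable_decoder p t v m)).ennreal_toReal
    exact (Real.measurable_log.comp this).neg.ennreal_ofReal
  set f : p.support → (Fin (m + 1) → ℝ) → ℝ≥0∞ := fun a z => p a *
    (gaussianPDF (convAt t 0 (Function.update 0 0 (a : ℝ))) v (z 0) *
      likelihood p t v m (0 + 1) (Function.update 0 0 (a : ℝ)) (Fin.tail z)) with hf
  have hfm : ∀ a, Measurable (f a) := fun a => measurable_integrand p t v m 0 _ a
  have hlik : ∀ z, likelihood p t v (m + 1) 0 0 z = ∑' a, f a z := fun z => rfl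
  have hsplit : ∀ a z, likelihood p t v (m + 1) 0 0 z
      = f a z + ∑' b, if a = b then 0 else f b z := by
    intro a z
    rw [hlik, ENNReal.tsum_eq_add_tsum_ite a]
    congr 1
    refine tsum_congr fun b => ?_
    by_cases hab : a = b
    · simp [hab]
    · simp [hab, Ne.symm hab]
  have hfin : ∀ a z, f a z ≠ ∞ := fun a z => ne_top_of_le_ne_top
    (likelihood_ne_top p t v (m + 1) 0 0 z) (hsplit a z ▸ le_self_add)
  have hrest : ∀ a z, (∑' b, if a = b then 0 else f b z) ≠ ∞ := fun a z => ne_top_of_le_ne_top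
    (likelihood_ne_top p t v (m + 1) 0 0 z) (hsplit a z ▸ le_add_self)
  unfold condEntropy
  rw [lintegral_windowObs_succ p t v hv m 0 0
    (fun x G hG => lintegral_windowObs p t v hv m (0 + 1) x G hG) _ hG, ← ENNReal.tsum_mul_left]
  refine ENNReal.tsum_le_tsum fun a => ?_
  have hdec : ∀ z, p a * decoder p t v m a z = f a z / (f a z + ∑' b, if a = b then 0 else f b z) := by
    intro z
    rw [← hsplit, decoder, ← mul_div_assoc, ← convAt_zero_update t]
  have hmix : ∀ b : p.support, Measurable fun z => if a = b then 0 else (f a z * f b z) ^ (1 / 2 : ℝ) := by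
    intro b
    split_ifs
    · exact measurable_const
    · exact ((hfm a).mul (hfm b)).pow_const _
  calc p a * ∫⁻ z : Fin (m + 1) → ℝ,
          gaussianPDF (convAt t 0 (Function.update 0 0 (a : ℝ))) v (z 0) *
            likelihood p t v m (0 + 1) (Function.update 0 0 (a : ℝ)) (Fin.tail z) *
            ENNReal.ofReal (-Real.log (p a * decoder p t v m a z).toReal)
      = ∫⁻ z : Fin (m + 1) → ℝ, f a z * ENNReal.ofReal
          (-Real.log (f a z / (f a z + ∑' b, if a = b then 0 else f b z)).toReal) := by
        rw [← lintegral_const_mul']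
        · refine lintegral_congr fun z => ?_
          rw [hdec]
          simp only [hf, mul_assoc]
        · exact p.apply_ne_top _
    _ ≤ ∫⁻ z : Fin (m + 1) → ℝ, 2 * ∑' b : p.support,
          if a = b then 0 else (f a z * f b z) ^ (1 / 2 : ℝ) := by
        refine lintegral_mono fun z => ?_
        refine (mul_neg_log_div_le (hfin a z) (hrest a z)).trans (mul_le_mul_right ?_ _)
        rw [← ENNReal.tsum_mul_left]
        refine (rpow_tsum_le_tsum_rpow _ (by norm_num) (by norm_num) (by norm_num)).trans ?_
        refine ENNReal.tsum_le_tsum fun b => ?_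
        split_ifs
        · simp
        · exact le_rfl
    _ = 2 * ∑' b : p.support, ∫⁻ z, if a = b then 0 else (f a z * f b z) ^ (1 / 2 : ℝ) := by
        rw [lintegral_const_mul _ (Measurable.tsum hmix),
          lintegral_tsum fun b => (hmix b).aemeasurable]
    _ = _ := by
        congr 1
        refine tsum_congr fun b => ?_
        split_ifs
        · simp
        · have := lintegral_rpow_half_integrand p t v hv m 0 (Function.update 0 0 (a : ℝ))
            (Function.update 0 0 (b : ℝ)) a b
          rw [convAt_zero_update, convAt_zero_update, zero_add] at this
          rw [← this]
          simp only [hf, convAt_zero_update, zero_add]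

end WindowProblem

/-! ### Overlaps of the input law with its translates, and the contraction -/

section PairWeights

theorem rpow_half_le_add_div_two {x y : ℝ≥0∞} (hx : x ≠ ∞) (hy : y ≠ ∞) :
    (x * y) ^ (1 / 2 : ℝ) ≤ (x + y) / 2 ∧ (x ≠ y → (x * y) ^ (1 / 2 : ℝ) < (x + y) / 2) := by
  lift x to NNReal using hx
  lift y to NNReal using hy
  have e2 : (2 : ℝ≥0∞) = ((2 : NNReal) : ℝ≥0∞) := rfl
  rw [← ENNReal.coe_mul, ← ENNReal.coe_rpow_of_nonneg _ (by norm_num : (0 : ℝ) ≤ 1 / 2),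
    ← ENNReal.coe_add, e2, ← ENNReal.coe_div two_ne_zero, ENNReal.coe_le_coe, ENNReal.coe_lt_coe,
    Ne, ENNReal.coe_inj, ← NNReal.coe_le_coe, ← NNReal.coe_lt_coe, ← NNReal.coe_inj]
  push_cast
  rw [← Real.sqrt_eq_rpow]
  have hx := x.2
  have hy := y.2
  constructor
  · refine Real.sqrt_le_iff.2 ⟨by positivity, ?_⟩
    nlinarith [sq_nonneg ((x : ℝ) - y)]
  · intro hne
    have h := sq_pos_of_ne_zero (sub_ne_zero.2 hne)
    by_cases h0 : (x : ℝ) + y = 0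
    · exact absurd (by linarith [show (0 : ℝ) ≤ x from hx, show (0 : ℝ) ≤ y from hy]) hne
    · rw [Real.sqrt_lt' (by positivity)]
      nlinarith

variable (p : PMF ℝ)

/-- Write p as p(1+a²) times 1/(1+a²) and bound the geometric mean by the arithmetic one. The first
factor sums because the power is finite. The second sums because the letters are d-separated, so a ↦
⌊a/d⌋ is injective. -/
theorem tsum_rpow_half_ne_top (hpower : Integrable (fun a : ℝ => a ^ 2) p.toMeasure) {d : ℝ}
    (hd : 0 < d) (hsep : ∀ a ∈ p.support, ∀ b ∈ p.support, a ≠ b → d ≤ |a - b|) :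
    ∑' a : p.support, p a ^ (1 / 2 : ℝ) ≠ ∞ := by
  have h1 : ∑' a : p.support, p a * (1 + ENNReal.ofReal ((a : ℝ) ^ 2)) ≠ ∞ := by
    rw [← lintegral_toMeasure p fun a => 1 + ENNReal.ofReal (a ^ 2),
      lintegral_add_left measurable_const]
    refine ENNReal.add_ne_top.2 ⟨by simp, ?_⟩
    have := hpower.2
    rw [HasFiniteIntegral] at this
    convert this.ne using 3
    exact (Real.enorm_eq_ofReal (sq_nonneg _)).symm
  have h2 : ∑' a : p.support, ENNReal.ofReal (1 / (1 + (a : ℝ) ^ 2)) ≠ ∞ := by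
    set C : ℝ := 2 / d ^ 2 + 2
    have hC : 0 < C := by positivity
    -- At k = 0 the quotient is 0 by convention, and the extra term supplies the bound 1. Elsewhere
    -- C comes from k² ≤ 2(a/d)² + 2.
    set g : ℤ → ℝ := fun k => C * (1 / (k : ℝ) ^ 2) + if k = 0 then 1 else 0
    have hg0 : ∀ k, 0 ≤ g k := fun k => by
      simp only [g]
      split_ifs <;> positivity
    have hgs : Summable g :=
      ((Real.summable_one_div_int_pow.2 one_lt_two).mul_left C).add
        (summable_of_hasFiniteSupport ((Set.finite_singleton (0 : ℤ)).subset fun k hk => by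
          by_contra h
          exact hk (if_neg h)))
    let φ : p.support → ℤ := fun a => ⌊(a : ℝ) / d⌋
    have hφ : Function.Injective φ := by
      intro a b hab
      by_contra hne
      have h3 := hsep a a.2 b b.2 (fun h => hne (Subtype.ext h))
      have h4 : |(a : ℝ) / d - b / d| < 1 := Int.abs_sub_lt_one_of_floor_eq_floor hab
      rw [← sub_div, abs_div, abs_of_pos hd, div_lt_one hd] at h4
      linarith
    have hle : ∀ a : p.support, 1 / (1 + (a : ℝ) ^ 2) ≤ g (φ a) := by
      intro a
      set k := φ a
      by_cases hk : k = 0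
      · have : g k = 1 := by simp [g, hk]
        rw [this, div_le_one (by positivity)]
        nlinarith [sq_nonneg (a : ℝ)]
      · have hk' : (0 : ℝ) < (k : ℝ) ^ 2 := by positivity
        have e : g k = C / (k : ℝ) ^ 2 := by simp [g, hk]; ring
        rw [e, div_le_div_iff₀ (by positivity) hk']
        have h5 : (k : ℝ) ≤ a / d := Int.floor_le _
        have h6 : (a : ℝ) / d < k + 1 := Int.lt_floor_add_one _
        have h7 : (k : ℝ) ^ 2 ≤ 2 * ((a : ℝ) / d) ^ 2 + 2 := by
          nlinarith [sq_nonneg ((k : ℝ) - 2 * (a / d)), sq_nonneg ((a : ℝ) / d - 1),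
            sq_nonneg ((a : ℝ) / d + 1), mul_nonneg (sub_nonneg.2 h5) (sub_nonneg.2 h6.le)]
        have h8 : ((a : ℝ) / d) ^ 2 = a ^ 2 / d ^ 2 := div_pow _ _ _
        rw [h8] at h7
        calc 1 * (k : ℝ) ^ 2 ≤ 2 * ((a : ℝ) ^ 2 / d ^ 2) + 2 := by linarith
          _ ≤ 2 * ((a : ℝ) ^ 2 / d ^ 2) + 2 + (2 / d ^ 2 + 2 * a ^ 2) := by
              have : 0 ≤ 2 / d ^ 2 + 2 * (a : ℝ) ^ 2 := by positivity
              linarith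
          _ = C * (1 + (a : ℝ) ^ 2) := by simp only [C]; ring
    refine ne_top_of_le_ne_top hgs.tsum_ofReal_ne_top ?_
    calc _ ≤ ∑' a : p.support, ENNReal.ofReal (g (φ a)) :=
          ENNReal.tsum_le_tsum fun a => ENNReal.ofReal_le_ofReal (hle a)
      _ ≤ _ := ENNReal.tsum_comp_le_tsum_of_injective hφ fun k => ENNReal.ofReal (g k)
  refine ne_top_of_le_ne_top (ENNReal.add_ne_top.2 ⟨h1, h2⟩) ?_
  rw [← ENNReal.tsum_add]
  refine ENNReal.tsum_le_tsum fun a => ?_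
  have e1 : (1 : ℝ≥0∞) + ENNReal.ofReal ((a : ℝ) ^ 2) = ENNReal.ofReal (1 + (a : ℝ) ^ 2) := by
    rw [ENNReal.ofReal_add zero_le_one (sq_nonneg _), ENNReal.ofReal_one]
  have hpos : (0 : ℝ) < 1 + (a : ℝ) ^ 2 := by positivity
  have e2 : p a = (p a * ENNReal.ofReal (1 + (a : ℝ) ^ 2)) *
      ENNReal.ofReal (1 / (1 + (a : ℝ) ^ 2)) := by
    rw [mul_assoc, ← ENNReal.ofReal_mul hpos.le, mul_one_div_cancel hpos.ne', ENNReal.ofReal_one,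
      mul_one]
  rw [e1]
  conv_lhs => rw [e2]
  refine (rpow_half_le_add_div_two (ENNReal.mul_ne_top (p.apply_ne_top _) ENNReal.ofReal_ne_top)
    ENNReal.ofReal_ne_top).1.trans ?_
  exact ENNReal.half_le_self

theorem tsum_pairWeight (hS : ∑' a : p.support, p a ^ (1 / 2 : ℝ) ≠ ∞) :
    ∑' q : p.support × p.support, pairWeight p q.1 q.2 ≠ ∞ := by
  have : ∑' q : p.support × p.support, pairWeight p q.1 q.2
      = (∑' a : p.support, p a ^ (1 / 2 : ℝ)) * ∑' a : p.support, p a ^ (1 / 2 : ℝ) := by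
    rw [ENNReal.tsum_prod (f := fun a b : p.support => pairWeight p a b), ← ENNReal.tsum_mul_right]
    refine tsum_congr fun a => ?_
    rw [← ENNReal.tsum_mul_left]
    refine tsum_congr fun b => ?_
    rw [pairWeight, ENNReal.mul_rpow_of_nonneg _ _ (by norm_num)]
  rw [this]
  exact ENNReal.mul_ne_top hS hS

theorem tsum_ite_sub_le (a e : ℝ) (f : ℝ → ℝ≥0∞) :
    ∑' b : p.support, (if a - b = e then f b else 0) ≤ f (a - e) := by
  by_cases h : a - e ∈ p.support
  · rw [tsum_eq_single ⟨a - e, h⟩]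
    · simp
    · intro b hb
      refine if_neg fun he => hb (Subtype.ext ?_)
      simp only
      linarith
  · have : ∀ b : p.support, (if a - (b : ℝ) = e then f b else 0) = 0 := fun b =>
      if_neg fun he => h (by rw [show a - e = b by linarith]; exact b.2)
    simp [this]

/-- The overlap of the input distribution with its translate by `e`. -/
def overlap (e : ℝ) : ℝ≥0∞ :=
  ∑' q : p.support × p.support, if (q.1 : ℝ) - q.2 = e then pairWeight p q.1 q.2 else 0

/-- The arithmetic-geometric mean inequality gives at most 1. Equality would force p(a) = p(a − e)
at every letter, making p constant along an infinite progression, which is impossible for a summable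
function. -/
theorem overlap_lt_one {e : ℝ} (he : e ≠ 0) : overlap p e < 1 := by
  have h1 : overlap p e ≤ ∑' a : p.support, (p a * p (a - e)) ^ (1 / 2 : ℝ) := by
    unfold overlap
    rw [ENNReal.tsum_prod (f := fun a b : p.support =>
      if (a : ℝ) - b = e then pairWeight p a b else 0)]
    exact ENNReal.tsum_le_tsum fun a => tsum_ite_sub_le p a e fun b => pairWeight p a b
  have h2 : ∑' a : p.support, (p a + p (a - e)) / 2 ≤ 1 := by
    simp_rw [div_eq_mul_inv]
    rw [ENNReal.tsum_mul_right, ENNReal.tsum_add, tsum_support]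
    have h3 : ∑' a : p.support, p (a - e) ≤ 1 := by
      rw [← p.tsum_coe]
      exact ENNReal.tsum_comp_le_tsum_of_injective
        (f := fun a : p.support => (a : ℝ) - e) (fun a b hab => Subtype.ext (by simpa using hab)) p
    calc (1 + ∑' a : p.support, p (a - e)) * 2⁻¹ ≤ (1 + 1) * 2⁻¹ := by gcongr
      _ = 1 := by
        rw [one_add_one_eq_two]
        exact ENNReal.mul_inv_cancel two_ne_zero ENNReal.ofNat_ne_top
  have hle : ∀ a : p.support, (p a * p (a - e)) ^ (1 / 2 : ℝ) ≤ (p a + p (a - e)) / 2 := fun a =>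
    (rpow_half_le_add_div_two (p.apply_ne_top _) (p.apply_ne_top _)).1
  obtain ⟨a, ha⟩ : ∃ a : p.support, p a ≠ p (a - e) := by
    by_contra! hcon
    obtain ⟨a₀, ha₀⟩ := p.support_nonempty
    have hn : ∀ n : ℕ, p (a₀ - n * e) = p a₀ := by
      intro n
      induction n with
      | zero => simp
      | succ n ih =>
        have hmem : a₀ - n * e ∈ p.support := by
          rw [p.mem_support_iff, ih]
          exact (p.mem_support_iff _).1 ha₀
        rw [← ih, hcon ⟨_, hmem⟩]
        congr 1
        push_cast
        ring
    have hfin := ENNReal.finite_const_le_of_tsum_ne_top p.tsum_coe_ne_top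
      ((p.mem_support_iff _).1 ha₀)
    have hinj : Function.Injective fun n : ℕ => a₀ - n * e := by
      intro m n hmn
      have : (m : ℝ) * e = n * e := by simpa using hmn
      exact_mod_cast mul_right_cancel₀ he this
    exact Set.infinite_of_injective_forall_mem hinj (fun n => (hn n).ge) hfin
  refine h1.trans_lt (lt_of_lt_of_le (ENNReal.tsum_lt_tsum ?_ hle
    ((rpow_half_le_add_div_two (p.apply_ne_top _) (p.apply_ne_top _)).2 ha)) h2)
  exact ne_top_of_le_ne_top ENNReal.one_ne_top ((ENNReal.tsum_le_tsum hle).trans h2)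

theorem exists_finset_tsum_le {ι : Type*} {f : ι → ℝ≥0∞} (hf : ∑' i, f i ≠ ∞) {η : ℝ≥0∞}
    (hη : η ≠ 0) : ∃ s : Finset ι, ∑' i, (s : Set ι)ᶜ.indicator f i ≤ η := by
  obtain ⟨s, hs⟩ := ((ENNReal.tendsto_tsum_compl_atTop_zero hf).eventually_le_const
    (pos_iff_ne_zero.2 hη)).exists
  refine ⟨s, ?_⟩
  rw [← tsum_subtype]
  exact hs

/-- Finitely many pairs carry all but 1/2 of the finite total weight. A difference not realised by
them has overlap at most 1/2, and only finitely many nonzero differences remain. -/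
theorem exists_overlap_le (hS : ∑' a : p.support, p a ^ (1 / 2 : ℝ) ≠ ∞) :
    ∃ ρ : ℝ, 0 < ρ ∧ ρ < 1 ∧ ∀ e ≠ 0, overlap p e ≤ ENNReal.ofReal ρ := by
  classical
  obtain ⟨s, hs⟩ := exists_finset_tsum_le (tsum_pairWeight p hS) (η := 2⁻¹) (by simp)
  set D : Finset ℝ := (s.image fun q => (q.1 : ℝ) - q.2).erase 0
  set R : ℝ≥0∞ := max 2⁻¹ (D.sup (overlap p))
  have hR1 : R < 1 := by
    refine max_lt ENNReal.one_half_lt_one ((Finset.sup_lt_iff zero_lt_one).2 fun e he => ?_)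
    exact overlap_lt_one p (Finset.ne_of_mem_erase he)
  have hR0 : 0 < R := lt_of_lt_of_le (by simp) (le_max_left _ _)
  refine ⟨R.toReal, ENNReal.toReal_pos hR0.ne' hR1.ne_top, ?_, fun e he => ?_⟩
  · rw [← ENNReal.toReal_one]
    exact (ENNReal.toReal_lt_toReal hR1.ne_top ENNReal.one_ne_top).2 hR1
  · rw [ENNReal.ofReal_toReal hR1.ne_top]
    by_cases hD : e ∈ D
    · exact (Finset.le_sup hD).trans (le_max_right _ _)
    · refine le_trans ?_ (le_max_left _ _)
      refine le_trans (ENNReal.tsum_le_tsum fun q => ?_) hs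
      split_ifs with hq
      · rw [Set.indicator_of_mem]
        intro hqs
        exact hD (Finset.mem_erase.2 ⟨he, Finset.mem_image.2 ⟨q, hqs, hq⟩⟩)
      · exact zero_le

theorem exists_pos_gap (D : Finset ℝ) : ∃ g > 0, ∀ x ∈ D, ∀ y ∈ D, x ≠ y → g ≤ |x - y| := by
  classical
  rcases D.offDiag.eq_empty_or_nonempty with h | h
  · refine ⟨1, one_pos, fun x hx y hy hxy => ?_⟩
    have : (x, y) ∈ D.offDiag := Finset.mem_offDiag.2 ⟨hx, hy, hxy⟩
    simp [h] at this
  · obtain ⟨q, hq, hmin⟩ := Finset.exists_min_image _ (fun q : ℝ × ℝ => |q.1 - q.2|) h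
    refine ⟨|q.1 - q.2|, abs_pos.2 (sub_ne_zero.2 (Finset.mem_offDiag.1 hq).2.2),
      fun x hx y hy hxy => ?_⟩
    exact hmin (x, y) (Finset.mem_offDiag.2 ⟨hx, hy, hxy⟩)

/-- The total weight of the pairs of different letters, attenuated by the distance of the outputs
that they produce. -/
def offDiagWeight (lam τ c : ℝ) : ℝ≥0∞ :=
  ∑' q : p.support × p.support, if q.1 = q.2 then 0 else
    pairWeight p q.1 q.2 * ENNReal.ofReal (Real.exp (-lam * (τ * (q.1 - q.2) + c) ^ 2))

/-- Up to weight η/2 only finitely many differences matter, and these together with 0 are separated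
by a gap g. Hence at most one lies within g/2 of the cancelling value x = −c/τ, and a large `lam`
suppresses the others. If that one is 0, all unequal pairs are negligible. Otherwise 0 is far from
x, so equal pairs are attenuated too, and the one surviving difference has overlap at most ρ. -/
theorem exists_offDiagWeight_le (hS : ∑' a : p.support, p a ^ (1 / 2 : ℝ) ≠ ∞) {τ : ℝ}
    (hτ : τ ≠ 0) {ρ η : ℝ} (hρ : 0 ≤ ρ) (hoverlap : ∀ e ≠ 0, overlap p e ≤ ENNReal.ofReal ρ)
    (hη : 0 < η) :
    ∃ lam > 0, ∀ c, offDiagWeight p lam τ c ≤ ENNReal.ofReal η ∨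
      (Real.exp (-lam * c ^ 2) ≤ η ∧ offDiagWeight p lam τ c ≤ ENNReal.ofReal (ρ + η)) := by
  classical
  have hW := tsum_pairWeight p hS
  set SS := ∑' q : p.support × p.support, pairWeight p q.1 q.2
  obtain ⟨s, hs⟩ := exists_finset_tsum_le hW (η := ENNReal.ofReal (η / 2))
    (by simpa using hη)
  set D : Finset ℝ := insert 0 (s.image fun q => (q.1 : ℝ) - q.2)
  obtain ⟨g, hg, hgap⟩ := exists_pos_gap D
  -- Small enough that attenuating the whole weight `SS` by ζ leaves at most η/2, and below 1 so
  -- that `lam` is positive.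
  set ζ : ℝ := min (1 / 2) (η / (2 * (SS.toReal + 1)))
  have hSS0 : 0 ≤ SS.toReal := ENNReal.toReal_nonneg
  have hζ0 : 0 < ζ := lt_min (by norm_num) (by positivity)
  have hζ1 : ζ < 1 := (min_le_left _ _).trans_lt (by norm_num)
  have hζ2 : ζ * (2 * (SS.toReal + 1)) ≤ η := by
    rw [← le_div_iff₀ (by positivity)]
    exact min_le_right _ _
  -- Chosen so that exp(−lam·(τg/2)²) = ζ.
  set lam : ℝ := -Real.log ζ / (τ ^ 2 * (g / 2) ^ 2)
  have hden : 0 < τ ^ 2 * (g / 2) ^ 2 := by positivity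
  have hlam : 0 < lam := div_pos (neg_pos.2 (Real.log_neg hζ0 hζ1)) hden
  have hexp : ∀ x : ℝ, g / 2 ≤ |x| → Real.exp (-lam * (τ * x) ^ 2) ≤ ζ := by
    intro x hx
    rw [← Real.le_log_iff_exp_le hζ0]
    have h1 : (g / 2) ^ 2 ≤ x ^ 2 := by
      rw [← sq_abs x]
      exact pow_le_pow_left₀ (by positivity) hx 2
    have h2 : lam * (τ ^ 2 * (g / 2) ^ 2) = -Real.log ζ := div_mul_cancel₀ _ hden.ne'
    have h3 : lam * (τ ^ 2 * (g / 2) ^ 2) ≤ lam * (τ ^ 2 * x ^ 2) := by gcongr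
    rw [mul_pow]
    linarith
  have hcommon : ENNReal.ofReal ζ * SS + ENNReal.ofReal (η / 2) ≤ ENNReal.ofReal η := by
    rw [← ENNReal.ofReal_toReal hW, ← ENNReal.ofReal_mul hζ0.le,
      ← ENNReal.ofReal_add (by positivity) (by positivity)]
    refine ENNReal.ofReal_le_ofReal ?_
    nlinarith
  refine ⟨lam, hlam, fun c => ?_⟩
  set x := -c / τ
  have hcx : ∀ e : ℝ, τ * e + c = τ * (e - x) := by
    intro e
    simp only [x]
    field_simp
    ring
  have hexp1 : ∀ e : ℝ, Real.exp (-lam * (τ * e + c) ^ 2) ≤ 1 := fun e => by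
    rw [Real.exp_le_one_iff]
    nlinarith [mul_nonneg hlam.le (sq_nonneg (τ * e + c))]
  have hbound : ∀ e₁ : ℝ, (∀ e ∈ D, e ≠ e₁ → g / 2 ≤ |e - x|) → offDiagWeight p lam τ c
      ≤ (∑' q : p.support × p.support, if q.1 = q.2 then 0 else
          if (q.1 : ℝ) - q.2 = e₁ then pairWeight p q.1 q.2 else 0) + ENNReal.ofReal η := by
    intro e₁ he₁
    refine le_trans ?_ (add_le_add_right hcommon _)
    refine le_trans ?_ (add_le_add_right (add_le_add_right hs _) _)
    rw [← ENNReal.tsum_mul_left, ← ENNReal.tsum_add, ← ENNReal.tsum_add]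
    refine ENNReal.tsum_le_tsum fun q => ?_
    split_ifs with h1 h2
    · exact zero_le
    · refine le_trans ?_ le_self_add
      exact mul_le_of_le_one_right' (ENNReal.ofReal_le_one.2 (hexp1 _))
    · rw [zero_add]
      by_cases hq : q ∈ s
      · refine le_trans ?_ le_self_add
        rw [mul_comm]
        refine mul_le_mul_left (ENNReal.ofReal_le_ofReal ?_) _
        rw [hcx]
        refine hexp _ (he₁ _ ?_ h2)
        exact Finset.mem_insert_of_mem (Finset.mem_image.2 ⟨q, hq, rfl⟩)
      · refine le_trans ?_ le_add_self
        rw [Set.indicator_of_mem (by exact hq)]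
        exact mul_le_of_le_one_right' (ENNReal.ofReal_le_one.2 (hexp1 _))
  by_cases hx : |0 - x| < g / 2
  · left
    refine (hbound 0 fun e he hne => ?_).trans ?_
    · have h1 := hgap e he 0 (Finset.mem_insert_self _ _) hne
      have h2 := abs_sub_le e x 0
      rw [abs_sub_comm x 0] at h2
      linarith
    · have : ∀ q : p.support × p.support, (if q.1 = q.2 then (0 : ℝ≥0∞) else
          if (q.1 : ℝ) - q.2 = 0 then pairWeight p q.1 q.2 else 0) = 0 := by
        intro q
        split_ifs with h1 h2
        · rfl
        · exact absurd (Subtype.ext (sub_eq_zero.1 h2)) h1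
        · rfl
      simp [this]
  · right
    refine ⟨?_, ?_⟩
    · have h1 := hexp (0 - x) (not_lt.1 hx)
      have h2 := hcx 0
      rw [mul_zero, zero_add] at h2
      rw [← h2] at h1
      refine h1.trans ?_
      nlinarith
    · obtain ⟨e₁, he₁0, he₁⟩ : ∃ e₁ : ℝ, e₁ ≠ 0 ∧ ∀ e ∈ D, e ≠ e₁ → g / 2 ≤ |e - x| := by
        by_cases hex : ∃ e₁ ∈ D, |e₁ - x| < g / 2
        · obtain ⟨e₁, h1, h2⟩ := hex
          refine ⟨e₁, fun h0 => hx (h0 ▸ h2), fun e he hne => ?_⟩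
          have h3 := hgap e he e₁ h1 hne
          have h4 := abs_sub_le e x e₁
          rw [abs_sub_comm x e₁] at h4
          linarith
        -- No relevant difference is near x, so any nonzero value may serve as the exception.
        · push Not at hex
          exact ⟨1, one_ne_zero, fun e he _ => hex e he⟩
      refine (hbound e₁ he₁).trans ?_
      rw [ENNReal.ofReal_add hρ hη.le]
      refine add_le_add_left (le_trans (ENNReal.tsum_le_tsum fun q => ?_) (hoverlap e₁ he₁0)) _
      split_ifs <;> simp

/-- At high signal-to-noise ratio the weights of unresolved error events contract geometrically. -/
theorem exists_contraction (hS : ∑' a : p.support, p a ^ (1 / 2 : ℝ) ≠ ∞) {τ : ℝ} (hτ : τ ≠ 0)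
    (L : ℕ) : ∃ lam θ κ : ℝ, 0 < lam ∧ 0 < θ ∧ θ < 1 ∧ 0 < κ ∧ κ < 1 ∧ ∀ c : ℝ, ∀ r ≤ L,
      ENNReal.ofReal (Real.exp (-lam * c ^ 2) * θ ^ (r + 1)) + offDiagWeight p lam τ c
        ≤ ENNReal.ofReal (κ * θ ^ r) := by
  obtain ⟨ρ, hρ0, hρ1, hρ⟩ := exists_overlap_le p hS
  -- Bernoulli's inequality then gives θ^(L+1) ≥ (1+ρ)/2, so θ^(r+1) ≥ (1+ρ)/2 for every r ≤ L.
  set θ : ℝ := 1 - (1 - ρ) / (2 * (L + 1))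
  have hL : (0 : ℝ) < 2 * (L + 1) := by positivity
  have hq0 : 0 < (1 - ρ) / (2 * (L + 1)) := div_pos (by linarith) hL
  have hq1 : (1 - ρ) / (2 * (L + 1)) < 1 := by
    rw [div_lt_one hL]
    have : (0 : ℝ) ≤ L := Nat.cast_nonneg L
    linarith
  have hθ0 : 0 < θ := by simp only [θ]; linarith
  have hθ1 : θ < 1 := by simp only [θ]; linarith
  have hθL : (1 + ρ) / 2 ≤ θ ^ (L + 1) := by
    have h := one_add_mul_le_pow (a := -((1 - ρ) / (2 * ((L : ℝ) + 1)))) (by linarith) (L + 1)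
    have e1 : (1 : ℝ) + -((1 - ρ) / (2 * ((L : ℝ) + 1))) = θ := by simp only [θ]; ring
    rw [e1] at h
    refine le_trans (le_of_eq ?_) h
    push_cast
    field_simp
    ring
  set κ : ℝ := (1 + θ) / 2
  -- The first bound gives θ^(r+1) + η ≤ κθ^r, when unequal pairs are negligible. The second gives η
  -- + (ρ + η) ≤ (1+ρ)/2 ≤ θ^(r+1) ≤ κθ^r, when equal pairs are attenuated.
  set η : ℝ := min ((1 + ρ) / 2 * ((1 - θ) / 2)) ((1 - ρ) / 4)
  have hη0 : 0 < η := lt_min (mul_pos (by linarith) (by linarith)) (by linarith)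
  have hη1 : η ≤ (1 + ρ) / 2 * ((1 - θ) / 2) := min_le_left _ _
  have hη2 : η ≤ (1 - ρ) / 4 := min_le_right _ _
  obtain ⟨lam, hlam, h⟩ := exists_offDiagWeight_le p hS hτ hρ0.le hρ hη0
  refine ⟨lam, θ, κ, hlam, hθ0, hθ1, by simp only [κ]; linarith, by simp only [κ]; linarith,
    fun c r hr => ?_⟩
  have hθr : θ ^ (L + 1) ≤ θ ^ (r + 1) := pow_le_pow_of_le_one hθ0.le hθ1.le (by omega)
  have hθr1 : θ ^ (r + 1) ≤ 1 := pow_le_one₀ hθ0.le hθ1.le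
  have hsucc : θ ^ (r + 1) = θ ^ r * θ := pow_succ θ r
  have hr0 : 0 < θ ^ r := pow_pos hθ0 r
  have hrr : θ ^ (r + 1) ≤ θ ^ r := by rw [hsucc]; nlinarith
  have hexp1 : Real.exp (-lam * c ^ 2) ≤ 1 := by
    rw [Real.exp_le_one_iff]
    nlinarith [mul_nonneg hlam.le (sq_nonneg c)]
  have hexp0 := Real.exp_pos (-lam * c ^ 2)
  rcases h c with h1 | ⟨h1, h2⟩
  · refine (add_le_add_right h1 _).trans ?_
    rw [← ENNReal.ofReal_add (by positivity) hη0.le]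
    refine ENNReal.ofReal_le_ofReal ?_
    have h3 : Real.exp (-lam * c ^ 2) * θ ^ (r + 1) ≤ θ ^ (r + 1) :=
      mul_le_of_le_one_left (by positivity) hexp1
    have h4 : (1 + ρ) / 2 * ((1 - θ) / 2) ≤ θ ^ r * ((1 - θ) / 2) := by
      gcongr
      linarith
    simp only [κ]
    nlinarith
  · refine (add_le_add_right h2 _).trans ?_
    rw [← ENNReal.ofReal_add (by positivity) (by positivity)]
    refine ENNReal.ofReal_le_ofReal ?_
    have h3 : Real.exp (-lam * c ^ 2) * θ ^ (r + 1) ≤ η * 1 := by gcongr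
    have h4 : θ ^ (r + 1) ≤ κ * θ ^ r := by
      rw [hsucc, mul_comm]
      simp only [κ]
      gcongr
      linarith
    linarith

end PairWeights

/-! ### Output energy of a difference sequence -/

section Energy

/-- The energy of the first `n` outputs to the input sequence `e`. -/
def energy (t : ℕ → ℝ) (n : ℕ) (e : ℕ → ℝ) : ℝ := ∑ k ∈ Finset.range n, convAt t k e ^ 2

theorem energy_nonneg (t : ℕ → ℝ) (n : ℕ) (e : ℕ → ℝ) : 0 ≤ energy t n e :=
  Finset.sum_nonneg fun _ _ => sq_nonneg _

theorem energy_update_succ (t : ℕ → ℝ) (n : ℕ) (x y : ℕ → ℝ) (a b : ℝ) :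
    energy t (n + 1) (Function.update x n a - Function.update y n b)
      = energy t n (x - y)
        + (convAt t n (Function.update x n a) - convAt t n (Function.update y n b)) ^ 2 := by
  rw [energy, Finset.sum_range_succ, convAt_sub]
  congr 1
  refine Finset.sum_congr rfl fun k hk => ?_
  rw [convAt_congr t fun j hj => ?_]
  have : j ≠ n := by have := Finset.mem_range.1 hk; omega
  simp [Function.update_of_ne this]

theorem convAt_update_sub_update (t : ℕ → ℝ) (n : ℕ) (x y : ℕ → ℝ) (a b : ℝ) :
    convAt t n (Function.update x n a) - convAt t n (Function.update y n b)
      = t 0 * (a - b) + ∑ j ∈ Finset.range n, t (n - j) * (x j - y j) := by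
  rw [convAt_sub, convAt, Finset.sum_range_succ, add_comm]
  congr 1
  · simp
  · refine Finset.sum_congr rfl fun j hj => ?_
    have : j ≠ n := by have := Finset.mem_range.1 hj; omega
    simp [Function.update_of_ne this]

theorem pairWeight_self (p : PMF ℝ) (a : ℝ) : pairWeight p a a = p a := by
  rw [pairWeight, ← sq, ← ENNReal.rpow_natCast, ← ENNReal.rpow_mul]
  norm_num

theorem tsum_pair_eq (p : PMF ℝ) (f : p.support → p.support → ℝ≥0∞) :
    ∑' a, ∑' b, f a b
      = ∑' a, f a a + ∑' q : p.support × p.support, if q.1 = q.2 then 0 else f q.1 q.2 := by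
  classical
  rw [ENNReal.tsum_prod (f := fun a b => if a = b then 0 else f a b), ← ENNReal.tsum_add]
  refine tsum_congr fun a => ?_
  rw [ENNReal.tsum_eq_add_tsum_ite a]
  congr 1
  refine tsum_congr fun b => ?_
  by_cases hab : a = b
  · simp [hab]
  · simp [hab, Ne.symm hab]

end Energy

/-! ### Summation over error events -/

section ErrorEvents

variable (p : PMF ℝ) (t : ℕ → ℝ) (v : NNReal)

/-- Here l is the time of the last difference and r the number of agreeing letters since. The
Gaussian exponent 1/(8v) is split: the share `lam` pays for the contraction, and the rest w
accumulates the energy. Induction on the number m of remaining outputs: with none left, κ^0 covers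
the coefficient 1; at r = L the event is closed and its energy is at least Δ. Otherwise equal next
letters lead to r + 1, different ones reset r to 0, and `hcontr` returns a factor κ relative to the
weight θ^r. -/
theorem exp_energy_mul_bhatt_le (hv : v ≠ 0) {L : ℕ} (ht : ∀ i, L ≤ i → t i = 0)
    {lam θ κ Δ : ℝ} (hlam : lam ≤ 1 / (8 * v)) (hθ0 : 0 < θ) (hθ1 : θ < 1) (hκ0 : 0 < κ)
    (hκ1 : κ < 1)
    (hcontr : ∀ c : ℝ, ∀ r ≤ L, ENNReal.ofReal (Real.exp (-lam * c ^ 2) * θ ^ (r + 1))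
      + offDiagWeight p lam (t 0) c ≤ ENNReal.ofReal (κ * θ ^ r))
    (hΔ : ∀ (l : ℕ) (x y : ℕ → ℝ), x 0 ≠ y 0 → x l ≠ y l →
      (∀ j ≤ l, x j ∈ p.support ∧ y j ∈ p.support) →
      (∀ j, l < j → j < l + 1 + L → x j = y j) → Δ ≤ energy t (l + 1 + L) (x - y))
    (m l r : ℕ) (x y : ℕ → ℝ) (hr : r ≤ L) (h0 : x 0 ≠ y 0) (hl : x l ≠ y l)
    (hsupp : ∀ j < l + 1 + r, x j ∈ p.support ∧ y j ∈ p.support)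
    (heq : ∀ j, l < j → j < l + 1 + r → x j = y j) :
    ENNReal.ofReal (Real.exp (-(1 / (8 * v) - lam) * energy t (l + 1 + r) (x - y)))
        * bhatt p t v m (l + 1 + r) x y
      ≤ ENNReal.ofReal (θ ^ r / θ ^ L * (Real.exp (-(1 / (8 * v) - lam) * Δ) + κ ^ m)) := by
  set w : ℝ := 1 / (8 * v) - lam with hw
  have hw0 : 0 ≤ w := by simp only [hw]; linarith
  have hexp1 : ∀ E : ℝ, 0 ≤ E → Real.exp (-w * E) ≤ 1 := fun E hE => by
    rw [Real.exp_le_one_iff]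
    nlinarith [mul_nonneg hw0 hE]
  have hθL : 0 < θ ^ L := pow_pos hθ0 L
  induction m generalizing l r x y with
  | zero =>
    rw [bhatt_zero, mul_one]
    refine ENNReal.ofReal_le_ofReal ?_
    have h1 : 1 ≤ θ ^ r / θ ^ L := by
      rw [le_div_iff₀ hθL, one_mul]
      exact pow_le_pow_of_le_one hθ0.le hθ1.le hr
    have h2 : 1 ≤ Real.exp (-w * Δ) + κ ^ 0 := by
      rw [pow_zero]
      linarith [Real.exp_pos (-w * Δ)]
    exact (hexp1 _ (energy_nonneg _ _ _)).trans (one_le_mul_of_one_le_of_one_le h1 h2)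
  | succ m ih =>
    rcases hr.eq_or_lt with rfl | hr'
    · rw [bhatt_eq_one p t v hv ht _ fun j hj hj' => heq j (by omega) hj, mul_one,
        div_self hθL.ne', one_mul]
      refine ENNReal.ofReal_le_ofReal ?_
      have h1 := hΔ l x y h0 hl (fun j hj => hsupp j (by omega)) heq
      have h2 : Real.exp (-w * energy t (l + 1 + r) (x - y)) ≤ Real.exp (-w * Δ) :=
        Real.exp_le_exp.2 (by nlinarith [mul_le_mul_of_nonneg_left h1 hw0])
      have h3 : 0 < κ ^ (m + 1) := pow_pos hκ0 _
      linarith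
    · set n := l + 1 + r with hn
      set c : ℝ := ∑ j ∈ Finset.range n, t (n - j) * (x j - y j)
      set Q : ℝ := Real.exp (-w * Δ) + κ ^ m
      have hQ : 0 < Q := add_pos (Real.exp_pos _) (pow_pos hκ0 m)
      have hQL : 0 ≤ Q / θ ^ L := (div_pos hQ hθL).le
      -- The squared distance of the new output is divided: its share w joins the accumulated
      -- energy, its share `lam` stays as attenuation for the contraction.
      have hterm : ∀ a b : ℝ, ENNReal.ofReal (Real.exp (-w * energy t n (x - y))) *
          (pairWeight p a b * (ENNReal.ofReal (Real.exp (-(convAt t n (Function.update x n a)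
            - convAt t n (Function.update y n b)) ^ 2 / (8 * v))) *
          bhatt p t v m (n + 1) (Function.update x n a) (Function.update y n b)))
          = pairWeight p a b * (ENNReal.ofReal (Real.exp (-lam * (t 0 * (a - b) + c) ^ 2)) *
            (ENNReal.ofReal (Real.exp (-w * energy t (n + 1)
              (Function.update x n a - Function.update y n b))) *
            bhatt p t v m (n + 1) (Function.update x n a) (Function.update y n b))) := by
        intro a b
        have key : ENNReal.ofReal (Real.exp (-w * energy t n (x - y))) *
            ENNReal.ofReal (Real.exp (-(convAt t n (Function.update x n a)
            - convAt t n (Function.update y n b)) ^ 2 / (8 * v)))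
            = ENNReal.ofReal (Real.exp (-lam * (t 0 * (a - b) + c) ^ 2)) *
            ENNReal.ofReal (Real.exp (-w * energy t (n + 1)
              (Function.update x n a - Function.update y n b))) := by
          rw [← ENNReal.ofReal_mul (Real.exp_pos _).le, ← ENNReal.ofReal_mul (Real.exp_pos _).le,
            ← Real.exp_add, ← Real.exp_add, energy_update_succ, convAt_update_sub_update]
          congr 2
          simp only [hw]
          ring
        rw [← mul_assoc (ENNReal.ofReal (Real.exp (-lam * _))), ← key]
        ring
      have hsame : ∀ a : p.support, ENNReal.ofReal (Real.exp (-w * energy t (n + 1)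
              (Function.update x n (a : ℝ) - Function.update y n (a : ℝ)))) *
            bhatt p t v m (n + 1) (Function.update x n (a : ℝ)) (Function.update y n (a : ℝ))
          ≤ ENNReal.ofReal (Q / θ ^ L * θ ^ (r + 1)) := by
        intro a
        have := ih l (r + 1) (Function.update x n (a : ℝ)) (Function.update y n (a : ℝ)) hr'
          (by simpa [Function.update_of_ne (show (0 : ℕ) ≠ n by omega)] using h0)
          (by simpa [Function.update_of_ne (show l ≠ n by omega)] using hl)
          (fun j hj => by
            by_cases hjn : j = n
            · subst hjn; simp only [Function.update_self]; exact ⟨a.2, a.2⟩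
            · rw [Function.update_of_ne hjn, Function.update_of_ne hjn]
              exact hsupp j (by omega))
          (fun j hj hj' => by
            by_cases hjn : j = n
            · subst hjn; simp
            · rw [Function.update_of_ne hjn, Function.update_of_ne hjn]
              exact heq j hj (by omega))
        refine this.trans (le_of_eq ?_)
        congr 1
        ring
      have hdiff : ∀ a b : p.support, a ≠ b → ENNReal.ofReal (Real.exp (-w * energy t (n + 1)
              (Function.update x n (a : ℝ) - Function.update y n (b : ℝ)))) *
            bhatt p t v m (n + 1) (Function.update x n (a : ℝ)) (Function.update y n (b : ℝ))
          ≤ ENNReal.ofReal (Q / θ ^ L) := by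
        intro a b hab
        have := ih n 0 (Function.update x n (a : ℝ)) (Function.update y n (b : ℝ)) (Nat.zero_le _)
          (by simpa [Function.update_of_ne (show (0 : ℕ) ≠ n by omega)] using h0)
          (by simpa [Subtype.ext_iff] using hab)
          (fun j hj => by
            by_cases hjn : j = n
            · subst hjn; simp only [Function.update_self]; exact ⟨a.2, b.2⟩
            · rw [Function.update_of_ne hjn, Function.update_of_ne hjn]
              exact hsupp j (by omega))
          (fun j hj hj' => by omega)
        refine this.trans (le_of_eq ?_)
        congr 1
        ring
      calc ENNReal.ofReal (Real.exp (-w * energy t n (x - y))) * bhatt p t v (m + 1) n x y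
          ≤ ∑' a : p.support, ∑' b : p.support, pairWeight p a b *
            (ENNReal.ofReal (Real.exp (-lam * (t 0 * ((a : ℝ) - b) + c) ^ 2)) *
            (ENNReal.ofReal (Real.exp (-w * energy t (n + 1)
              (Function.update x n (a : ℝ) - Function.update y n (b : ℝ)))) *
            bhatt p t v m (n + 1) (Function.update x n (a : ℝ))
              (Function.update y n (b : ℝ)))) := by
            refine (mul_le_mul_right (bhatt_succ_le p t v hv m n x y) _).trans (le_of_eq ?_)
            simp_rw [← ENNReal.tsum_mul_left, hterm]
        _ ≤ ENNReal.ofReal (Q / θ ^ L) *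
            (ENNReal.ofReal (Real.exp (-lam * c ^ 2) * θ ^ (r + 1))
              + offDiagWeight p lam (t 0) c) := by
            rw [tsum_pair_eq, mul_add]
            refine add_le_add ?_ ?_
            · calc _ ≤ ∑' a : p.support, p a * (ENNReal.ofReal (Real.exp (-lam * c ^ 2)) *
                    ENNReal.ofReal (Q / θ ^ L * θ ^ (r + 1))) := by
                    refine ENNReal.tsum_le_tsum fun a => ?_
                    rw [pairWeight_self, sub_self, mul_zero, zero_add]
                    gcongr
                    exact hsame a
                _ = _ := by
                    rw [ENNReal.tsum_mul_right, tsum_support, one_mul,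
                      ← ENNReal.ofReal_mul (Real.exp_pos _).le, ← ENNReal.ofReal_mul hQL]
                    congr 1
                    ring
            · rw [offDiagWeight, ← ENNReal.tsum_mul_left]
              refine ENNReal.tsum_le_tsum fun q => ?_
              split_ifs with hq
              · simp
              · calc _ ≤ pairWeight p q.1 q.2 *
                      (ENNReal.ofReal (Real.exp (-lam * (t 0 * ((q.1 : ℝ) - q.2) + c) ^ 2)) *
                        ENNReal.ofReal (Q / θ ^ L)) := by
                      gcongr
                      exact hdiff _ _ hq
                  _ = _ := by ring
        _ ≤ ENNReal.ofReal (Q / θ ^ L) * ENNReal.ofReal (κ * θ ^ r) := by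
            gcongr
            exact hcontr c r hr
        _ ≤ _ := by
            rw [← ENNReal.ofReal_mul hQL]
            refine ENNReal.ofReal_le_ofReal ?_
            -- Only the unfinished part κ^m needs the gain κ; for closed events κ < 1 is simply
            -- discarded.
            have h1 : κ * Q ≤ Real.exp (-w * Δ) + κ ^ (m + 1) := by
              simp only [Q]
              rw [mul_add, pow_succ']
              nlinarith [Real.exp_pos (-w * Δ)]
            have h2 : Q / θ ^ L * (κ * θ ^ r) = θ ^ r / θ ^ L * (κ * Q) := by ring
            rw [h2]
            gcongr

/-- The conditional entropy of the first letter is governed by the least energy of error events. -/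
theorem condEntropy_le_exp (hv : v ≠ 0) {L : ℕ} (ht : ∀ i, L ≤ i → t i = 0)
    {lam θ κ Δ : ℝ} (hlam0 : 0 ≤ lam) (hlam : lam ≤ 1 / (8 * v)) (hθ0 : 0 < θ) (hθ1 : θ < 1)
    (hκ0 : 0 < κ) (hκ1 : κ < 1)
    (hcontr : ∀ c : ℝ, ∀ r ≤ L, ENNReal.ofReal (Real.exp (-lam * c ^ 2) * θ ^ (r + 1))
      + offDiagWeight p lam (t 0) c ≤ ENNReal.ofReal (κ * θ ^ r))
    (hΔ : ∀ (l : ℕ) (x y : ℕ → ℝ), x 0 ≠ y 0 → x l ≠ y l →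
      (∀ j ≤ l, x j ∈ p.support ∧ y j ∈ p.support) →
      (∀ j, l < j → j < l + 1 + L → x j = y j) → Δ ≤ energy t (l + 1 + L) (x - y))
    (m : ℕ) :
    condEntropy p t v m ≤ 2 * (∑' a : p.support, ∑' b : p.support, pairWeight p a b) *
      ENNReal.ofReal (1 / θ ^ L * (Real.exp (-(1 / (8 * v) - lam) * Δ) + κ ^ m)) := by
  refine (condEntropy_le p t v hv m).trans ?_
  rw [mul_assoc]
  refine mul_le_mul_right ?_ _
  simp_rw [← ENNReal.tsum_mul_right]
  refine ENNReal.tsum_le_tsum fun a => ENNReal.tsum_le_tsum fun b => ?_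
  split_ifs with hab
  · exact zero_le
  refine mul_le_mul_right ?_ _
  have h := exp_energy_mul_bhatt_le p t v hv ht hlam hθ0 hθ1 hκ0 hκ1 hcontr hΔ m 0 0
    (Function.update 0 0 (a : ℝ)) (Function.update 0 0 (b : ℝ)) (Nat.zero_le _)
    (by simpa [Subtype.ext_iff] using hab) (by simpa [Subtype.ext_iff] using hab)
    (fun j hj => by
      obtain rfl : j = 0 := by omega
      simp only [Function.update_self]
      exact ⟨a.2, b.2⟩) (fun j _ _ => by omega)
  refine le_trans ?_ (h.trans (le_of_eq (by rw [pow_zero])))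
  -- The first output has exponent 1/(8v), of which only the share w is needed.
  refine mul_le_mul_left (ENNReal.ofReal_le_ofReal (Real.exp_le_exp.2 ?_)) _
  have h1 : energy t (0 + 1 + 0)
      (Function.update (0 : ℕ → ℝ) 0 (a : ℝ) - Function.update (0 : ℕ → ℝ) 0 (b : ℝ))
      = (t 0 * a - t 0 * b) ^ 2 := by
    rw [add_zero, energy_update_succ, convAt_zero_update, convAt_zero_update]
    simp [energy]
  rw [h1, neg_div, ← one_div_mul_eq_div]
  nlinarith [mul_nonneg hlam0 (sq_nonneg (t 0 * a - t 0 * b))]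

end ErrorEvents

/-! ### From the window problem to the achievable rate -/

section SequentialDecoding

variable (p : PMF ℝ) {L : ℕ} (h : Fin L → ℝ) (N₀ : ℝ)

/-- A stationary sequential soft decoder of finite memory and delay, which estimates the input at
time `0` from the past inputs and from the outputs, bounds the achievable rate from below. -/
theorem integral_log_le_achievableRate (hentropy : Summable (entropyTerm p)) (r : ℕ)
    (ψ : (ℤ → ℝ) × (ℤ → ℝ) → ℝ≥0∞) (hm : Measurable ψ)
    (hloc : ∀ x x' y y', (∀ i : ℤ, -r ≤ i → i ≤ r → x i = x' i) →
      (∀ i : ℤ, -r ≤ i → i ≤ r → y i = y' i) → ψ (x, y) = ψ (x', y'))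
    (hpast : ∀ x y, ∀ i > 0, ∀ v, ψ (Function.update x i v, y) = ψ (x, y))
    (hone : ∀ x y, ∫⁻ v, ψ (Function.update x 0 v, y) ∂p.toMeasure ≤ 1)
    (h0 : ∀ z, ψ z ≠ 0)
    (hint : Integrable (fun ω => Real.log (ψ (ω.1, fun i => output h i ω)).toReal)
      (channelLaw p N₀)) :
    ∫ ω, Real.log (ψ (ω.1, fun i => output h i ω)).toReal ∂(channelLaw p N₀)
      ≤ achievableRate p h N₀ := by
  set c := ∫ ω, Real.log (ψ (ω.1, fun i => output h i ω)).toReal ∂(channelLaw p N₀) with hc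
  have hbound : ∀ᶠ N : ℕ in atTop, (2 * (N - r : ℝ) + 1) / (2 * N + 1) * c ≤ blockRate p h N₀ N := by
    filter_upwards [eventually_ge_atTop r] with N hN
    set s : Finset ℤ := Finset.Icc (-(N : ℤ)) N with hs
    -- Recentres the window at time k and pads with zeros. For k in `T`, at distance at least r from
    -- both ends, the decoder never sees the padding; the 2r lost positions vanish in the rate.
    let ext : (s → ℝ) → ℤ → ℤ → ℝ := fun x k i => if hi : i + k ∈ s then x ⟨i + k, hi⟩ else 0
    have hextm : ∀ k, Measurable fun x => ext x k := by
      intro k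
      refine measurable_pi_lambda _ fun i => ?_
      simp only [ext]
      split_ifs <;> fun_prop
    have hextu : ∀ (x : s → ℝ) (k : s) (j : s) (v : ℝ),
        ext (Function.update x j v) k = Function.update (ext x k) (j - k) v := by
      intro x k j v
      funext i
      by_cases hi : i = (j : ℤ) - k
      · have h1 : i + (k : ℤ) = j := by omega
        have h2 : i + (k : ℤ) ∈ s := h1 ▸ j.2
        have h3 : (⟨i + k, h2⟩ : s) = j := Subtype.ext h1
        subst hi
        simp only [ext, h2, dif_pos, h3, Function.update_self]
      · rw [Function.update_of_ne hi]
        simp only [ext]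
        split_ifs with h2
        · rw [Function.update_of_ne]
          intro h3
          exact hi (by rw [← h3]; simp)
        · rfl
    let Ψ : s → (s → ℝ) × (s → ℝ) → ℝ≥0∞ := fun k z => ψ (ext z.1 k, ext z.2 k)
    let T : Finset s := Finset.univ.filter fun k : s => -(N : ℤ) + r ≤ k ∧ (k : ℤ) ≤ N - r
    have hΨ : ∀ k ∈ T, ∀ ω, Ψ k (windowIn s ω, windowOut h s ω)
        = ψ ((shift k ω).1, fun i => output h i (shift k ω)) := by
      intro k hk ω
      have hk' : -(N : ℤ) + r ≤ k ∧ (k : ℤ) ≤ N - r := by simpa [T] using hk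
      have hmem : ∀ i : ℤ, -r ≤ i → i ≤ r → i + k ∈ s := fun i h1 h2 =>
        Finset.mem_Icc.2 ⟨by omega, by omega⟩
      refine hloc _ _ _ _ (fun i h1 h2 => ?_) (fun i h1 h2 => ?_)
      · simp only [ext, hmem i h1 h2, dif_pos]
        rfl
      · simp only [ext, hmem i h1 h2, dif_pos, output_shift]
        rfl
    have hmp : ∀ k, MeasurePreserving (shift k) (channelLaw p N₀) (channelLaw p N₀) := fun k =>
      ⟨measurable_shift k, map_shift_channelLaw p N₀ k⟩
    have hval : ∀ k ∈ T, ∫ ω, Real.log (Ψ k (windowIn s ω, windowOut h s ω)).toReal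
        ∂(channelLaw p N₀) = c := by
      intro k hk
      simp_rw [hΨ k hk]
      rw [hc]
      conv_rhs => rw [← (hmp k).map_eq]
      rw [integral_map (hmp k).measurable.aemeasurable]
      rw [(hmp k).map_eq]
      exact hint.aestronglyMeasurable
    have key := sum_integral_log_le_windowInfo p h N₀ hentropy s T Ψ
      (fun k _ => hm.comp (((hextm k).comp measurable_fst).prodMk
        ((hextm k).comp measurable_snd)))
      (fun k _ i hi x v y => by
        simp only [Ψ, hextu]
        have : (k : ℤ) < i := hi
        exact hpast _ _ _ (by omega) _)
      (fun k _ x y => by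
        simp only [Ψ, hextu, sub_self]
        exact hone _ _)
      (fun k _ z => h0 _)
      (fun k hk => by
        simp_rw [hΨ k hk]
        exact (hmp k).integrable_comp_of_integrable hint)
    rw [Finset.sum_congr rfl hval, Finset.sum_const, nsmul_eq_mul] at key
    have hcard : (T.card : ℝ) = 2 * (N - r : ℝ) + 1 := by
      have h1 : T.map ⟨Subtype.val, Subtype.val_injective⟩
          = Finset.Icc (-(N : ℤ) + r) (N - r) := by
        ext i
        simp only [T, hs, Finset.mem_map, Finset.mem_filter, Finset.mem_univ, true_and,
          Function.Embedding.coeFn_mk, Subtype.exists, Finset.mem_Icc]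
        constructor
        · rintro ⟨a, _, h2, rfl⟩
          exact h2
        · intro h2
          exact ⟨i, ⟨by omega, by omega⟩, h2, rfl⟩
      have h2 : T.card = 2 * (N - r) + 1 := by
        rw [← Finset.card_map ⟨Subtype.val, Subtype.val_injective⟩, h1, Int.card_Icc]
        omega
      rw [h2]
      push_cast [hN]
      ring
    rw [hcard] at key
    rw [blockRate, blockInfo_eq_windowInfo, div_mul_eq_mul_div]
    gcongr
  have hlim : Tendsto (fun N : ℕ => (2 * (N - r : ℝ) + 1) / (2 * N + 1) * c) atTop (𝓝 c) := by
    have h1 : Tendsto (fun N : ℕ => 1 - 2 * (r : ℝ) * ((2 * N + 1 : ℕ) : ℝ)⁻¹) atTop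
        (𝓝 (1 - 2 * (r : ℝ) * 0)) := by
      refine tendsto_const_nhds.sub (Tendsto.const_mul _ ?_)
      exact tendsto_inv_atTop_nhds_zero_nat.comp
        (tendsto_atTop_mono (fun n => by dsimp only [id]; omega) tendsto_id)
    have h2 := h1.mul_const c
    rw [mul_zero, sub_zero, one_mul] at h2
    refine h2.congr fun N => ?_
    congr 1
    have : (2 * N + 1 : ℝ) ≠ 0 := by positivity
    push_cast
    field_simp
    ring
  exact le_of_tendsto_of_tendsto hlim (tendsto_blockRate p h N₀ hentropy) hbound

theorem achievableRate_nonneg (hentropy : Summable (entropyTerm p)) :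
    0 ≤ achievableRate p h N₀ :=
  ge_of_tendsto' (tendsto_blockRate p h N₀ hentropy) fun N => by
    unfold blockRate
    positivity

theorem output_eq_sum_taps {j₀ : ℕ} (hj₀ : ∀ i : Fin L, (i : ℕ) < j₀ → h i = 0) (j : ℕ)
    (ω : (ℤ → ℝ) × (ℤ → ℝ)) :
    output h ((j₀ : ℤ) + j) ω
      = ∑ i ∈ Finset.range L, tap h ((j₀ + i : ℕ) : ℤ) * ω.1 ((j : ℤ) - i) + ω.2 ((j₀ : ℤ) + j) := by
  rw [output]
  congr 1
  have htap : ∀ i : Fin L, tap h ((i : ℕ) : ℤ) = h i := fun i => by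
    unfold tap
    rw [dif_pos ⟨by omega, by have := i.2; omega⟩]
    congr 1
  have h1 : ∑ i : Fin L, h i * ω.1 ((j₀ : ℤ) + j - i)
      = ∑ i ∈ Finset.range L, tap h (i : ℤ) * ω.1 ((j₀ : ℤ) + j - i) := by
    rw [← Fin.sum_univ_eq_sum_range (fun i => tap h (i : ℤ) * ω.1 ((j₀ : ℤ) + j - i))]
    simp [htap]
  have h0 : ∀ i, i < j₀ → tap h (i : ℤ) = 0 := by
    intro i hi
    by_cases hiL : i < L
    · rw [← hj₀ ⟨i, hiL⟩ hi]; exact htap ⟨i, hiL⟩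
    · unfold tap; rw [dif_neg]; omega
  have hL : ∀ i, L ≤ i → tap h (i : ℤ) = 0 := by
    intro i hi
    unfold tap; rw [dif_neg]; omega
  rw [h1]
  have h2 : ∑ i ∈ Finset.range L, tap h (i : ℤ) * ω.1 ((j₀ : ℤ) + j - i)
      = ∑ i ∈ Finset.range (j₀ + L), tap h (i : ℤ) * ω.1 ((j₀ : ℤ) + j - i) := by
    refine Finset.sum_subset (Finset.range_subset_range.2 (by omega)) fun i _ hi => ?_
    rw [hL i (by simpa using hi), zero_mul]
  rw [h2, Finset.sum_range_add, Finset.sum_eq_zero, zero_add]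
  · refine Finset.sum_congr rfl fun i _ => ?_
    congr 2
    push_cast
    ring_nf
  · intro i hi
    rw [h0 i (Finset.mem_range.1 hi), zero_mul]

theorem measurable_comp_windowObs (t : ℕ → ℝ) {m : ℕ} {G : ℝ → (Fin (m + 1) → ℝ) → ℝ≥0∞}
    (hG : Measurable (Function.uncurry G)) :
    Measurable fun q : (Fin (m + 1) → ℝ) × (Fin (m + 1) → ℝ) =>
      G (q.1 0) (windowObs t 0 0 q.1 q.2) := by
  have hu0 : Measurable fun q : (Fin (m + 1) → ℝ) × (Fin (m + 1) → ℝ) => q.1 0 := by fun_prop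
  have hW := measurable_windowObs t 0 0 (m := m + 1)
  exact hG.comp (hu0.prodMk hW)

/-- The logarithm of the likelihood ratio is the self-information of the letter minus −log of its
posterior. The latter is nonnegative, since a posterior is at most 1, and its integral is the
conditional entropy. -/
theorem integrable_log_decoder (hentropy : Summable (entropyTerm p)) (t : ℕ → ℝ) (v : NNReal)
    (hv : v ≠ 0) (m : ℕ) (hfin : condEntropy p t v m ≠ ∞) :
    Integrable (fun q : (Fin (m + 1) → ℝ) × (Fin (m + 1) → ℝ) =>
        Real.log (decoder p t v m (q.1 0) (windowObs t 0 0 q.1 q.2)).toReal)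
      ((Measure.pi fun _ => p.toMeasure).prod (Measure.pi fun _ => gaussianReal 0 v)) ∧
    ∫ q : (Fin (m + 1) → ℝ) × (Fin (m + 1) → ℝ),
        Real.log (decoder p t v m (q.1 0) (windowObs t 0 0 q.1 q.2)).toReal
      ∂((Measure.pi fun _ => p.toMeasure).prod (Measure.pi fun _ => gaussianReal 0 v))
      = inputEntropy p - (condEntropy p t v m).toReal := by
  set μ := (Measure.pi fun _ : Fin (m + 1) => p.toMeasure).prod
    (Measure.pi fun _ : Fin (m + 1) => gaussianReal 0 v) with hμ
  have hpm : Measurable fun a : ℝ => p a := by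
    refine (measurable_const (a := (0 : ℝ≥0∞))).measurable_of_countable_ne
      (p.support_countable.mono fun a ha => ?_)
    exact (p.mem_support_iff a).2 (Ne.symm ha)
  have hu0 : Measurable fun q : (Fin (m + 1) → ℝ) × (Fin (m + 1) → ℝ) => q.1 0 := by fun_prop
  have hdm : Measurable fun q : (Fin (m + 1) → ℝ) × (Fin (m + 1) → ℝ) =>
      decoder p t v m (q.1 0) (windowObs t 0 0 q.1 q.2) :=
    measurable_comp_windowObs t (G := decoder p t v m) (measurable_decoder p t v m)
  have hmp : MeasurePreserving (fun q : (Fin (m + 1) → ℝ) × (Fin (m + 1) → ℝ) => q.1 0) μ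
      p.toMeasure := by
    have h1 : MeasurePreserving Prod.fst μ (Measure.pi fun _ : Fin (m + 1) => p.toMeasure) :=
      measurePreserving_fst
    exact (measurePreserving_eval (fun _ : Fin (m + 1) => p.toMeasure) 0).comp h1
  have hself : Integrable (fun q : (Fin (m + 1) → ℝ) × (Fin (m + 1) → ℝ) => selfInfo p (q.1 0)) μ :=
    hmp.integrable_comp_of_integrable (integrable_selfInfo p hentropy)
  have hselfv : ∫ q : (Fin (m + 1) → ℝ) × (Fin (m + 1) → ℝ), selfInfo p (q.1 0) ∂μ
      = inputEntropy p := by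
    rw [inputEntropy_eq p hentropy]
    conv_rhs => rw [← hmp.map_eq]
    rw [integral_map hu0.aemeasurable (measurable_selfInfo p).aestronglyMeasurable]
  set f : (Fin (m + 1) → ℝ) × (Fin (m + 1) → ℝ) → ℝ := fun q =>
    -Real.log (p (q.1 0) * decoder p t v m (q.1 0) (windowObs t 0 0 q.1 q.2)).toReal with hf
  have hfm : Measurable f :=
    (Real.measurable_log.comp ((hpm.comp hu0).mul hdm).ennreal_toReal).neg
  have hle : ∀ a ∈ p.support, ∀ z, p a * decoder p t v m a z ≤ 1 := fun a ha z => by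
    rw [← tsum_decoder p t v hv m z]
    exact ENNReal.le_tsum (f := fun a : p.support => p a * decoder p t v m a z) ⟨a, ha⟩
  have hmem : ∀ᵐ q ∂μ, q.1 0 ∈ p.support := hmp.quasiMeasurePreserving.ae (ae_mem_support p)
  have hf0 : 0 ≤ᵐ[μ] f := by
    filter_upwards [hmem] with q hq
    refine neg_nonneg.2 (Real.log_nonpos ENNReal.toReal_nonneg ?_)
    exact ENNReal.toReal_le_of_le_ofReal zero_le_one (by simpa using hle _ hq _)
  have hfl : ∫⁻ q, ENNReal.ofReal (f q) ∂μ = condEntropy p t v m :=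
    lintegral_prod _ hfm.ennreal_ofReal.aemeasurable
  have hfi : Integrable f μ := by
    refine ⟨hfm.aestronglyMeasurable, ?_⟩
    rw [hasFiniteIntegral_iff_ofReal hf0, hfl]
    exact hfin.lt_top
  have hfv : ∫ q, f q ∂μ = (condEntropy p t v m).toReal := by
    rw [integral_eq_lintegral_of_nonneg_ae hf0 hfm.aestronglyMeasurable, hfl]
  have heq : (fun q : (Fin (m + 1) → ℝ) × (Fin (m + 1) → ℝ) =>
      selfInfo p (q.1 0) - f q) =ᵐ[μ] fun q =>
      Real.log (decoder p t v m (q.1 0) (windowObs t 0 0 q.1 q.2)).toReal := by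
    filter_upwards [hmem] with q hq
    have h1 : (p (q.1 0)).toReal ≠ 0 :=
      (ENNReal.toReal_pos ((p.mem_support_iff _).1 hq) (p.apply_ne_top _)).ne'
    have h2 : (decoder p t v m (q.1 0) (windowObs t 0 0 q.1 q.2)).toReal ≠ 0 :=
      (ENNReal.toReal_pos (decoder_ne_zero p t v hv _ _ _) (decoder_ne_top p t v hv _ _ _)).ne'
    simp only [hf, selfInfo, ENNReal.toReal_mul]
    rw [Real.log_mul h1 h2]
    ring
  refine ⟨(integrable_congr heq).1 (hself.sub hfi), ?_⟩
  rw [← integral_congr_ae heq, integral_sub hself hfi, hselfv, hfv]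

/-- Decision feedback: the past letters are known, so their contribution can be subtracted from the
outputs. What is left is the window problem with empty history, for the filter without its j₀
leading zero taps. -/
theorem inputEntropy_sub_condEntropy_le (hentropy : Summable (entropyTerm p)) (hN : 0 < N₀)
    {j₀ : ℕ} (hj₀ : ∀ i : Fin L, (i : ℕ) < j₀ → h i = 0) (m : ℕ)
    (hfin : condEntropy p (fun i => tap h ((j₀ + i : ℕ) : ℤ)) N₀.toNNReal m ≠ ∞) :
    inputEntropy p - (condEntropy p (fun i => tap h ((j₀ + i : ℕ) : ℤ)) N₀.toNNReal m).toReal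
      ≤ achievableRate p h N₀ := by
  set t : ℕ → ℝ := fun i => tap h ((j₀ + i : ℕ) : ℤ) with ht
  have hv : N₀.toNNReal ≠ 0 := (Real.toNNReal_pos.2 hN).ne'
  obtain ⟨hi, hval⟩ := integrable_log_decoder p hentropy t N₀.toNNReal hv m hfin
  obtain ⟨D, hD⟩ : ∃ D, D = decoder p t N₀.toNNReal m := ⟨_, rfl⟩
  have hDm : Measurable (Function.uncurry D) := hD ▸ measurable_decoder p t N₀.toNNReal m
  have hD1 : ∀ z, ∫⁻ a, D a z ∂p.toMeasure ≤ 1 := fun z =>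
    hD ▸ (lintegral_decoder p t N₀.toNNReal hv m z).le
  have hD0 : ∀ a z, D a z ≠ 0 := fun a z => hD ▸ decoder_ne_zero p t N₀.toNNReal hv m a z
  rw [← hD] at hi hval
  clear hD
  -- The subtracted terms have i > j and hence involve only inputs at negative times j − i.
  let Z : (ℤ → ℝ) × (ℤ → ℝ) → Fin (m + 1) → ℝ := fun z j =>
    z.2 ((j₀ : ℤ) + (j : ℕ)) - ∑ i ∈ Finset.range L,
      if (j : ℕ) < i then t i * z.1 (((j : ℕ) : ℤ) - i) else 0
  have hZm : Measurable Z := by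
    refine measurable_pi_lambda _ fun j => ?_
    refine Measurable.sub (by fun_prop) (Finset.measurable_fun_sum _ fun i _ => ?_)
    split_ifs <;> fun_prop
  have hZu : ∀ x y, ∀ i ≥ 0, ∀ a, Z (Function.update x i a, y) = Z (x, y) := by
    intro x y i hi a
    funext j
    simp only [Z]
    congr 1
    refine Finset.sum_congr rfl fun k _ => ?_
    split_ifs with hk
    · rw [Function.update_of_ne (by omega)]
    · rfl
  have hpos : ∀ ω : (ℤ → ℝ) × (ℤ → ℝ), Z (ω.1, fun i => output h i ω)
      = windowObs t 0 0 (fun i : Fin (m + 1) => ω.1 ((i : ℕ) : ℤ))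
        (fun i => ω.2 ((j₀ : ℤ) + (i : ℕ))) := by
    intro ω
    funext j
    simp only [Z, windowObs, output_eq_sum_taps h hj₀, zero_add]
    rw [add_sub_right_comm]
    congr 1
    rw [← Finset.sum_sub_distrib, convAt,
      ← Finset.sum_range_reflect (fun i => t ((j : ℕ) - i) * glue 0 0 _ i)]
    have h1 : ∀ i ∈ Finset.range ((j : ℕ) + 1), t ((j : ℕ) - ((j : ℕ) + 1 - 1 - i)) *
        glue 0 0 (fun i : Fin (m + 1) => ω.1 ((i : ℕ) : ℤ)) ((j : ℕ) + 1 - 1 - i)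
        = t i * ω.1 (((j : ℕ) : ℤ) - i) := by
      intro i hi
      have hi' := Finset.mem_range.1 hi
      have hj := j.2
      have e1 : (j : ℕ) - ((j : ℕ) + 1 - 1 - i) = i := by omega
      rw [e1, glue, if_neg (by omega), dif_pos (by omega)]
      congr 1
      refine congrArg ω.1 ?_
      dsimp only
      omega
    rw [Finset.sum_congr rfl h1]
    have h2 : ∀ i ∈ Finset.range L, (tap h ((j₀ + i : ℕ) : ℤ) * ω.1 (((j : ℕ) : ℤ) - i)
        - if (j : ℕ) < i then t i * ω.1 (((j : ℕ) : ℤ) - i) else 0)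
        = if i < (j : ℕ) + 1 then t i * ω.1 (((j : ℕ) : ℤ) - i) else 0 := by
      intro i _
      by_cases hij : (j : ℕ) < i
      · rw [if_pos hij, if_neg (by omega), sub_self]
      · rw [if_neg hij, if_pos (by omega), sub_zero]
    rw [Finset.sum_congr rfl h2, ← Finset.sum_filter]
    refine Finset.sum_subset (fun i hi => ?_) (fun i hi hi' => ?_)
    · exact Finset.mem_range.2 (Finset.mem_filter.1 hi).2
    · have : L ≤ i := by
        by_contra hlt
        exact hi' (Finset.mem_filter.2 ⟨Finset.mem_range.2 (by omega), Finset.mem_range.1 hi⟩)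
      have : t i = 0 := by
        simp only [ht]
        unfold tap
        rw [dif_neg]
        push_cast
        omega
      rw [this, zero_mul]
  have hlaw : MeasurePreserving (fun ω : (ℤ → ℝ) × (ℤ → ℝ) =>
      ((fun i : Fin (m + 1) => ω.1 ((i : ℕ) : ℤ)),
        (fun i : Fin (m + 1) => ω.2 ((j₀ : ℤ) + (i : ℕ))))) (channelLaw p N₀)
      ((Measure.pi fun _ => p.toMeasure).prod (Measure.pi fun _ => gaussianReal 0 N₀.toNNReal)) := by
    refine ⟨by fun_prop, ?_⟩
    rw [map_coords_channelLaw p N₀ (f := fun i : Fin (m + 1) => ((i : ℕ) : ℤ))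
      (g := fun i : Fin (m + 1) => (j₀ : ℤ) + (i : ℕ))
      (fun i j hij => by ext; simpa using hij) (fun i j hij => by ext; simpa using hij),
      Measure.infinitePi_eq_pi, Measure.infinitePi_eq_pi]
    rfl
  let ψ : (ℤ → ℝ) × (ℤ → ℝ) → ℝ≥0∞ := fun z => D (z.1 0) (Z z)
  have hψ : ∀ ω : (ℤ → ℝ) × (ℤ → ℝ), Real.log (ψ (ω.1, fun i => output h i ω)).toReal
      = (fun q : (Fin (m + 1) → ℝ) × (Fin (m + 1) → ℝ) =>
        Real.log (D (q.1 0) (windowObs t 0 0 q.1 q.2)).toReal)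
        ((fun i : Fin (m + 1) => ω.1 ((i : ℕ) : ℤ)),
        (fun i : Fin (m + 1) => ω.2 ((j₀ : ℤ) + (i : ℕ)))) := by
    intro ω
    simp only [ψ, hpos]
    rfl
  -- The reach covers outputs up to time j₀ + m and inputs back to time 1 − L.
  have key := integral_log_le_achievableRate p h N₀ hentropy (L + j₀ + m + 1) ψ
    (hDm.comp
      (((measurable_pi_apply 0).comp measurable_fst).prodMk hZm))
    (fun x x' y y' hx hy => by
      simp only [ψ]
      congr 1
      · exact hx 0 (by omega) (by omega)
      · funext j
        have hj := j.2
        simp only [Z]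
        congr 1
        · exact hy _ (by omega) (by omega)
        · refine Finset.sum_congr rfl fun i hi => ?_
          have hi' := Finset.mem_range.1 hi
          split_ifs
          · rw [hx _ (by omega) (by omega)]
          · rfl)
    (fun x y i hi a => by
      simp only [ψ]
      rw [hZu x y i hi.le a, Function.update_of_ne (by omega)])
    (fun x y => by
      simp only [ψ, Function.update_self]
      simp_rw [hZu x y 0 le_rfl]
      exact hD1 _)
    (fun z => hD0 _ _)
    (by simp_rw [hψ]; exact hlaw.integrable_comp_of_integrable hi)
  have hchange := integral_map hlaw.measurable.aemeasurable
    (f := fun q : (Fin (m + 1) → ℝ) × (Fin (m + 1) → ℝ) =>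
      Real.log (D (q.1 0) (windowObs t 0 0 q.1 q.2)).toReal)
    (by rw [hlaw.map_eq]; exact hi.aestronglyMeasurable)
  rw [hlaw.map_eq, hval] at hchange
  rw [hchange]
  refine le_trans (le_of_eq (integral_congr_ae (Eventually.of_forall fun ω => ?_))) key
  exact (hψ ω).symm

end SequentialDecoding

/-! ### Minimum distance and convergence of the achievable rate -/

section Rate

variable {L : ℕ} (h : Fin L → ℝ)

theorem tap_coe (i : Fin L) : tap h ((i : ℕ) : ℤ) = h i := by
  unfold tap
  rw [dif_pos ⟨by omega, by have := i.2; omega⟩]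
  congr 1

theorem tap_of_neg {k : ℤ} (hk : k < 0) : tap h k = 0 := by
  unfold tap
  rw [dif_neg (by omega)]

theorem tap_of_le {k : ℤ} (hk : (L : ℤ) ≤ k) : tap h k = 0 := by
  unfold tap
  rw [dif_neg (by omega)]

theorem exists_first_tap (hh : h ≠ 0) :
    ∃ j₀ : Fin L, h j₀ ≠ 0 ∧ ∀ i : Fin L, (i : ℕ) < j₀ → h i = 0 := by
  obtain ⟨i, hi⟩ := Function.ne_iff.1 hh
  obtain ⟨j, hj, hmin⟩ := WellFounded.has_min (wellFounded_lt (α := Fin L)) {i | h i ≠ 0} ⟨i, hi⟩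
  exact ⟨j, hj, fun i hij => not_not.1 fun hne => hmin i hne hij⟩

theorem tap_eq_zero_of_lt {j₀ : ℕ} (hj₀ : ∀ i : Fin L, (i : ℕ) < j₀ → h i = 0) {k : ℤ}
    (hk : k < j₀) : tap h k = 0 := by
  unfold tap
  split_ifs with hk'
  · exact hj₀ _ (by dsimp only; omega)
  · rfl

theorem minDist_pos {p : PMF ℝ} (hdist : IsLeast (inputDistances p) (minDist p)) : 0 < minDist p := by
  obtain ⟨a, -, b, -, hab, h⟩ := hdist.1
  rw [h]
  exact abs_pos.2 (sub_ne_zero.2 hab)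

theorem minDist_le {p : PMF ℝ} (hdist : IsLeast (inputDistances p) (minDist p)) {a b : ℝ} (ha : a ∈ p.support) (hb : b ∈ p.support) (hab : a ≠ b) :
    minDist p ≤ |a - b| :=
  hdist.2 ⟨a, ha, b, hb, hab, rfl⟩

theorem inputPower_pos {p : PMF ℝ} (hdist : IsLeast (inputDistances p) (minDist p))
    (hpower : Integrable (fun a : ℝ => a ^ 2) p.toMeasure) :
    0 < inputPower p := by
  refine lt_of_le_of_ne (integral_nonneg fun a => sq_nonneg a) fun h0 => ?_
  have h1 := (integral_eq_zero_iff_of_nonneg (fun a => sq_nonneg a) hpower).1 h0.symm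
  have h2 : ∀ a ∈ p.support, a = 0 := by
    intro a ha
    by_contra hne
    have h3 : p.toMeasure {a} ≤ p.toMeasure {x | ¬ x ^ 2 = (0 : ℝ → ℝ) x} :=
      measure_mono fun x hx => by
        rw [Set.mem_singleton_iff.1 hx]
        exact pow_ne_zero 2 hne
    rw [p.toMeasure_apply_singleton _ (measurableSet_singleton _), ae_iff.1 h1] at h3
    exact (p.mem_support_iff a).1 ha (le_antisymm h3 zero_le)
  obtain ⟨a, ha, b, hb, hab, -⟩ := hdist.1
  exact hab ((h2 a ha).trans (h2 b hb).symm)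

/-- The power cancels: the normalised exponent is the Gaussian one for the actual letter distance.
-/
theorem inputPower_mul_normMinDist_sq {p : PMF ℝ} (hdist : IsLeast (inputDistances p) (minDist p))
    (hpower : Integrable (fun a : ℝ => a ^ 2) p.toMeasure)
    (N₀ : ℝ) : inputPower p / (2 * N₀) * (normMinDist p / 2) ^ 2
      = 1 / (8 * N₀) * minDist p ^ 2 := by
  have hP := inputPower_pos hdist hpower
  rw [normMinDist, div_pow, div_pow, Real.sq_sqrt hP.le]
  by_cases hN : N₀ = 0
  · simp [hN]
  field_simp
  norm_num [mul_comm]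

theorem nonempty_deltaMinSq_set {p : PMF ℝ} (hdist : IsLeast (inputDistances p) (minDist p)) :
     {v | ∃ (M : ℕ) (x x' : Fin (M + 1) → ℝ),
    (∀ l, x l ∈ p.support) ∧ (∀ l, x' l ∈ p.support) ∧
    x 0 ≠ x' 0 ∧ x (Fin.last M) ≠ x' (Fin.last M) ∧ v = wordDist h (minDist p) x x'}.Nonempty := by
  obtain ⟨a, ha, b, hb, hab, -⟩ := hdist.1
  exact ⟨_, 0, fun _ => a, fun _ => b, fun _ => ha, fun _ => hb, hab, hab, rfl⟩

theorem wordDist_nonneg {N : ℕ} (d : ℝ) (x x' : Fin N → ℝ) : 0 ≤ wordDist h d x x' :=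
  Finset.sum_nonneg fun _ _ => sq_nonneg _

theorem deltaMinSq_nonneg (p : PMF ℝ) : 0 ≤ deltaMinSq p h := by
  refine Real.sInf_nonneg ?_
  rintro _ ⟨M, x, x', -, -, -, -, rfl⟩
  exact wordDist_nonneg h _ x x'

theorem deltaMinSq_le {p : PMF ℝ} {M : ℕ} {x x' : Fin (M + 1) → ℝ} (hx : ∀ l, x l ∈ p.support)
    (hx' : ∀ l, x' l ∈ p.support) (h0 : x 0 ≠ x' 0) (hl : x (Fin.last M) ≠ x' (Fin.last M)) :
    deltaMinSq p h ≤ wordDist h (minDist p) x x' := by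
  refine csInf_le ⟨0, ?_⟩ ⟨M, x, x', hx, hx', h0, hl, rfl⟩
  rintro _ ⟨M, x, x', -, -, -, -, rfl⟩
  exact wordDist_nonneg h _ x x'

/-- Cut at time l, the sequences are two admissible words. Later letters agree and contribute
nothing, and the first j₀ outputs of the unshifted channel vanish, so the word distance times d² is
part of the energy. -/
theorem deltaMinSq_mul_le_energy {p : PMF ℝ} (hdist : IsLeast (inputDistances p) (minDist p))
    {j₀ : ℕ} (hj₀ : ∀ i : Fin L, (i : ℕ) < j₀ → h i = 0)
    (l : ℕ) (x y : ℕ → ℝ) (h0 : x 0 ≠ y 0) (hl : x l ≠ y l)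
    (hsupp : ∀ j ≤ l, x j ∈ p.support ∧ y j ∈ p.support)
    (heq : ∀ j, l < j → j < l + 1 + L → x j = y j) :
    minDist p ^ 2 * deltaMinSq p h
      ≤ energy (fun i => tap h ((j₀ + i : ℕ) : ℤ)) (l + 1 + L) (x - y) := by
  have hd := minDist_pos hdist
  set d := minDist p
  have h1 := deltaMinSq_le h (x := fun i : Fin (l + 1) => x i) (x' := fun i : Fin (l + 1) => y i)
    (fun i => (hsupp i (by have := i.2; omega)).1) (fun i => (hsupp i (by have := i.2; omega)).2)
    (by simpa using h0) (by simpa using hl)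
  refine (mul_le_mul_of_nonneg_left h1 (sq_nonneg d)).trans ?_
  have hterm : ∀ k : ℕ, d ^ 2 * |∑ i : Fin (l + 1), ((x i - y i) / d) *
      tap h ((k : ℤ) - ((i : ℕ) : ℤ))| ^ 2
      = (∑ i ∈ Finset.range (l + 1), (x i - y i) * tap h ((k : ℤ) - (i : ℤ))) ^ 2 := by
    intro k
    rw [sq_abs, ← mul_pow, Finset.mul_sum,
      ← Fin.sum_univ_eq_sum_range (fun i => (x i - y i) * tap h ((k : ℤ) - (i : ℤ)))]
    congr 1
    refine Finset.sum_congr rfl fun i _ => ?_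
    field_simp
  have hlow : ∀ k : ℕ, k < j₀ →
      (∑ i ∈ Finset.range (l + 1), (x i - y i) * tap h ((k : ℤ) - (i : ℤ))) ^ 2 = 0 := by
    intro k hk
    rw [Finset.sum_eq_zero, zero_pow two_ne_zero]
    intro i _
    rw [tap_eq_zero_of_lt h hj₀ (by omega), mul_zero]
  have hhigh : ∀ k : ℕ, k < l + 1 + L →
      ∑ i ∈ Finset.range (l + 1), (x i - y i) * tap h (((j₀ + k : ℕ) : ℤ) - (i : ℤ))
        = convAt (fun i => tap h ((j₀ + i : ℕ) : ℤ)) k (x - y) := by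
    intro k hk
    have e1 : ∑ i ∈ Finset.range (l + 1), (x i - y i) * tap h (((j₀ + k : ℕ) : ℤ) - (i : ℤ))
        = ∑ i ∈ Finset.range (l + 1 + k), (x i - y i) * tap h (((j₀ + k : ℕ) : ℤ) - (i : ℤ)) := by
      refine Finset.sum_subset (Finset.range_subset_range.2 (by omega)) fun i hi hi' => ?_
      rw [Finset.mem_range] at hi hi'
      by_cases hik : i ≤ k
      · rw [heq i (by omega) (by omega), sub_self, zero_mul]
      · rw [tap_eq_zero_of_lt h hj₀ (by push_cast; omega), mul_zero]
    rw [e1, convAt]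
    symm
    have e2 : ∀ i ∈ Finset.range (k + 1), tap h ((j₀ + (k - i) : ℕ) : ℤ) * (x - y) i
        = (x i - y i) * tap h (((j₀ + k : ℕ) : ℤ) - (i : ℤ)) := by
      intro i hi
      have := Finset.mem_range.1 hi
      rw [mul_comm, Pi.sub_apply]
      congr 2
      omega
    rw [Finset.sum_congr rfl e2]
    refine Finset.sum_subset (Finset.range_subset_range.2 (by omega)) fun i hi hi' => ?_
    rw [Finset.mem_range] at hi hi'
    rw [tap_eq_zero_of_lt h hj₀ (by push_cast; omega), mul_zero]
  rw [wordDist, Finset.mul_sum, energy]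
  calc _ = ∑ k ∈ Finset.range (L + (l + 1) - 1),
        (∑ i ∈ Finset.range (l + 1), (x i - y i) * tap h ((k : ℤ) - (i : ℤ))) ^ 2 :=
        Finset.sum_congr rfl fun k _ => hterm k
    _ ≤ ∑ k ∈ Finset.range (j₀ + (l + 1 + L)),
        (∑ i ∈ Finset.range (l + 1), (x i - y i) * tap h ((k : ℤ) - (i : ℤ))) ^ 2 :=
        Finset.sum_le_sum_of_subset_of_nonneg (Finset.range_subset_range.2 (by omega))
          fun _ _ _ => sq_nonneg _
    _ = _ := by
        rw [Finset.sum_range_add, Finset.sum_eq_zero fun k hk => hlow k (Finset.mem_range.1 hk),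
          zero_add]
        exact Finset.sum_congr rfl fun k hk => by rw [hhigh k (Finset.mem_range.1 hk)]

/-- The achievable rate converges to the input entropy exponentially fast in the SNR. -/
theorem exists_inputEntropy_sub_achievableRate_le (p : PMF ℝ)
    (hentropy : Summable (entropyTerm p))
    (hpower : Integrable (fun a : ℝ => a ^ 2) p.toMeasure)
    (hdist : IsLeast (inputDistances p) (minDist p)) (hh : h ≠ 0) :
    ∃ C : ℝ, 0 < C ∧ ∀ N₀ : ℝ, 0 < N₀ →
      inputEntropy p - achievableRate p h N₀
        ≤ C * Real.exp (-(1 / (8 * N₀)) * (minDist p ^ 2 * deltaMinSq p h)) := by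
  obtain ⟨j₀, hj₀, hlow⟩ := exists_first_tap h hh
  set t : ℕ → ℝ := fun i => tap h (((j₀ : ℕ) + i : ℕ) : ℤ) with ht
  have ht0 : t 0 ≠ 0 := by
    simp only [ht, add_zero]
    rwa [tap_coe]
  have htL : ∀ i, L ≤ i → t i = 0 := fun i hi => tap_of_le h (by push_cast; omega)
  have hS := tsum_rpow_half_ne_top p hpower (minDist_pos hdist)
    fun a ha b hb hab => minDist_le hdist ha hb hab
  obtain ⟨lam, θ, κ, hlam, hθ0, hθ1, hκ0, hκ1, hcontr⟩ := exists_contraction p hS ht0 L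
  set S : ℝ≥0∞ := ∑' a : p.support, ∑' b : p.support, pairWeight p a b
  have hSfin : S ≠ ∞ := by
    have := tsum_pairWeight p hS
    rwa [ENNReal.tsum_prod (f := fun a b : p.support => pairWeight p a b)] at this
  set Δ := minDist p ^ 2 * deltaMinSq p h with hΔ
  have hΔ0 : 0 ≤ Δ := mul_nonneg (sq_nonneg _) (deltaMinSq_nonneg h p)
  have hH := inputEntropy_nonneg p hentropy
  set K : ℝ := 2 * S.toReal * (1 / θ ^ L)
  have hK : 0 ≤ K := by positivity
  -- The factor exp(lam·Δ) repays the share of the exponent spent on the contraction. The entropy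
  -- term serves for large noise, lam > 1/(8N₀), where the exponential is at least 1 and the rate is
  -- nonnegative.
  refine ⟨(K + inputEntropy p + 1) * Real.exp (lam * Δ), by positivity, fun N₀ hN => ?_⟩
  rw [mul_assoc, ← Real.exp_add]
  by_cases hc : lam ≤ 1 / (8 * N₀)
  · have hv : N₀.toNNReal ≠ 0 := (Real.toNNReal_pos.2 hN).ne'
    have hvN : (N₀.toNNReal : ℝ) = N₀ := Real.coe_toNNReal _ hN.le
    have hm : ∀ m : ℕ, inputEntropy p - achievableRate p h N₀
        ≤ K * (Real.exp (-(1 / (8 * N₀) - lam) * Δ) + κ ^ m) := by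
      intro m
      have h1 := condEntropy_le_exp p t N₀.toNNReal hv htL hlam.le (by rwa [hvN]) hθ0 hθ1 hκ0 hκ1
        hcontr (deltaMinSq_mul_le_energy h hdist hlow) m
      rw [hvN] at h1
      have hfin : 2 * S * ENNReal.ofReal (1 / θ ^ L *
          (Real.exp (-(1 / (8 * N₀) - lam) * Δ) + κ ^ m)) ≠ ∞ :=
        ENNReal.mul_ne_top (ENNReal.mul_ne_top (by simp) hSfin) ENNReal.ofReal_ne_top
      have h2 := inputEntropy_sub_condEntropy_le p h N₀ hentropy hN hlow m
        (ne_top_of_le_ne_top hfin h1)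
      have h3 := ENNReal.toReal_mono hfin h1
      rw [ENNReal.toReal_mul, ENNReal.toReal_mul, ENNReal.toReal_ofReal (by positivity),
        ← mul_assoc] at h3
      have h4 : (2 : ℝ≥0∞).toReal = 2 := rfl
      rw [h4] at h3
      linarith
    -- With unboundedly many outputs the contribution κ^m of unfinished events disappears.
    have hlim : Tendsto (fun m : ℕ => K * (Real.exp (-(1 / (8 * N₀) - lam) * Δ) + κ ^ m)) atTop
        (𝓝 (K * (Real.exp (-(1 / (8 * N₀) - lam) * Δ) + 0))) :=
      ((tendsto_pow_atTop_nhds_zero_of_lt_one hκ0.le hκ1).const_add _).const_mul _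
    refine (ge_of_tendsto' hlim hm).trans ?_
    rw [add_zero]
    have e1 : -(1 / (8 * N₀) - lam) * Δ = lam * Δ + -(1 / (8 * N₀)) * Δ := by ring
    rw [e1]
    gcongr
    linarith
  · have h1 := achievableRate_nonneg p h N₀ hentropy
    have h2 : 1 ≤ Real.exp (lam * Δ + -(1 / (8 * N₀)) * Δ) := by
      rw [Real.one_le_exp_iff]
      nlinarith [not_le.1 hc]
    nlinarith

end Rate

/-! ### Root reflection and the Mahler measure -/

section Reflection

open Polynomial

/-- The squared `ℓ²`-norm of the coefficients of a polynomial. -/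
def coeffNormSq (P : ℂ[X]) : ℝ := P.sum fun _ a => ‖a‖ ^ 2

theorem coeffNormSq_eq (P : ℂ[X]) {n : ℕ} (hn : P.natDegree < n) :
    coeffNormSq P = ∑ i ∈ Finset.range n, ‖P.coeff i‖ ^ 2 :=
  P.sum_over_range' (fun _ => by simp) n hn

/-- The sum telescopes: |u − aw|² − |w − āu|² = (1 − |a|²)(|u|² − |w|²) for consecutive coefficients
u, w of Q. -/
theorem sum_norm_coeff_sub_reflect (a : ℂ) (Q : ℂ[X]) (n : ℕ) :
    ∑ i ∈ Finset.range (n + 1), (‖((X - C a) * Q).coeff i‖ ^ 2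
      - ‖((1 - C (starRingEnd ℂ a) * X) * Q).coeff i‖ ^ 2) = -((1 - ‖a‖ ^ 2) * ‖Q.coeff n‖ ^ 2) := by
  have key : ∀ u w : ℂ, ‖u - a * w‖ ^ 2 - ‖w - starRingEnd ℂ a * u‖ ^ 2
      = (1 - ‖a‖ ^ 2) * (‖u‖ ^ 2 - ‖w‖ ^ 2) := by
    intro u w
    simp only [← Complex.normSq_eq_norm_sq, Complex.normSq_apply]
    simp
    ring
  induction n with
  | zero =>
    simp [sub_mul, mul_assoc]
    ring
  | succ n ih =>
    rw [Finset.sum_range_succ, ih]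
    have h1 : ((X - C a) * Q).coeff (n + 1) = Q.coeff n - a * Q.coeff (n + 1) := by
      simp [sub_mul]
    have h2 : ((1 - C (starRingEnd ℂ a) * X) * Q).coeff (n + 1)
        = Q.coeff (n + 1) - starRingEnd ℂ a * Q.coeff n := by
      simp [sub_mul, mul_assoc]
    rw [h1, h2, key]
    ring

/-- Past the degree of Q the boundary term is zero. This is the coefficient form of |z − a| = |1 −
āz| on the unit circle. -/
theorem coeffNormSq_reflect (a : ℂ) (Q : ℂ[X]) :
    coeffNormSq ((X - C a) * Q) = coeffNormSq ((1 - C (starRingEnd ℂ a) * X) * Q) := by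
  have hd1 : ((X - C a) * Q).natDegree < Q.natDegree + 1 + 1 := by
    refine Nat.lt_succ_of_le (natDegree_mul_le.trans ?_)
    rw [natDegree_X_sub_C, add_comm]
  have hd2 : ((1 - C (starRingEnd ℂ a) * X) * Q).natDegree < Q.natDegree + 1 + 1 := by
    refine Nat.lt_succ_of_le (natDegree_mul_le.trans ?_)
    rw [add_comm]
    refine Nat.add_le_add_left ((natDegree_sub_le _ _).trans ?_) _
    simpa using natDegree_C_mul_le (starRingEnd ℂ a) X
  rw [coeffNormSq_eq _ hd1, coeffNormSq_eq _ hd2, ← sub_eq_zero, ← Finset.sum_sub_distrib,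
    sum_norm_coeff_sub_reflect, coeff_eq_zero_of_natDegree_lt (Nat.lt_succ_self _)]
  simp

/-- The monic factor of a root, reflected in the unit circle if the root lies inside. -/
def reflectedFactor (a : ℂ) : ℂ[X] :=
  if 1 < ‖a‖ then X - C a else 1 - C (starRingEnd ℂ a) * X

theorem norm_reflectedFactor_eval_zero (a : ℂ) : ‖(reflectedFactor a).eval 0‖ = max 1 ‖a‖ := by
  unfold reflectedFactor
  split_ifs with h
  · simp [h.le]
  · simp [not_lt.1 h]

theorem reflectedFactor_ne_zero (a : ℂ) : reflectedFactor a ≠ 0 := by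
  intro h
  have := norm_reflectedFactor_eval_zero a
  rw [h, eval_zero, norm_zero] at this
  linarith [le_max_left 1 ‖a‖]

theorem one_le_natDegree_reflectedFactor {a : ℂ} (ha : a ≠ 0) :
    1 ≤ (reflectedFactor a).natDegree := by
  unfold reflectedFactor
  split_ifs with h
  · rw [natDegree_X_sub_C]
  · have h1 : (1 - C (starRingEnd ℂ a) * X).coeff 1 ≠ 0 := by
      simpa [coeff_one] using ha
    exact le_natDegree_of_ne_zero h1

theorem coeffNormSq_prod_reflect (s : Multiset ℂ) (Q : ℂ[X]) :
    coeffNormSq ((s.map fun a => X - C a).prod * Q)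
      = coeffNormSq ((s.map reflectedFactor).prod * Q) := by
  induction s using Multiset.induction_on generalizing Q with
  | empty => rfl
  | cons a s ih =>
    rw [Multiset.map_cons, Multiset.prod_cons, Multiset.map_cons, Multiset.prod_cons, mul_comm (X - C a),
      mul_assoc, ih, ← mul_assoc, mul_comm _ (X - C a), mul_assoc]
    unfold reflectedFactor
    split_ifs
    · rw [mul_assoc]
    · rw [coeffNormSq_reflect, mul_assoc]

/-- The polynomial obtained by reflecting the roots inside the unit circle. -/
def reflected (P : ℂ[X]) : ℂ[X] := C P.leadingCoeff * (P.roots.map reflectedFactor).prod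

theorem coeffNormSq_reflected_mul (P Q : ℂ[X]) :
    coeffNormSq (P * Q) = coeffNormSq (reflected P * Q) := by
  have h := (IsAlgClosed.splits P).eq_prod_roots
  conv_lhs => rw [h]
  rw [mul_comm (C P.leadingCoeff), mul_assoc, coeffNormSq_prod_reflect, reflected]
  congr 1
  ring

theorem prod_reflectedFactor_ne_zero (s : Multiset ℂ) : (s.map reflectedFactor).prod ≠ 0 := by
  refine Multiset.prod_ne_zero fun h => ?_
  obtain ⟨a, -, ha⟩ := Multiset.mem_map.1 h
  exact reflectedFactor_ne_zero a ha

theorem reflected_ne_zero {P : ℂ[X]} (hP : P ≠ 0) : reflected P ≠ 0 :=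
  mul_ne_zero (by simpa using hP) (prod_reflectedFactor_ne_zero _)

/-- Each factor contributes max(1, |a|) at 0, which is the product formula for the Mahler measure.
-/
theorem norm_reflected_eval_zero (P : ℂ[X]) : ‖(reflected P).eval 0‖ = P.mahlerMeasure := by
  rw [mahlerMeasure_eq_leadingCoeff_mul_prod_roots, reflected, eval_mul, eval_C, norm_mul]
  congr 1
  induction P.roots using Multiset.induction_on with
  | empty => simp
  | cons a s ih =>
    rw [Multiset.map_cons, Multiset.prod_cons, Multiset.map_cons, Multiset.prod_cons, eval_mul,
      norm_mul, ih, norm_reflectedFactor_eval_zero]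

theorem one_le_natDegree_reflected {P : ℂ[X]} (hP : P ≠ 0) {a : ℂ} (ha : a ∈ P.roots)
    (ha0 : a ≠ 0) : 1 ≤ (reflected P).natDegree := by
  obtain ⟨s, hs⟩ := Multiset.exists_cons_of_mem ha
  rw [reflected, hs, Multiset.map_cons, Multiset.prod_cons, natDegree_C_mul (by simpa using hP),
    natDegree_mul (reflectedFactor_ne_zero a) (prod_reflectedFactor_ne_zero s)]
  exact (one_le_natDegree_reflectedFactor ha0).trans (Nat.le_add_right _ _)

/-- After reflection the constant coefficient of the product alone is large enough. -/
theorem sq_le_coeffNormSq_mul (P Q : ℂ[X]) (hQ : 1 ≤ ‖Q.coeff 0‖) :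
    P.mahlerMeasure ^ 2 ≤ coeffNormSq (P * Q) := by
  rw [coeffNormSq_reflected_mul, coeffNormSq_eq _ (Nat.lt_succ_self _),
    ← norm_reflected_eval_zero]
  refine le_trans ?_ (Finset.single_le_sum (f := fun i => ‖(reflected P * Q).coeff i‖ ^ 2)
    (fun i _ => sq_nonneg _) (Finset.mem_range.2 (Nat.succ_pos _)))
  simp only [mul_coeff_zero, norm_mul, ← coeff_zero_eq_eval_zero]
  gcongr
  exact le_mul_of_one_le_right (norm_nonneg _) hQ

/-- A nonzero root makes the reflected polynomial nonconstant, so the leading coefficient of the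
product is distinct from the constant one and counts in addition. -/
theorem sq_add_sq_le_coeffNormSq_mul {P : ℂ[X]} (hP : P ≠ 0) {a : ℂ} (ha : a ∈ P.roots)
    (ha0 : a ≠ 0) (Q : ℂ[X]) (hQ : 1 ≤ ‖Q.coeff 0‖) (hQl : 1 ≤ ‖Q.leadingCoeff‖) :
    P.mahlerMeasure ^ 2 + ‖(reflected P).leadingCoeff‖ ^ 2 ≤ coeffNormSq (P * Q) := by
  have hQ0 : Q ≠ 0 := by rintro rfl; norm_num at hQ
  have hdeg : 1 ≤ (reflected P * Q).natDegree := by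
    rw [natDegree_mul (reflected_ne_zero hP) hQ0]
    exact (one_le_natDegree_reflected hP ha ha0).trans (Nat.le_add_right _ _)
  rw [coeffNormSq_reflected_mul, coeffNormSq_eq _ (Nat.lt_succ_self _),
    ← norm_reflected_eval_zero, Finset.sum_range_succ]
  refine add_le_add ?_ ?_
  · refine le_trans ?_ (Finset.single_le_sum (f := fun i => ‖(reflected P * Q).coeff i‖ ^ 2)
      (fun i _ => sq_nonneg _) (Finset.mem_range.2 hdeg))
    simp only [mul_coeff_zero, norm_mul, ← coeff_zero_eq_eval_zero]
    gcongr
    exact le_mul_of_one_le_right (norm_nonneg _) hQ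
  · change _ ≤ ‖(reflected P * Q).leadingCoeff‖ ^ 2
    rw [leadingCoeff_mul, norm_mul]
    gcongr
    exact le_mul_of_one_le_right (norm_nonneg _) hQl

end Reflection

/-! ### The zero-forcing gain against the minimum distance -/

section Gain

open Polynomial

variable {L : ℕ} (h : Fin L → ℝ)

/-- The polynomial with the given real coefficients. -/
def toPoly {N : ℕ} (e : Fin N → ℝ) : ℂ[X] := ∑ k : Fin N, C (e k : ℂ) * X ^ (k : ℕ)

theorem coeff_toPoly (n : ℕ) : (toPoly h).coeff n = (tap h n : ℂ) := by
  simp only [toPoly, finsetSum_coeff, coeff_C_mul, coeff_X_pow]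
  by_cases hn : n < L
  · rw [Finset.sum_eq_single ⟨n, hn⟩]
    · rw [if_pos rfl, mul_one, ← tap_coe h ⟨n, hn⟩]
    · intro k _ hk
      have : n ≠ (k : ℕ) := fun h' => hk (Fin.ext h'.symm)
      simp [this]
    · simp
  · rw [tap_of_le h (by omega)]
    refine Finset.sum_eq_zero fun k _ => ?_
    have : n ≠ (k : ℕ) := by have := k.2; omega
    simp [this]

theorem coeff_toPoly_fin (i : Fin L) : (toPoly h).coeff (i : ℕ) = (h i : ℂ) := by
  rw [coeff_toPoly, tap_coe]

theorem toPoly_ne_zero (hh : h ≠ 0) : toPoly h ≠ 0 := by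
  obtain ⟨i, hi⟩ := Function.ne_iff.1 hh
  intro h0
  have := coeff_toPoly h (i : ℕ)
  rw [h0, coeff_zero, tap_coe] at this
  exact hi (by exact_mod_cast this.symm)

theorem natDegree_toPoly_lt (hL : 0 < L) : (toPoly h).natDegree < L := by
  refine Nat.lt_of_le_pred hL (natDegree_le_iff_coeff_eq_zero.2 fun m hm => ?_)
  rw [coeff_toPoly, tap_of_le h (by rw [Nat.pred_eq_sub_one] at hm; omega), Complex.ofReal_zero]

theorem wordDist_eq_coeffNormSq (hL : 0 < L) {N : ℕ} (hN : 0 < N) (d : ℝ) (x x' : Fin N → ℝ) :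
    wordDist h d x x' = coeffNormSq (toPoly h * toPoly fun l => (x l - x' l) / d) := by
  have hdeg : (toPoly h * toPoly fun l => (x l - x' l) / d).natDegree < L + N - 1 := by
    have h1 := natDegree_toPoly_lt h hL
    have h2 := natDegree_toPoly_lt (fun l => (x l - x' l) / d) hN
    have h3 := natDegree_mul_le (p := toPoly h) (q := toPoly fun l => (x l - x' l) / d)
    omega
  rw [coeffNormSq_eq _ hdeg, wordDist]
  refine Finset.sum_congr rfl fun k _ => ?_
  have hc : (toPoly h * toPoly fun l => (x l - x' l) / d).coeff k
      = ((∑ l : Fin N, ((x l - x' l) / d) * tap h ((k : ℤ) - (l : ℤ)) : ℝ) : ℂ) := by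
    conv_lhs => rw [toPoly.eq_def fun l => (x l - x' l) / d]
    rw [Finset.mul_sum, finsetSum_coeff]
    push_cast
    refine Finset.sum_congr rfl fun l _ => ?_
    rw [mul_left_comm, coeff_C_mul, coeff_mul_X_pow']
    congr 1
    split_ifs with hl
    · rw [coeff_toPoly, Nat.cast_sub hl]
    · rw [tap_of_neg h (by omega), Complex.ofReal_zero]
  rw [hc, Complex.norm_real, Real.norm_eq_abs]

theorem transfer_eq_eval (θ : ℝ) : transfer h θ = (toPoly h).eval (circleMap 0 1 (-θ)) := by
  simp only [transfer, toPoly, eval_finsetSum, eval_mul, eval_C, eval_pow, eval_X]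
  refine Finset.sum_congr rfl fun k _ => ?_
  rw [circleMap_zero, Complex.ofReal_one, one_mul, ← Complex.exp_nat_mul]
  congr 2
  push_cast
  ring

/-- The transfer function is the polynomial at exp(−iθ); reversing θ and using periodicity moves the
integral to the standard interval. -/
theorem integral_transfer_eq {f : ℂ → ℝ} :
    ∫ θ in (-Real.pi)..Real.pi, f (transfer h θ)
      = ∫ θ in (0)..(2 * Real.pi), f ((toPoly h).eval (circleMap 0 1 θ)) := by
  simp_rw [transfer_eq_eval]
  rw [intervalIntegral.integral_comp_neg fun θ => f ((toPoly h).eval (circleMap 0 1 θ)), neg_neg]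
  have hper : Function.Periodic (fun θ => f ((toPoly h).eval (circleMap 0 1 θ))) (2 * Real.pi) := by
    intro θ
    simp only [periodic_circleMap 0 1 θ]
  have := hper.intervalIntegral_add_eq (-Real.pi) 0
  rw [zero_add] at this
  rw [← this]
  congr 1
  ring

theorem gZFDFE_eq (hh : h ≠ 0) : gZFDFE h = (toPoly h).mahlerMeasure ^ 2 := by
  rw [gZFDFE, mahlerMeasure_def_of_ne_zero (toPoly_ne_zero h hh), ← Real.exp_nat_mul,
    integral_transfer_eq h (f := fun z => Real.log (‖z‖ ^ 2))]
  simp only [Real.log_pow]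
  rw [intervalIntegral.integral_const_mul]
  congr 1
  push_cast
  ring

theorem one_le_norm_letter {p : PMF ℝ} (hdist : IsLeast (inputDistances p) (minDist p)) {a b : ℝ}
    (ha : a ∈ p.support) (hb : b ∈ p.support) (hab : a ≠ b) :
    1 ≤ ‖(((a - b) / minDist p : ℝ) : ℂ)‖ := by
  have hd := minDist_pos hdist
  rw [Complex.norm_real, Real.norm_eq_abs, abs_div, abs_of_pos hd, le_div_iff₀ hd, one_mul]
  exact minDist_le hdist ha hb hab

theorem pos_of_ne_zero (hh : h ≠ 0) : 0 < L := by
  obtain ⟨i, -⟩ := Function.ne_iff.1 hh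
  exact i.pos

theorem gZFDFE_le_deltaMinSq {p : PMF ℝ} (hdist : IsLeast (inputDistances p) (minDist p))
    (hh : h ≠ 0) : gZFDFE h ≤ deltaMinSq p h := by
  refine le_csInf (nonempty_deltaMinSq_set h hdist) ?_
  rintro _ ⟨M, x, x', hx, hx', h0, -, rfl⟩
  rw [wordDist_eq_coeffNormSq h (pos_of_ne_zero h hh) (Nat.succ_pos M), gZFDFE_eq h hh]
  refine sq_le_coeffNormSq_mul _ _ ?_
  rw [← Fin.val_zero (M + 1), coeff_toPoly_fin]
  exact one_le_norm_letter hdist (hx 0) (hx' 0) h0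

/-- The gap |lc|², with lc the leading coefficient of the reflected channel polynomial, depends only
on the channel. It therefore survives the infimum over words of all lengths. -/
theorem gZFDFE_lt_deltaMinSq {p : PMF ℝ} (hdist : IsLeast (inputDistances p) (minDist p))
    (hh : h ≠ 0) {a : ℂ} (ha : a ∈ (toPoly h).roots) (ha0 : a ≠ 0) :
    gZFDFE h < deltaMinSq p h := by
  have hP := toPoly_ne_zero h hh
  have hgap : 0 < ‖(reflected (toPoly h)).leadingCoeff‖ ^ 2 := by
    have := leadingCoeff_ne_zero.2 (reflected_ne_zero hP)
    positivity
  refine (lt_add_of_pos_right _ hgap).trans_le ?_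
  refine le_csInf (nonempty_deltaMinSq_set h hdist) ?_
  rintro _ ⟨M, x, x', hx, hx', h0, hl, rfl⟩
  rw [wordDist_eq_coeffNormSq h (pos_of_ne_zero h hh) (Nat.succ_pos M), gZFDFE_eq h hh]
  have hlast : 1 ≤ ‖(toPoly fun l => (x l - x' l) / minDist p).coeff M‖ := by
    have h1 := coeff_toPoly_fin (fun l => (x l - x' l) / minDist p) (Fin.last M)
    rw [Fin.val_last] at h1
    rw [h1]
    exact one_le_norm_letter hdist (hx _) (hx' _) hl
  have hdeg : (toPoly fun l => (x l - x' l) / minDist p).natDegree = M := by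
    refine le_antisymm (Nat.lt_succ_iff.1 (natDegree_toPoly_lt _ (Nat.succ_pos M))) ?_
    refine le_natDegree_of_ne_zero fun h0 => ?_
    rw [h0, norm_zero] at hlast
    linarith
  refine sq_add_sq_le_coeffNormSq_mul hP ha ha0 _ ?_ ?_
  · rw [← Fin.val_zero (M + 1), coeff_toPoly_fin]
    exact one_le_norm_letter hdist (hx 0) (hx' 0) h0
  · rw [leadingCoeff, hdeg]
    exact hlast

/-- A channel whose transfer polynomial has no nonzero root has a single tap. -/
theorem exists_eq_single (hh : h ≠ 0) (hroots : ∀ a ∈ (toPoly h).roots, a = 0) :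
    ∃ (j : Fin L) (c : ℝ), c ≠ 0 ∧ h = Pi.single j c := by
  have hP := (IsAlgClosed.splits (toPoly h)).eq_prod_roots
  have hr : (toPoly h).roots = Multiset.replicate (Multiset.card (toPoly h).roots) 0 :=
    Multiset.eq_replicate_card.2 hroots
  rw [hr] at hP
  simp only [Multiset.map_replicate, Multiset.prod_replicate, C_0, sub_zero] at hP
  set n := Multiset.card (toPoly h).roots
  have hcoeff : ∀ k : Fin L, (k : ℕ) ≠ n → h k = 0 := by
    intro k hk
    have h1 := coeff_toPoly h k
    rw [hP, coeff_C_mul, coeff_X_pow, if_neg hk, mul_zero, tap_coe] at h1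
    exact_mod_cast h1.symm
  obtain ⟨j, hj⟩ := Function.ne_iff.1 hh
  have hjn : (j : ℕ) = n := by
    by_contra hne
    exact hj (hcoeff j hne)
  refine ⟨j, h j, hj, ?_⟩
  funext k
  by_cases hkj : k = j
  · subst hkj; simp
  · rw [Pi.single_eq_of_ne hkj]
    exact hcoeff k fun hk => hkj (Fin.ext (hk.trans hjn.symm))

theorem norm_transfer_single (j : Fin L) (c θ : ℝ) : ‖transfer (Pi.single j c) θ‖ = |c| := by
  rw [transfer, Finset.sum_eq_single j]
  · rw [Pi.single_eq_same, norm_mul, Complex.norm_real, Real.norm_eq_abs]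
    have : -(Complex.I * ((j : ℕ) : ℂ) * (θ : ℂ)) = ((-((j : ℕ) * θ) : ℝ) : ℂ) * Complex.I := by
      push_cast
      ring
    rw [this, Complex.norm_exp_ofReal_mul_I, mul_one]
  · intro k _ hk
    simp [Pi.single_eq_of_ne hk]
  · simp

end Gain

/-! ### The scalar Gaussian channel -/

section ScalarChannel

variable (p : PMF ℝ) (α : ℝ) (v : NNReal)

/-- The density of the output of the scalar Gaussian channel with gain `α`. -/
def scalarDensity (y : ℝ) : ℝ≥0∞ := ∑' a : p.support, p a * gaussianPDF (α * a) v y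

/-- The likelihood ratio of the input `a` given the output `y` of the scalar channel. -/
def scalarRatio (a y : ℝ) : ℝ≥0∞ := gaussianPDF (α * a) v y / scalarDensity p α v y

theorem measurable_scalarDensity : Measurable (scalarDensity p α v) := by
  unfold scalarDensity
  exact Measurable.tsum fun a => (measurable_gaussianPDF _ v).const_mul _

theorem measurable_scalarRatio : Measurable (Function.uncurry (scalarRatio p α v)) := by
  unfold scalarRatio Function.uncurry
  exact (measurable_gaussianPDF_comp (by fun_prop) (by fun_prop) v).div
    ((measurable_scalarDensity p α v).comp measurable_snd)

theorem measurable_scalarRatio_right (a : ℝ) : Measurable fun y => scalarRatio p α v a y := by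
  unfold scalarRatio
  exact (measurable_gaussianPDF _ v).div (measurable_scalarDensity p α v)

theorem scalarDensity_ne_zero (hv : v ≠ 0) (y : ℝ) : scalarDensity p α v y ≠ 0 := by
  obtain ⟨a, ha⟩ := p.support_nonempty
  intro h
  exact mul_ne_zero ((p.mem_support_iff a).1 ha) (gaussianPDF_pos _ hv _).ne'
    (ENNReal.tsum_eq_zero.1 h ⟨a, ha⟩)

theorem scalarDensity_le {y : ℝ} {c : ℝ≥0∞} (hc : ∀ a ∈ p.support, gaussianPDF (α * a) v y ≤ c) :
    scalarDensity p α v y ≤ c := by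
  calc _ ≤ ∑' a : p.support, p a * c := ENNReal.tsum_le_tsum fun a => by
        gcongr
        exact hc a a.2
    _ = c := by rw [ENNReal.tsum_mul_right, tsum_support, one_mul]

theorem scalarDensity_ne_top (y : ℝ) : scalarDensity p α v y ≠ ∞ :=
  ne_top_of_le_ne_top ENNReal.ofReal_ne_top (scalarDensity_le p α v fun _ _ => gaussianPDF_le _ v y)

theorem scalarRatio_ne_zero (hv : v ≠ 0) (a y : ℝ) : scalarRatio p α v a y ≠ 0 :=
  ENNReal.div_ne_zero.2 ⟨(gaussianPDF_pos _ hv _).ne', scalarDensity_ne_top p α v y⟩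

theorem scalarRatio_ne_top (hv : v ≠ 0) (a y : ℝ) : scalarRatio p α v a y ≠ ∞ :=
  ENNReal.div_ne_top gaussianPDF_ne_top (scalarDensity_ne_zero p α v hv y)

theorem tsum_scalarRatio (hv : v ≠ 0) (y : ℝ) :
    ∑' a : p.support, p a * scalarRatio p α v a y = 1 := by
  unfold scalarRatio
  simp_rw [← mul_div_assoc, div_eq_mul_inv]
  rw [ENNReal.tsum_mul_right]
  exact ENNReal.mul_inv_cancel (scalarDensity_ne_zero p α v hv y) (scalarDensity_ne_top p α v y)

theorem scalarDensity_mul_scalarRatio (hv : v ≠ 0) (a y : ℝ) :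
    scalarDensity p α v y * scalarRatio p α v a y = gaussianPDF (α * a) v y :=
  ENNReal.mul_div_cancel (scalarDensity_ne_zero p α v hv y) (scalarDensity_ne_top p α v y)

theorem lintegral_scalarChannel (hv : v ≠ 0) {G : ℝ × ℝ → ℝ≥0∞} (hG : Measurable G) :
    ∫⁻ q : ℝ × ℝ, G (q.1, α * q.1 + q.2) ∂(p.toMeasure.prod (gaussianReal 0 v))
      = ∑' a : p.support, p a * ∫⁻ y, gaussianPDF (α * a) v y * G (a, y) := by
  have hG' : Measurable fun q : ℝ × ℝ => G (q.1, α * q.1 + q.2) := hG.comp (by fun_prop)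
  rw [lintegral_prod _ hG'.aemeasurable, lintegral_toMeasure]
  refine tsum_congr fun a => ?_
  rw [lintegral_noise_add v hv (α * a) (f := fun y => G (a, y)) (hG.comp measurable_prodMk_left)]

theorem map_scalarOutput (hv : v ≠ 0) :
    (p.toMeasure.prod (gaussianReal 0 v)).map (fun q : ℝ × ℝ => α * q.1 + q.2)
      = volume.withDensity (scalarDensity p α v) := by
  ext S hS
  rw [← lintegral_indicator_one hS, lintegral_map (measurable_one.indicator hS) (by fun_prop),
    withDensity_apply _ hS, ← lintegral_indicator hS,
    lintegral_scalarChannel p α v hv (G := fun z => S.indicator 1 z.2)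
      ((measurable_one.indicator hS).comp measurable_snd)]
  have : ∀ y, S.indicator (scalarDensity p α v) y
      = ∑' a : p.support, p a * (gaussianPDF (α * a) v y * S.indicator 1 y) := by
    intro y
    by_cases hy : y ∈ S <;> simp [hy, scalarDensity]
  simp_rw [this]
  have hm : ∀ a : p.support, Measurable fun y =>
      p a * (gaussianPDF (α * a) v y * S.indicator (1 : ℝ → ℝ≥0∞) y) := fun a =>
    ((measurable_gaussianPDF _ v).mul (measurable_one.indicator hS)).const_mul _
  rw [lintegral_tsum fun a => (hm a).aemeasurable]
  refine tsum_congr fun a => ?_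
  rw [lintegral_const_mul' _ _ (p.apply_ne_top _)]

/-- Exhibits the likelihood ratio as the density of the joint law, so the mutual information becomes
the integral of its logarithm. -/
theorem map_scalarChannel (hv : v ≠ 0) :
    (p.toMeasure.prod (gaussianReal 0 v)).map (fun q : ℝ × ℝ => (q.1, α * q.1 + q.2))
      = (p.toMeasure.prod ((p.toMeasure.prod (gaussianReal 0 v)).map
          fun q : ℝ × ℝ => α * q.1 + q.2)).withDensity (Function.uncurry (scalarRatio p α v)) := by
  have hr := measurable_scalarRatio p α v
  have hf := measurable_scalarDensity p α v
  have : SFinite ((p.toMeasure.prod (gaussianReal 0 v)).map fun q : ℝ × ℝ => α * q.1 + q.2) :=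
    inferInstance
  ext S hS
  have hind : Measurable (S.indicator (1 : ℝ × ℝ → ℝ≥0∞)) := measurable_one.indicator hS
  rw [← lintegral_indicator_one hS, lintegral_map hind (by fun_prop),
    withDensity_apply _ hS, ← lintegral_indicator hS,
    lintegral_scalarChannel p α v hv hind, lintegral_prod _ (hr.indicator hS).aemeasurable,
    lintegral_toMeasure]
  refine tsum_congr fun a => ?_
  congr 1
  have hm : Measurable fun y => S.indicator (Function.uncurry (scalarRatio p α v)) ((a : ℝ), y) :=
    (hr.indicator hS).comp measurable_prodMk_left
  rw [map_scalarOutput p α v hv, lintegral_withDensity_eq_lintegral_mul _ hf hm]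
  refine lintegral_congr fun y => ?_
  rw [Pi.mul_apply, ← scalarDensity_mul_scalarRatio p α v hv, mul_assoc]
  congr 1
  by_cases hy : ((a : ℝ), y) ∈ S <;> simp [hy, Function.uncurry]

/-- The mutual information of input and output of the scalar channel with gain `α`. -/
def gainInfo : ℝ≥0∞ :=
  mutualInfo (p.toMeasure.prod (gaussianReal 0 v)) (fun q : ℝ × ℝ => q.1)
    (fun q : ℝ × ℝ => α * q.1 + q.2)

theorem gainInfo_ne_top (hentropy : Summable (entropyTerm p)) : gainInfo p α v ≠ ∞ := by
  have hfst : (p.toMeasure.prod (gaussianReal 0 v)).map (fun q : ℝ × ℝ => q.1) = p.toMeasure :=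
    measurePreserving_fst.map_eq
  refine (mutualInfo_le_entropy (I := selfInfo p) (S := p.support) measurable_fst (by fun_prop)
    p.support_countable ?_ (measurable_selfInfo p) (fun a _ => ?_) ?_).1
  · exact measurePreserving_fst.quasiMeasurePreserving.ae (ae_mem_support p)
  · rw [hfst, p.toMeasure_apply_singleton _ (measurableSet_singleton _)]
    rfl
  · rw [hfst]
    exact integrable_selfInfo p hentropy

theorem integrable_log_scalarRatio (hentropy : Summable (entropyTerm p)) (hv : v ≠ 0) :
    Integrable (fun q : ℝ × ℝ => Real.log (scalarRatio p α v q.1 (α * q.1 + q.2)).toReal)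
      (p.toMeasure.prod (gaussianReal 0 v)) ∧
    ∫ q : ℝ × ℝ, Real.log (scalarRatio p α v q.1 (α * q.1 + q.2)).toReal
      ∂(p.toMeasure.prod (gaussianReal 0 v)) = (gainInfo p α v).toReal := by
  have hfst : (p.toMeasure.prod (gaussianReal 0 v)).map (fun q : ℝ × ℝ => q.1) = p.toMeasure :=
    measurePreserving_fst.map_eq
  have hXY : Measurable fun q : ℝ × ℝ => (q.1, α * q.1 + q.2) := by fun_prop
  have hY : Measurable fun q : ℝ × ℝ => α * q.1 + q.2 := by fun_prop
  have hr := measurable_scalarRatio p α v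
  have hmap := map_scalarChannel p α v hv
  have hne := gainInfo_ne_top p α v hentropy
  unfold gainInfo mutualInfo at hne ⊢
  rw [hfst] at hne ⊢
  set J := (p.toMeasure.prod (gaussianReal 0 v)).map (fun q : ℝ × ℝ => (q.1, α * q.1 + q.2)) with hJ
  set ν := (p.toMeasure.prod (gaussianReal 0 v)).map fun q : ℝ × ℝ => α * q.1 + q.2
  have : IsProbabilityMeasure J := Measure.isProbabilityMeasure_map hXY.aemeasurable
  have : IsProbabilityMeasure ν := Measure.isProbabilityMeasure_map hY.aemeasurable
  obtain ⟨hac, hint⟩ := InformationTheory.klDiv_ne_top_iff.1 hne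
  have hrn : J.rnDeriv (p.toMeasure.prod ν) =ᵐ[J] Function.uncurry (scalarRatio p α v) := by
    have h := Measure.rnDeriv_withDensity (p.toMeasure.prod ν) hr
    rw [← hmap] at h
    exact hac.ae_le h
  have hllr : llr J (p.toMeasure.prod ν) =ᵐ[J]
      fun z => Real.log (scalarRatio p α v z.1 z.2).toReal := by
    filter_upwards [hrn] with z hz
    rw [llr, hz]
    rfl
  have hlm : Measurable fun z : ℝ × ℝ => Real.log (scalarRatio p α v z.1 z.2).toReal :=
    Real.measurable_log.comp hr.ennreal_toReal
  have hint' := (integrable_congr hllr).1 hint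
  rw [InformationTheory.toReal_klDiv_of_measure_eq hac (by simp), integral_congr_ae hllr, hJ,
    integral_map hXY.aemeasurable hlm.aestronglyMeasurable]
  exact ⟨(integrable_map_measure hlm.aestronglyMeasurable hXY.aemeasurable).1 hint', rfl⟩

/-- The equivocation of the scalar channel dominates any part of its error probability. -/
theorem lintegral_le_inputEntropy_sub_gainInfo (hentropy : Summable (entropyTerm p)) (hv : v ≠ 0)
    {a b : ℝ} (ha : a ∈ p.support) (hb : b ∈ p.support) (hab : a ≠ b) (W : Set ℝ)
    (hW : MeasurableSet W) :
    p a * p b * ∫⁻ y in W, gaussianPDF (α * a) v y * scalarRatio p α v b y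
      ≤ ENNReal.ofReal (inputEntropy p - (gainInfo p α v).toReal) := by
  classical
  set μ := p.toMeasure.prod (gaussianReal 0 v)
  have hr := measurable_scalarRatio p α v
  have hpm : Measurable fun a : ℝ => p a := by
    refine (measurable_const (a := (0 : ℝ≥0∞))).measurable_of_countable_ne
      (p.support_countable.mono fun a ha => ?_)
    exact (p.mem_support_iff a).2 (Ne.symm ha)
  obtain ⟨hint, hval⟩ := integrable_log_scalarRatio p α v hentropy hv
  have hmp : MeasurePreserving (fun q : ℝ × ℝ => q.1) μ p.toMeasure := measurePreserving_fst
  have hmem : ∀ᵐ q ∂μ, q.1 ∈ p.support := hmp.quasiMeasurePreserving.ae (ae_mem_support p)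
  have hself : Integrable (fun q : ℝ × ℝ => selfInfo p q.1) μ :=
    hmp.integrable_comp_of_integrable (integrable_selfInfo p hentropy)
  have hselfv : ∫ q : ℝ × ℝ, selfInfo p q.1 ∂μ = inputEntropy p := by
    rw [inputEntropy_eq p hentropy]
    conv_rhs => rw [← hmp.map_eq]
    rw [integral_map measurable_fst.aemeasurable (measurable_selfInfo p).aestronglyMeasurable]
  have hle : ∀ c ∈ p.support, ∀ y, p c * scalarRatio p α v c y ≤ 1 := fun c hc y => by
    rw [← tsum_scalarRatio p α v hv y]
    exact ENNReal.le_tsum (f := fun a : p.support => p a * scalarRatio p α v a y) ⟨c, hc⟩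
  set f : ℝ × ℝ → ℝ := fun q => selfInfo p q.1
    - Real.log (scalarRatio p α v q.1 (α * q.1 + q.2)).toReal with hf
  have hfi : Integrable f μ := hself.sub hint
  -- f is −log of the posterior t of the transmitted letter, and −log t ≥ 1 − t.
  have hfeq : ∀ᵐ q ∂μ, 0 ≤ f q ∧ 1 - (p q.1 * scalarRatio p α v q.1 (α * q.1 + q.2)).toReal ≤ f q := by
    filter_upwards [hmem] with q hq
    have h1 : 0 < (p q.1).toReal :=
      ENNReal.toReal_pos ((p.mem_support_iff _).1 hq) (p.apply_ne_top _)
    have h2 : 0 < (scalarRatio p α v q.1 (α * q.1 + q.2)).toReal :=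
      ENNReal.toReal_pos (scalarRatio_ne_zero p α v hv _ _) (scalarRatio_ne_top p α v hv _ _)
    have h3 : f q = -Real.log (p q.1 * scalarRatio p α v q.1 (α * q.1 + q.2)).toReal := by
      simp only [hf, selfInfo]
      rw [ENNReal.toReal_mul, Real.log_mul h1.ne' h2.ne']
      ring
    have h4 : (p q.1 * scalarRatio p α v q.1 (α * q.1 + q.2)).toReal ≤ 1 :=
      ENNReal.toReal_le_of_le_ofReal zero_le_one (by simpa using hle _ hq _)
    rw [h3]
    refine ⟨neg_nonneg.2 (Real.log_nonpos ENNReal.toReal_nonneg h4), ?_⟩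
    have h5 : 0 < (p q.1 * scalarRatio p α v q.1 (α * q.1 + q.2)).toReal := by
      rw [ENNReal.toReal_mul]
      exact mul_pos h1 h2
    linarith [Real.log_le_sub_one_of_pos h5]
  have hfv : inputEntropy p - (gainInfo p α v).toReal = ∫ q, f q ∂μ := by
    rw [hf, integral_sub hself hint, hselfv, hval]
  rw [hfv, ofReal_integral_eq_lintegral_ofReal hfi (hfeq.mono fun q hq => hq.1)]
  -- Keeps only the event that a is sent and the output falls in W. There 1 minus the posterior of a
  -- is at least the posterior of b.
  set G : ℝ × ℝ → ℝ≥0∞ := fun z => if z.1 = a ∧ z.2 ∈ W then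
    ENNReal.ofReal (1 - (p a * scalarRatio p α v a z.2).toReal) else 0 with hG
  have hra := measurable_scalarRatio_right p α v a
  have hGm : Measurable G := by
    refine Measurable.ite ?_ ?_ measurable_const
    · exact (measurable_fst (measurableSet_singleton a)).inter (measurable_snd hW)
    · exact (measurable_const.sub ((hra.comp measurable_snd).const_mul _).ennreal_toReal).ennreal_ofReal
  calc p a * p b * ∫⁻ y in W, gaussianPDF (α * a) v y * scalarRatio p α v b y
      = p a * ∫⁻ y in W, gaussianPDF (α * a) v y * (p b * scalarRatio p α v b y) := by
        rw [mul_assoc, ← lintegral_const_mul' _ _ (p.apply_ne_top _)]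
        simp_rw [mul_left_comm]
    _ ≤ p a * ∫⁻ y in W, gaussianPDF (α * a) v y *
          ENNReal.ofReal (1 - (p a * scalarRatio p α v a y).toReal) := by
        gcongr with y
        have h1 : p a * scalarRatio p α v a y + p b * scalarRatio p α v b y ≤ 1 := by
          rw [← tsum_scalarRatio p α v hv y]
          have hne : (⟨a, ha⟩ : p.support) ≠ ⟨b, hb⟩ := fun h => hab (congrArg Subtype.val h)
          have := ENNReal.sum_le_tsum (f := fun a : p.support => p a * scalarRatio p α v a y)
            {⟨a, ha⟩, ⟨b, hb⟩}
          rwa [Finset.sum_pair hne] at this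
        have h2 : p a * scalarRatio p α v a y ≠ ∞ := ne_top_of_le_ne_top ENNReal.one_ne_top (hle a ha y)
        have h3 : p b * scalarRatio p α v b y ≠ ∞ := ne_top_of_le_ne_top ENNReal.one_ne_top (hle b hb y)
        rw [← ENNReal.ofReal_toReal h3]
        refine ENNReal.ofReal_le_ofReal ?_
        have h4 := ENNReal.toReal_mono ENNReal.one_ne_top h1
        rw [ENNReal.toReal_add h2 h3, ENNReal.toReal_one] at h4
        linarith
    _ = ∫⁻ q : ℝ × ℝ, G (q.1, α * q.1 + q.2) ∂μ := by
        rw [lintegral_scalarChannel p α v hv hGm, tsum_eq_single ⟨a, ha⟩, ← lintegral_indicator hW]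
        · congr 1
          refine lintegral_congr fun y => ?_
          by_cases hy : y ∈ W <;> simp [hG, hy]
        · intro c hc
          have : (c : ℝ) ≠ a := fun h => hc (Subtype.ext h)
          simp [hG, this]
    _ ≤ ∫⁻ q, ENNReal.ofReal (f q) ∂μ := by
        refine lintegral_mono_ae ?_
        filter_upwards [hfeq] with q hq
        simp only [hG]
        split_ifs with hqa
        · rw [← hqa.1]
          exact ENNReal.ofReal_le_ofReal hq.2
        · exact zero_le

end ScalarChannel

/-! ### Lower bound for the scalar equivocation -/

section EquivocationBound

variable (p : PMF ℝ)

/-- A letter nearer to the midpoint would be closer than the minimal distance to a or b. Hence the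
two closest letters dominate the output density near their midpoint. -/
theorem half_le_abs_sub_midpoint {p : PMF ℝ} (hdist : IsLeast (inputDistances p) (minDist p))
    {a b c : ℝ} (ha : a ∈ p.support) (hb : b ∈ p.support) (hc : c ∈ p.support)
    (hab : |a - b| = minDist p) : minDist p / 2 ≤ |c - (a + b) / 2| := by
  by_cases hca : c = a
  · subst hca
    have : c - (c + b) / 2 = (c - b) / 2 := by ring
    rw [this, abs_div, hab, abs_two]
  by_cases hcb : c = b
  · subst hcb
    have : c - (a + c) / 2 = -((a - c) / 2) := by ring
    rw [this, abs_neg, abs_div, hab, abs_two]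
  have h1 := minDist_le hdist hc ha hca
  have h2 := minDist_le hdist hc hb hcb
  have hd := minDist_pos hdist
  by_contra hlt
  rw [not_le, abs_lt] at hlt
  rcases abs_cases (c - a) with h3 | h3 <;> rcases abs_cases (c - b) with h4 | h4 <;>
    rcases abs_cases (a - b) with h5 | h5 <;> linarith

/-- The square w² in (x − w)² is dropped, so that the bound also holds trivially when w > x. -/
theorem gaussianPDF_le_of_abs {v : NNReal} {μ y y₀ x w : ℝ} (hx : 0 ≤ x) (hw : 0 ≤ w)
    (hμ : x ≤ |μ - y₀|) (hy : |y - y₀| ≤ w) :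
    gaussianPDF μ v y
      ≤ ENNReal.ofReal ((√(2 * Real.pi * v))⁻¹ * Real.exp (-(x ^ 2 - 2 * x * w) / (2 * v))) := by
  refine ENNReal.ofReal_le_ofReal ?_
  rw [gaussianPDFReal]
  gcongr
  have h1 : x - w ≤ |y - μ| := by
    have := abs_sub_le μ y y₀
    rw [abs_sub_comm μ y] at this
    linarith
  rw [← sq_abs (y - μ)]
  have h2 := abs_nonneg (y - μ)
  rcases le_total w x with h3 | h3
  · nlinarith [mul_self_le_mul_self (sub_nonneg.2 h3) h1]
  · nlinarith [mul_nonneg hx (sub_nonneg.2 h3), mul_nonneg hx hw]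

theorem le_gaussianPDF_of_abs {v : NNReal} {μ y y₀ x w : ℝ}
    (hμ : |μ - y₀| ≤ x) (hy : |y - y₀| ≤ w) :
    ENNReal.ofReal ((√(2 * Real.pi * v))⁻¹ * Real.exp (-(x + w) ^ 2 / (2 * v)))
      ≤ gaussianPDF μ v y := by
  refine ENNReal.ofReal_le_ofReal ?_
  rw [gaussianPDFReal]
  refine mul_le_mul_of_nonneg_left (Real.exp_le_exp.2 ?_) (by positivity)
  refine div_le_div_of_nonneg_right (neg_le_neg ?_) (by positivity)
  rw [← sq_abs (y - μ)]
  have h1 : |y - μ| ≤ x + w := by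
    have := abs_sub_le y y₀ μ
    rw [abs_sub_comm y₀ μ] at this
    linarith
  have := abs_nonneg (y - μ)
  gcongr

/-- Integrate over a short interval around the midpoint of two closest letters, where both
likelihoods and the total density are all about exp(−x²/2v), x being half the received distance. The
posterior of the wrong letter is then bounded below. -/
theorem exists_le_inputEntropy_sub_gainInfo (hentropy : Summable (entropyTerm p))
    (hdist : IsLeast (inputDistances p) (minDist p)) :
    ∃ c > 0, ∀ (α : ℝ) (v : NNReal), 0 ≤ α → v ≠ 0 → ∀ β : ℝ, β = α * minDist p / √v →
      c / (1 + β) * Real.exp (-β ^ 2 / 8) ≤ inputEntropy p - (gainInfo p α v).toReal := by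
  obtain ⟨a, ha, b, hb, hab, hd⟩ := hdist.1
  have hd0 := minDist_pos hdist
  have hpa : 0 < (p a).toReal := ENNReal.toReal_pos ((p.mem_support_iff _).1 ha) (p.apply_ne_top _)
  have hpb : 0 < (p b).toReal := ENNReal.toReal_pos ((p.mem_support_iff _).1 hb) (p.apply_ne_top _)
  refine ⟨(p a).toReal * (p b).toReal * (2 / √(2 * Real.pi) * Real.exp (-(5 / 2))),
    by positivity, fun α v hα hv β hβ => ?_⟩
  have hv0 : (0 : ℝ) < v := by positivity
  have hsv : 0 < √(v : ℝ) := Real.sqrt_pos.2 hv0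
  have hsq : √(v : ℝ) ^ 2 = v := Real.sq_sqrt hv0.le
  have hβ0 : 0 ≤ β := by rw [hβ]; positivity
  set x : ℝ := α * minDist p / 2 with hx
  have hx0 : 0 ≤ x := by positivity
  have hxβ : x = β * √v / 2 := by
    rw [hx, hβ]
    field_simp
  -- The half-width satisfies xw ≤ v/2 and w² ≤ v, so moving off the midpoint costs at most 5/2 in
  -- the exponent.
  set w : ℝ := √v / (1 + β) with hw
  have hw0 : 0 < w := by positivity
  set y₀ : ℝ := α * ((a + b) / 2) with hy₀
  have hmid : ∀ c : ℝ, |α * c - y₀| = α * |c - (a + b) / 2| := fun c => by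
    rw [hy₀, ← mul_sub, abs_mul, abs_of_nonneg hα]
  have hfar : ∀ c ∈ p.support, x ≤ |α * c - y₀| := fun c hc => by
    rw [hmid, hx, mul_div_assoc]
    exact mul_le_mul_of_nonneg_left (half_le_abs_sub_midpoint hdist ha hb hc hd.symm) hα
  have hnear : |α * a - y₀| ≤ x ∧ |α * b - y₀| ≤ x := by
    have e1 : a - (a + b) / 2 = (a - b) / 2 := by ring
    have e2 : b - (a + b) / 2 = -((a - b) / 2) := by ring
    rw [hmid, hmid, e1, e2, abs_neg, abs_div, abs_two, ← hd, hx, mul_div_assoc]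
    exact ⟨le_rfl, le_rfl⟩
  set W : Set ℝ := Set.Icc (y₀ - w) (y₀ + w)
  set g : ℝ := (√(2 * Real.pi * v))⁻¹
  have hg : 0 < g := by positivity
  -- The exponent is 2(x + w)² from the two lower bounds minus x² − 2xw from the upper bound on the
  -- mixture.
  set K : ℝ := g * Real.exp (-(x ^ 2 + 6 * x * w + 2 * w ^ 2) / (2 * v)) with hK
  have hpoint : ∀ y ∈ W, ENNReal.ofReal K ≤ gaussianPDF (α * a) v y * scalarRatio p α v b y := by
    intro y hy
    have hy' : |y - y₀| ≤ w := abs_le.2 ⟨by linarith [hy.1], by linarith [hy.2]⟩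
    have h1 := scalarDensity_le p α v fun c hc => gaussianPDF_le_of_abs hx0 hw0.le (hfar c hc) hy'
    have h2 := le_gaussianPDF_of_abs (v := v) hnear.1 hy'
    have h3 := le_gaussianPDF_of_abs (v := v) hnear.2 hy'
    rw [scalarRatio]
    refine le_trans (le_of_eq ?_) (mul_le_mul' h2 (ENNReal.div_le_div h3 h1))
    rw [← ENNReal.ofReal_div_of_pos (by positivity), ← ENNReal.ofReal_mul (by positivity), hK]
    congr 1
    change _ = g * _ * (g * _ / (g * _))
    rw [mul_div_mul_left _ _ hg.ne', ← Real.exp_sub, mul_assoc g, ← Real.exp_add]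
    congr 2
    ring
  have h1 := lintegral_le_inputEntropy_sub_gainInfo p α v hentropy hv ha hb hab W measurableSet_Icc
  have h2 : ENNReal.ofReal K * ENNReal.ofReal (2 * w)
      ≤ ∫⁻ y in W, gaussianPDF (α * a) v y * scalarRatio p α v b y := by
    have h3 : volume W = ENNReal.ofReal (2 * w) := by
      rw [Real.volume_Icc]
      congr 1
      ring
    rw [← h3, ← setLIntegral_const]
    exact setLIntegral_mono' measurableSet_Icc hpoint
  have h3 : ENNReal.ofReal ((p a).toReal * (p b).toReal * (K * (2 * w)))
      ≤ ENNReal.ofReal (inputEntropy p - (gainInfo p α v).toReal) := by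
    refine le_trans (le_of_eq ?_) ((mul_le_mul_right h2 _).trans h1)
    rw [ENNReal.ofReal_mul (by positivity), ENNReal.ofReal_mul hpa.le,
      ENNReal.ofReal_toReal (p.apply_ne_top _), ENNReal.ofReal_toReal (p.apply_ne_top _),
      ENNReal.ofReal_mul (by positivity)]
  have h4 : (p a).toReal * (p b).toReal * (K * (2 * w))
      ≤ inputEntropy p - (gainInfo p α v).toReal := by
    rcases ENNReal.ofReal_le_ofReal_iff'.1 h3 with h | h
    · exact h
    · exact absurd h (not_le.2 (by positivity))
  refine le_trans ?_ h4
  rw [mul_div_assoc, mul_assoc]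
  refine mul_le_mul_of_nonneg_left ?_ (by positivity)
  have hexp : -β ^ 2 / 8 - 5 / 2 ≤ -(x ^ 2 + 6 * x * w + 2 * w ^ 2) / (2 * v) := by
    rw [le_div_iff₀ (by positivity)]
    have e1 : x ^ 2 = β ^ 2 * v / 4 := by
      rw [hxβ, div_pow, mul_pow, hsq]
      ring
    have e2 : x * w ≤ v / 2 := by
      have : x * w = v / 2 * (β / (1 + β)) := by
        have : x * w = √v ^ 2 / 2 * (β / (1 + β)) := by
          rw [hxβ, hw]
          ring
        rw [this, hsq]
      rw [this]
      refine mul_le_of_le_one_right (by positivity) ?_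
      rw [div_le_one (by positivity)]
      linarith
    have e3 : w ^ 2 ≤ v := by
      rw [hw, div_pow, hsq]
      refine div_le_self hv0.le (one_le_pow₀ (by linarith))
    nlinarith
  have hgw : g * (2 * w) = 2 / √(2 * Real.pi) / (1 + β) := by
    simp only [g, hw]
    rw [Real.sqrt_mul (by positivity)]
    field_simp
  have hKw : K * (2 * w) = 2 / √(2 * Real.pi) / (1 + β) *
      Real.exp (-(x ^ 2 + 6 * x * w + 2 * w ^ 2) / (2 * v)) := by
    rw [← hgw, hK]
    ring
  rw [hKw]
  calc _ = 2 / √(2 * Real.pi) / (1 + β) * Real.exp (-β ^ 2 / 8 - 5 / 2) := by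
        rw [sub_eq_add_neg, Real.exp_add]
        ring
    _ ≤ _ := by gcongr

end EquivocationBound

/-! ### Channels with a single tap -/

section SingleTap

/-- Changing the sign of the gain does not increase the information. -/
theorem gainInfo_neg_le (p : PMF ℝ) (α : ℝ) (v : NNReal) :
    gainInfo p (-α) v ≤ gainInfo p α v := by
  have hmp : MeasurePreserving (fun q : ℝ × ℝ => (q.1, -q.2))
      (p.toMeasure.prod (gaussianReal 0 v)) (p.toMeasure.prod (gaussianReal 0 v)) := by
    have h : MeasurePreserving (fun x : ℝ => -x) (gaussianReal 0 v) (gaussianReal 0 v) :=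
      ⟨measurable_neg, by rw [gaussianReal_map_neg, neg_zero]⟩
    exact (MeasurePreserving.id p.toMeasure).prod h
  have h1 := mutualInfo_comp_measurePreserving hmp (X := fun q : ℝ × ℝ => q.1)
    (Y := fun q : ℝ × ℝ => -α * q.1 + q.2) measurable_fst (by fun_prop)
  have h2 := mutualInfo_comp_le (P := p.toMeasure.prod (gaussianReal 0 v))
    (X := fun q : ℝ × ℝ => q.1) (Y := fun q : ℝ × ℝ => α * q.1 + q.2) measurable_fst (by fun_prop)
    measurable_id measurable_neg
  unfold gainInfo
  rw [← h1]
  refine le_trans (le_of_eq ?_) h2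
  congr 1
  funext q
  ring

theorem gainInfo_abs_le (p : PMF ℝ) (α : ℝ) (v : NNReal) : gainInfo p |α| v ≤ gainInfo p α v := by
  rcases abs_choice α with h | h
  · rw [h]
  · rw [h]
    exact gainInfo_neg_le p α v

/-- On a channel with a single tap, symbol-by-symbol decoding is as good as on the scalar channel. -/
theorem gainInfo_le_achievableRate (p : PMF ℝ) (hentropy : Summable (entropyTerm p)) {L : ℕ}
    (j : Fin L) (c : ℝ) {N₀ : ℝ} (hN : 0 < N₀) :
    (gainInfo p c N₀.toNNReal).toReal ≤ achievableRate p (Pi.single j c) N₀ := by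
  have hv : N₀.toNNReal ≠ 0 := (Real.toNNReal_pos.2 hN).ne'
  obtain ⟨hint, hval⟩ := integrable_log_scalarRatio p c N₀.toNNReal hentropy hv
  obtain ⟨R, hR⟩ : ∃ R, R = scalarRatio p c N₀.toNNReal := ⟨_, rfl⟩
  have hRm : Measurable (Function.uncurry R) := hR ▸ measurable_scalarRatio p c N₀.toNNReal
  have hR0 : ∀ a y, R a y ≠ 0 := fun a y => hR ▸ scalarRatio_ne_zero p c N₀.toNNReal hv a y
  have hR1 : ∀ y, ∫⁻ a, R a y ∂p.toMeasure ≤ 1 := fun y => by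
    rw [lintegral_toMeasure, hR, tsum_scalarRatio p c N₀.toNNReal hv]
  rw [← hR] at hint hval
  clear hR
  have hout : ∀ ω : (ℤ → ℝ) × (ℤ → ℝ),
      output (Pi.single j c) ((j : ℕ) : ℤ) ω = c * ω.1 0 + ω.2 ((j : ℕ) : ℤ) := by
    intro ω
    rw [output, Finset.sum_eq_single j]
    · simp
    · intro i _ hij
      simp [Pi.single_eq_of_ne hij]
    · simp
  have hlaw : MeasurePreserving (fun ω : (ℤ → ℝ) × (ℤ → ℝ) => (ω.1 0, ω.2 ((j : ℕ) : ℤ)))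
      (channelLaw p N₀) (p.toMeasure.prod (gaussianReal 0 N₀.toNNReal)) :=
    (measurePreserving_eval_infinitePi (fun _ : ℤ => p.toMeasure) 0).prod
      (measurePreserving_eval_infinitePi (fun _ : ℤ => noise N₀) ((j : ℕ) : ℤ))
  let ψ : (ℤ → ℝ) × (ℤ → ℝ) → ℝ≥0∞ := fun z => R (z.1 0) (z.2 ((j : ℕ) : ℤ))
  have hψ : ∀ ω : (ℤ → ℝ) × (ℤ → ℝ),
      Real.log (ψ (ω.1, fun i => output (Pi.single j c) i ω)).toReal
      = (fun q : ℝ × ℝ => Real.log (R q.1 (c * q.1 + q.2)).toReal)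
        (ω.1 0, ω.2 ((j : ℕ) : ℤ)) := by
    intro ω
    simp only [ψ, hout]
  have hψm : Measurable ψ := by
    have h0 : Measurable fun z : (ℤ → ℝ) × (ℤ → ℝ) => (z.1 0, z.2 ((j : ℕ) : ℤ)) := by fun_prop
    exact hRm.comp h0
  have key := integral_log_le_achievableRate p (Pi.single j c) N₀ hentropy L ψ hψm
    (fun x x' y y' hx hy => by
      have := j.2
      simp only [ψ]
      rw [hx 0 (by omega) (by omega), hy _ (by omega) (by omega)])
    (fun x y i hi a => by simp only [ψ]; rw [Function.update_of_ne (by omega)])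
    (fun x y => by simp only [ψ, Function.update_self]; exact hR1 _)
    (fun z => hR0 _ _)
    (by simp_rw [hψ]; exact hlaw.integrable_comp_of_integrable hint)
  have hchange := integral_map hlaw.measurable.aemeasurable
    (f := fun q : ℝ × ℝ => Real.log (R q.1 (c * q.1 + q.2)).toReal)
    (by rw [hlaw.map_eq]; exact hint.aestronglyMeasurable)
  rw [hlaw.map_eq, hval] at hchange
  rw [hchange]
  refine le_trans (le_of_eq (integral_congr_ae (Eventually.of_forall fun ω => ?_))) key
  exact (hψ ω).symm

end SingleTap

/-! ### Integrability of negative powers on the unit circle -/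

section NegativeMoments

open Polynomial

/-- Jordan's inequality compares the sine with a linear function at each end of a period, where
x^(−κ) is integrable for κ < 1. -/
theorem intervalIntegrable_abs_sin_rpow {κ : ℝ} (hκ0 : 0 < κ) (hκ1 : κ < 1) (a b : ℝ) :
    IntervalIntegrable (fun x => |Real.sin x| ^ (-κ)) volume a b := by
  have hper : Function.Periodic (fun x => |Real.sin x| ^ (-κ)) Real.pi := fun x => by
    simp [Real.sin_add_pi]
  refine hper.intervalIntegrable Real.pi_ne_zero (t := 0) ?_ a b
  rw [zero_add]
  have h1 : IntervalIntegrable (fun x : ℝ => x ^ (-κ)) volume 0 Real.pi :=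
    intervalIntegral.intervalIntegrable_rpow' (by linarith)
  have h2 : IntervalIntegrable (fun x : ℝ => (Real.pi - x) ^ (-κ)) volume 0 Real.pi := by
    have := h1.comp_sub_left Real.pi
    simpa using this.symm
  refine ((h1.add h2).const_mul ((2 / Real.pi) ^ (-κ))).mono_fun'
    (by fun_prop : Measurable fun x => |Real.sin x| ^ (-κ)).aestronglyMeasurable ?_
  rw [Filter.EventuallyLE, Set.uIoc_of_le Real.pi_pos.le, ← restrict_Ioo_eq_restrict_Ioc]
  filter_upwards [ae_restrict_mem measurableSet_Ioo] with x hx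
  have hs : 0 < Real.sin x := Real.sin_pos_of_pos_of_lt_pi hx.1 hx.2
  have hx' : 0 < Real.pi - x := sub_pos.2 hx.2
  have hc : (0 : ℝ) ≤ 2 / Real.pi := by positivity
  have key : ∀ y : ℝ, 0 < y → y ≤ Real.pi / 2 →
      Real.sin y ^ (-κ) ≤ (2 / Real.pi) ^ (-κ) * y ^ (-κ) := by
    intro y hy hy'
    rw [← Real.mul_rpow hc hy.le]
    have := Real.pi_pos
    exact Real.rpow_le_rpow_of_nonpos (by positivity) (Real.mul_le_sin hy.le hy') (by linarith)
  rw [Real.norm_of_nonneg (Real.rpow_nonneg (abs_nonneg _) _), abs_of_pos hs, mul_add]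
  have n1 : 0 ≤ (2 / Real.pi) ^ (-κ) * x ^ (-κ) :=
    mul_nonneg (Real.rpow_nonneg hc _) (Real.rpow_nonneg hx.1.le _)
  have n2 : 0 ≤ (2 / Real.pi) ^ (-κ) * (Real.pi - x) ^ (-κ) :=
    mul_nonneg (Real.rpow_nonneg hc _) (Real.rpow_nonneg hx'.le _)
  rcases le_total x (Real.pi / 2) with h | h
  · linarith [key x hx.1 h]
  · have := key (Real.pi - x) hx' (by linarith)
    rw [Real.sin_pi_sub] at this
    linarith

/-- Rotate a onto the positive real axis and keep only the imaginary part. -/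
theorem abs_sin_le_norm_circleMap_sub (a : ℂ) (θ : ℝ) :
    |Real.sin (θ - a.arg)| ≤ ‖circleMap 0 1 θ - a‖ := by
  have h1 : circleMap 0 1 θ - a
      = Complex.exp (a.arg * Complex.I) * (Complex.exp ((θ - a.arg : ℝ) * Complex.I) - ‖a‖) := by
    rw [mul_sub, ← Complex.exp_add, mul_comm _ (‖a‖ : ℂ), Complex.norm_mul_exp_arg_mul_I,
      circleMap_zero]
    congr 1
    rw [Complex.ofReal_one, one_mul]
    congr 1
    push_cast
    ring
  rw [h1, norm_mul, Complex.norm_exp_ofReal_mul_I, one_mul]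
  refine le_trans (le_of_eq ?_) (Complex.abs_im_le_norm _)
  rw [Complex.sub_im, Complex.exp_ofReal_mul_I_im, Complex.ofReal_im, sub_zero]

theorem continuous_norm_eval_circleMap (P : ℂ[X]) :
    Continuous fun θ => ‖P.eval (circleMap 0 1 θ)‖ :=
  continuous_norm.comp (P.continuous.comp (continuous_circleMap 0 1))

/-- A negative power of the modulus of a polynomial is integrable on the unit circle. -/
def HasNegativeMoment (P : ℂ[X]) : Prop :=
  ∃ κ₀ > 0, ∀ κ : ℝ, 0 < κ → κ ≤ κ₀ →
    IntervalIntegrable (fun θ => ‖P.eval (circleMap 0 1 θ)‖ ^ (-κ)) volume 0 (2 * Real.pi)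

theorem hasNegativeMoment_C (c : ℂ) : HasNegativeMoment (C c) :=
  ⟨1, one_pos, fun κ _ _ => by simp⟩

theorem hasNegativeMoment_X_sub_C (a : ℂ) : HasNegativeMoment (X - C a) := by
  refine ⟨1 / 2, by norm_num, fun κ hκ0 hκ1 => ?_⟩
  have h1 := (intervalIntegrable_abs_sin_rpow hκ0 (by linarith) (0 - a.arg)
    (2 * Real.pi - a.arg)).comp_sub_right a.arg
  rw [sub_add_cancel, sub_add_cancel] at h1
  refine h1.mono_fun' ((continuous_norm_eval_circleMap _).measurable.pow_const _).aestronglyMeasurable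
    (ae_restrict_of_ae ?_)
  have h2 : ∀ᵐ θ : ℝ, Real.sin (θ - a.arg) ≠ 0 := by
    rw [ae_iff]
    refine Set.Countable.measure_zero ((Set.countable_range fun n : ℤ => n * Real.pi + a.arg).mono ?_) _
    intro θ hθ
    obtain ⟨n, hn⟩ := Real.sin_eq_zero_iff.1 (not_not.1 hθ)
    exact ⟨n, by simp only [hn]; ring⟩
  filter_upwards [h2] with θ hθ
  rw [Real.norm_of_nonneg (Real.rpow_nonneg (norm_nonneg _) _)]
  simp only [eval_sub, eval_X, eval_C]
  exact Real.rpow_le_rpow_of_nonpos (abs_pos.2 hθ) (abs_sin_le_norm_circleMap_sub a θ)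
    (by linarith)

/-- Since 2xy ≤ x² + y², halving the admissible exponent handles the product. -/
theorem HasNegativeMoment.mul {P Q : ℂ[X]} (hP : HasNegativeMoment P) (hQ : HasNegativeMoment Q) :
    HasNegativeMoment (P * Q) := by
  obtain ⟨κ₁, h₁, hP⟩ := hP
  obtain ⟨κ₂, h₂, hQ⟩ := hQ
  refine ⟨min κ₁ κ₂ / 2, by positivity, fun κ hκ0 hκ => ?_⟩
  have hκ1 : 2 * κ ≤ κ₁ := by linarith [min_le_left κ₁ κ₂]
  have hκ2 : 2 * κ ≤ κ₂ := by linarith [min_le_right κ₁ κ₂]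
  refine ((hP (2 * κ) (by linarith) hκ1).add (hQ (2 * κ) (by linarith) hκ2)).mono_fun'
    ((continuous_norm_eval_circleMap _).measurable.pow_const _).aestronglyMeasurable
    (Eventually.of_forall fun θ => ?_)
  have key : ∀ x : ℝ, 0 ≤ x → x ^ (-(2 * κ)) = (x ^ (-κ)) ^ 2 := fun x hx => by
    rw [← Real.rpow_natCast, ← Real.rpow_mul hx]
    congr 1
    push_cast
    ring
  simp only [eval_mul, norm_mul]
  rw [Real.norm_of_nonneg (Real.rpow_nonneg (by positivity) _),
    Real.mul_rpow (norm_nonneg _) (norm_nonneg _), key _ (norm_nonneg _), key _ (norm_nonneg _)]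
  set x := ‖P.eval (circleMap 0 1 θ)‖ ^ (-κ)
  set y := ‖Q.eval (circleMap 0 1 θ)‖ ^ (-κ)
  nlinarith [sq_nonneg (x - y), sq_nonneg x, sq_nonneg y]

theorem hasNegativeMoment (P : ℂ[X]) : HasNegativeMoment P := by
  rw [(IsAlgClosed.splits P).eq_prod_roots]
  refine (hasNegativeMoment_C _).mul ?_
  induction P.roots using Multiset.induction_on with
  | empty => simpa using hasNegativeMoment_C 1
  | cons a s ih =>
    rw [Multiset.map_cons, Multiset.prod_cons]
    exact (hasNegativeMoment_X_sub_C a).mul ih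

theorem ae_eval_circleMap_ne_zero {P : ℂ[X]} (hP : P ≠ 0) :
    ∀ᵐ θ : ℝ, P.eval (circleMap 0 1 θ) ≠ 0 := by
  rw [ae_iff]
  have h1 : (P.rootSet ℂ).Countable := (P.rootSet_finite ℂ).countable
  refine Set.Countable.measure_zero ((h1.preimage_circleMap 0 one_ne_zero).mono fun θ hθ => ?_) _
  rw [Set.mem_preimage, mem_rootSet]
  exact ⟨hP, by simpa using hθ⟩

end NegativeMoments

/-! ### The SNR of the decision feedback equalizer at high SNR -/

section EqualizerSNR

variable {L : ℕ} (h : Fin L → ℝ)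

/-- With z = 1/(su), the excess log(1 + z) is at most z^κ/κ, because (1 + z)^κ ≤ 1 + z^κ. The power
κ can be taken small enough for u^(−κ) to be integrable at spectral zeros. -/
theorem log_one_add_mul_le {s u κ : ℝ} (hs : 0 < s) (hu : 0 < u) (hκ0 : 0 < κ) (hκ1 : κ ≤ 1) :
    Real.log (1 + s * u) ≤ Real.log s + Real.log u + s ^ (-κ) / κ * u ^ (-κ) := by
  have hsu : 0 < s * u := mul_pos hs hu
  have h1 : 1 + s * u = s * u * (1 + (s * u)⁻¹) := by
    field_simp
    ring
  have h2 : Real.log (1 + (s * u)⁻¹) ≤ (s * u)⁻¹ ^ κ / κ := by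
    rw [le_div_iff₀ hκ0, mul_comm, ← Real.log_rpow (by positivity)]
    have h3 : (1 + (s * u)⁻¹) ^ κ ≤ 1 + (s * u)⁻¹ ^ κ := by
      have := NNReal.coe_le_coe.2
        (NNReal.rpow_add_le_add_rpow 1 (Real.toNNReal (s * u)⁻¹) hκ0.le hκ1)
      push_cast at this
      rwa [Real.coe_toNNReal _ (inv_pos.2 hsu).le, Real.one_rpow] at this
    refine (Real.log_le_log (by positivity) h3).trans ?_
    have := Real.log_le_sub_one_of_pos (x := 1 + (s * u)⁻¹ ^ κ) (by positivity)
    linarith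
  rw [h1, Real.log_mul hsu.ne' (by positivity), Real.log_mul hs.ne' hu.ne']
  have h4 : (s * u)⁻¹ ^ κ = s ^ (-κ) * u ^ (-κ) := by
    rw [Real.inv_rpow hsu.le, ← Real.rpow_neg hsu.le, Real.mul_rpow hs.le hu.le]
  rw [h4] at h2
  have h5 : s ^ (-κ) / κ * u ^ (-κ) = s ^ (-κ) * u ^ (-κ) / κ := by ring
  rw [h5]
  linarith

/-- The normalized log-integral that determines the SNR of the equalizer. -/
def logGain (s : ℝ) : ℝ :=
  1 / (2 * Real.pi) * ∫ θ in (-Real.pi)..Real.pi, Real.log (1 + s * ‖transfer h θ‖ ^ 2)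

theorem continuous_transfer : Continuous (transfer h) := by
  unfold transfer
  fun_prop

theorem intervalIntegrable_logGain {s : ℝ} (hs : 0 < s) (a b : ℝ) :
    IntervalIntegrable (fun θ => Real.log (1 + s * ‖transfer h θ‖ ^ 2)) volume a b := by
  have := continuous_transfer h
  refine Continuous.intervalIntegrable (Continuous.log (by fun_prop) fun θ => ?_) a b
  positivity

theorem logGain_nonneg {s : ℝ} (hs : 0 < s) : 0 ≤ logGain h s := by
  have := Real.pi_pos
  refine mul_nonneg (by positivity) (intervalIntegral.integral_nonneg (by linarith) fun θ _ => ?_)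
  refine Real.log_nonneg ?_
  have : 0 ≤ s * ‖transfer h θ‖ ^ 2 := by positivity
  linarith

theorem logGain_le_log {s : ℝ} (hs : 0 < s) :
    logGain h s ≤ Real.log (1 + s * (∑ k, |h k|) ^ 2) := by
  have hpi := Real.pi_pos
  have hle : ∀ θ, ‖transfer h θ‖ ≤ ∑ k, |h k| := fun θ => by
    refine (norm_sum_le _ _).trans (le_of_eq (Finset.sum_congr rfl fun k _ => ?_))
    have : -(Complex.I * ((k : ℕ) : ℂ) * (θ : ℂ)) = ((-((k : ℕ) * θ) : ℝ) : ℂ) * Complex.I := by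
      push_cast
      ring
    rw [norm_mul, Complex.norm_real, Real.norm_eq_abs, this, Complex.norm_exp_ofReal_mul_I, mul_one]
  have h1 : ∫ θ in (-Real.pi)..Real.pi, Real.log (1 + s * ‖transfer h θ‖ ^ 2)
      ≤ ∫ _ in (-Real.pi)..Real.pi, Real.log (1 + s * (∑ k, |h k|) ^ 2) := by
    refine intervalIntegral.integral_mono_on (by linarith) (intervalIntegrable_logGain h hs _ _)
      (by simp) fun θ _ => ?_
    have := hle θ
    gcongr
  rw [intervalIntegral.integral_const, smul_eq_mul] at h1
  unfold logGain
  calc _ ≤ 1 / (2 * Real.pi) * ((Real.pi - -Real.pi) * Real.log (1 + s * (∑ k, |h k|) ^ 2)) := by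
        gcongr
    _ = _ := by
        field_simp
        ring

theorem exists_logGain_le (hh : h ≠ 0) : ∃ κ A : ℝ, 0 < κ ∧ κ ≤ 1 / 2 ∧ 0 ≤ A ∧ ∀ s > 0,
    logGain h s ≤ Real.log s + Real.log (gZFDFE h) + s ^ (-κ) / κ * A := by
  have hP := toPoly_ne_zero h hh
  have hpi := Real.pi_pos
  obtain ⟨κ₀, hκ₀, hmom⟩ := hasNegativeMoment (toPoly h)
  set κ : ℝ := min (κ₀ / 2) (1 / 2)
  have hκ : 0 < κ := lt_min (by linarith) (by norm_num)
  have hκ1 : κ ≤ 1 / 2 := min_le_right _ _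
  have hint := hmom (2 * κ) (by linarith) (by linarith [min_le_left (κ₀ / 2) (1 / 2 : ℝ)])
  set U : ℝ → ℝ := fun θ => ‖(toPoly h).eval (circleMap 0 1 θ)‖ with hU
  have hUc : Continuous U := continuous_norm_eval_circleMap (toPoly h)
  have hlog : IntervalIntegrable (fun θ => Real.log (U θ ^ 2)) volume 0 (2 * Real.pi) := by
    have := (toPoly h).intervalIntegrable_mahlerMeasure.const_mul 2
    refine this.congr fun θ _ => ?_
    simp [hU, Real.log_pow]
  refine ⟨κ, 1 / (2 * Real.pi) * ∫ θ in (0)..(2 * Real.pi), U θ ^ (-(2 * κ)), hκ, hκ1,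
    mul_nonneg (by positivity) (intervalIntegral.integral_nonneg (by linarith) fun θ _ =>
      Real.rpow_nonneg (norm_nonneg _) _), fun s hs => ?_⟩
  have h1 : ∫ θ in (0)..(2 * Real.pi), Real.log (1 + s * U θ ^ 2)
      ≤ ∫ θ in (0)..(2 * Real.pi), (Real.log s + Real.log (U θ ^ 2)
        + s ^ (-κ) / κ * U θ ^ (-(2 * κ))) := by
    refine intervalIntegral.integral_mono_ae (by linarith) ?_ ?_ ?_
    · refine Continuous.intervalIntegrable (Continuous.log (by fun_prop) fun θ => ?_) _ _
      positivity
    · exact ((by simp : IntervalIntegrable (fun _ => Real.log s) volume 0 (2 * Real.pi)).add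
        hlog).add (hint.const_mul _)
    · filter_upwards [ae_eval_circleMap_ne_zero hP] with θ hθ
      have hpos : 0 < U θ := norm_pos_iff.2 hθ
      have h2 := log_one_add_mul_le hs (pow_pos hpos 2) hκ (by linarith)
      have h3 : (U θ ^ 2) ^ (-κ) = U θ ^ (-(2 * κ)) := by
        rw [← Real.rpow_natCast, ← Real.rpow_mul hpos.le]
        congr 1
        push_cast
        ring
      rwa [h3] at h2
  have h2 : Real.log (gZFDFE h)
      = 1 / (2 * Real.pi) * ∫ θ in (0)..(2 * Real.pi), Real.log (U θ ^ 2) := by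
    rw [gZFDFE, Real.log_exp, integral_transfer_eq h (f := fun z => Real.log (‖z‖ ^ 2))]
  rw [intervalIntegral.integral_add ((by simp :
      IntervalIntegrable (fun _ => Real.log s) volume 0 (2 * Real.pi)).add hlog)
      (hint.const_mul _), intervalIntegral.integral_add (by simp) hlog,
    intervalIntegral.integral_const, intervalIntegral.integral_const_mul, smul_eq_mul] at h1
  rw [h2, logGain, integral_transfer_eq h (f := fun z => Real.log (1 + s * ‖z‖ ^ 2))]
  calc _ ≤ 1 / (2 * Real.pi) * ((2 * Real.pi - 0) * Real.log s
        + (∫ θ in (0)..(2 * Real.pi), Real.log (U θ ^ 2))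
        + s ^ (-κ) / κ * ∫ θ in (0)..(2 * Real.pi), U θ ^ (-(2 * κ))) := by
        gcongr
    _ = _ := by
        field_simp
        ring

theorem gZFDFE_pos : 0 < gZFDFE h := Real.exp_pos _

/-- The SNR of the equalizer is at most that of the zero-forcing equalizer, up to a term of lower
order. -/
theorem exists_exp_logGain_sub_one_le (hh : h ≠ 0) : ∃ κ K : ℝ, 0 < κ ∧ κ ≤ 1 / 2 ∧ 0 ≤ K ∧
    ∀ s > 0, Real.exp (logGain h s) - 1 ≤ s * gZFDFE h + K * s ^ (1 - κ) := by
  obtain ⟨κ, A, hκ, hκ1, hA, hle⟩ := exists_logGain_le h hh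
  have hg := gZFDFE_pos h
  set B : ℝ := (∑ k, |h k|) ^ 2
  have hB : 0 ≤ B := sq_nonneg _
  set K₁ : ℝ := gZFDFE h * (A / κ) * Real.exp (A / κ)
  have hK₁ : 0 ≤ K₁ := by positivity
  refine ⟨κ, max B K₁, hκ, hκ1, le_max_of_le_left hB, fun s hs => ?_⟩
  have hs1 : 0 < s ^ (1 - κ) := Real.rpow_pos_of_pos hs _
  -- For s ≤ 1 the trivial bound by log(1 + sB) suffices, as s ≤ s^(1−κ). For s ≥ 1 the correction T
  -- is at most A/κ and the exponential can be linearised.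
  rcases le_total s 1 with h1 | h1
  · have h2 : Real.exp (logGain h s) ≤ 1 + s * B := by
      rw [← Real.exp_log (show 0 < 1 + s * B by positivity)]
      exact Real.exp_le_exp.2 (logGain_le_log h hs)
    have h3 : s ≤ s ^ (1 - κ) := by
      conv_lhs => rw [← Real.rpow_one s]
      exact Real.rpow_le_rpow_of_exponent_ge hs h1 (by linarith)
    have h4 : s * B ≤ max B K₁ * s ^ (1 - κ) := by
      rw [mul_comm s B]
      exact mul_le_mul (le_max_left _ _) h3 hs.le (le_max_of_le_left hB)
    have h5 : 0 < s * gZFDFE h := mul_pos hs hg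
    linarith
  · set T : ℝ := s ^ (-κ) / κ * A with hT
    have hT0 : 0 ≤ T := mul_nonneg (div_nonneg (Real.rpow_nonneg hs.le _) hκ.le) hA
    have hT1 : T ≤ A / κ := by
      have : s ^ (-κ) ≤ 1 := Real.rpow_le_one_of_one_le_of_nonpos h1 (by linarith)
      rw [hT, div_mul_eq_mul_div]
      gcongr
      exact mul_le_of_le_one_left hA this
    have h2 : Real.exp (logGain h s) ≤ s * gZFDFE h * Real.exp T := by
      refine (Real.exp_le_exp.2 (hle s hs)).trans (le_of_eq ?_)
      rw [Real.exp_add, Real.exp_add, Real.exp_log hs, Real.exp_log hg]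
    have h3 : Real.exp T ≤ 1 + T * Real.exp (A / κ) := by
      have h4 := Real.add_one_le_exp (-T)
      have h5 : Real.exp (-T) * Real.exp T = 1 := by rw [← Real.exp_add, neg_add_cancel, Real.exp_zero]
      have h6 : Real.exp T ≤ Real.exp (A / κ) := Real.exp_le_exp.2 hT1
      have h7 := mul_le_mul_of_nonneg_right h4 (Real.exp_pos T).le
      nlinarith
    have h4 : s * gZFDFE h * (1 + T * Real.exp (A / κ)) = s * gZFDFE h + K₁ * s ^ (1 - κ) := by
      have : s ^ (1 - κ) = s * s ^ (-κ) := by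
        rw [sub_eq_add_neg, Real.rpow_add hs, Real.rpow_one]
      rw [this, hT]
      simp only [K₁]
      ring
    have h5 : K₁ * s ^ (1 - κ) ≤ max B K₁ * s ^ (1 - κ) :=
      mul_le_mul_of_nonneg_right (le_max_right _ _) hs1.le
    have h6 := mul_le_mul_of_nonneg_left h3 (mul_pos hs hg).le
    linarith

end EqualizerSNR

/-! ### Comparison of the Shamai-Laroia expression with the achievable rate -/

section Comparison

variable (p : PMF ℝ) {L : ℕ} (h : Fin L → ℝ)

theorem snrDFEU_eq (N₀ : ℝ) :
    snrDFEU p h N₀ = Real.exp (logGain h (inputPower p / N₀)) - 1 := rfl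

theorem shamaiLaroia_eq (N₀ : ℝ) :
    shamaiLaroia p h N₀ = gainInfo p (√(snrDFEU p h N₀ * N₀ / inputPower p)) N₀.toNNReal := rfl

theorem shamaiLaroia_ne_top (hentropy : Summable (entropyTerm p)) (N₀ : ℝ) :
    shamaiLaroia p h N₀ ≠ ∞ :=
  gainInfo_ne_top p _ _ hentropy

/-- The Shamai-Laroia expression converges to the input entropy at most exponentially fast in the
SNR, with the exponent of the zero-forcing equalizer. -/
theorem exists_le_inputEntropy_sub_shamaiLaroia (hentropy : Summable (entropyTerm p))
    (hpower : Integrable (fun a : ℝ => a ^ 2) p.toMeasure)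
    (hdist : IsLeast (inputDistances p) (minDist p)) (hh : h ≠ 0) :
    ∃ c κ K : ℝ, 0 < c ∧ 0 < κ ∧ κ ≤ 1 / 2 ∧ 0 < K ∧ ∀ N₀ : ℝ, 0 < N₀ →
      c * Real.exp (-(inputPower p / (2 * N₀)) * (normMinDist p / 2) ^ 2 * gZFDFE h
        - K * (inputPower p / N₀) ^ (1 - κ))
      ≤ inputEntropy p - (shamaiLaroia p h N₀).toReal := by
  obtain ⟨c, hc, hbound⟩ := exists_le_inputEntropy_sub_gainInfo p hentropy hdist
  obtain ⟨κ, K, hκ0, hκ1, hK, hsnr⟩ := exists_exp_logGain_sub_one_le h hh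
  have hP := inputPower_pos hdist hpower
  have hg := gZFDFE_pos h
  set D := normMinDist p with hD
  have hD2 : D ^ 2 = minDist p ^ 2 / inputPower p := by
    rw [hD, normMinDist, div_pow, Real.sq_sqrt hP.le]
  -- M is chosen so that β ≤ M(1 + r). The prefactor 1/(1 + β) ≥ exp(−β) can then be absorbed into
  -- the lower-order exponent K·r.
  set M : ℝ := √(D ^ 2 * (gZFDFE h + K))
  have hM : M ^ 2 = D ^ 2 * (gZFDFE h + K) := Real.sq_sqrt (by positivity)
  have hM0 : 0 ≤ M := Real.sqrt_nonneg _
  refine ⟨c * Real.exp (-M), κ, M + D ^ 2 / 8 * K + 1, by positivity, hκ0, hκ1, by positivity,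
    fun N₀ hN => ?_⟩
  set s : ℝ := inputPower p / N₀ with hs
  have hs0 : 0 < s := div_pos hP hN
  set r : ℝ := s ^ (1 - κ)
  have hr : 0 < r := Real.rpow_pos_of_pos hs0 _
  set γ : ℝ := snrDFEU p h N₀ with hγ
  have hγ1 : γ ≤ s * gZFDFE h + K * r := hsnr s hs0
  have hγ0 : 0 ≤ γ := by
    rw [hγ, snrDFEU_eq]
    linarith [Real.one_le_exp (logGain_nonneg h hs0)]
  have hv : N₀.toNNReal ≠ 0 := (Real.toNNReal_pos.2 hN).ne'
  set β : ℝ := √(γ * N₀ / inputPower p) * minDist p / √(N₀.toNNReal : ℝ) with hβ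
  have hβ0 : 0 ≤ β := by
    have := minDist_pos hdist
    positivity
  have hβ2 : β ^ 2 = γ * D ^ 2 := by
    rw [hβ, div_pow, mul_pow, Real.sq_sqrt (by positivity), Real.coe_toNNReal _ hN.le,
      Real.sq_sqrt hN.le, hD2]
    field_simp
  have key := hbound _ N₀.toNNReal (Real.sqrt_nonneg _) hv β hβ
  rw [← shamaiLaroia_eq] at key
  refine le_trans ?_ key
  -- Here κ ≤ 1/2 is needed: √s, the order of β, must not exceed that of s^(1−κ).
  have hs2 : s ≤ (1 + r) ^ 2 := by
    rcases le_total s 1 with h1 | h1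
    · nlinarith
    · have h2 : s ≤ r ^ 2 := by
        have e : r ^ 2 = s ^ ((1 - κ) * 2) := by
          rw [Real.rpow_mul hs0.le]
          exact (Real.rpow_natCast r 2).symm
        rw [e]
        conv_lhs => rw [← Real.rpow_one s]
        exact Real.rpow_le_rpow_of_exponent_le h1 (by linarith)
      nlinarith
  have hr2 : r ≤ (1 + r) ^ 2 := by nlinarith
  have hβM : β ≤ M * (1 + r) := by
    refine le_of_abs_le (abs_le_of_sq_le_sq ?_ (by positivity))
    rw [hβ2, mul_pow, hM, mul_comm γ, mul_assoc]
    refine mul_le_mul_of_nonneg_left (hγ1.trans ?_) (sq_nonneg D)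
    nlinarith [mul_le_mul_of_nonneg_left hs2 hg.le, mul_le_mul_of_nonneg_left hr2 hK]
  have hinv : Real.exp (-β) ≤ 1 / (1 + β) := by
    rw [Real.exp_neg, ← one_div]
    exact one_div_le_one_div_of_le (by linarith) (by linarith [Real.add_one_le_exp β])
  have e1 : inputPower p / (2 * N₀) = s / 2 := by
    rw [hs]
    field_simp
  calc c * Real.exp (-M) * Real.exp (-(inputPower p / (2 * N₀)) * (D / 2) ^ 2 * gZFDFE h
        - (M + D ^ 2 / 8 * K + 1) * r)
      ≤ c * Real.exp (-β) * Real.exp (-β ^ 2 / 8) := by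
        rw [mul_assoc c, mul_assoc c, ← Real.exp_add, ← Real.exp_add, e1]
        refine mul_le_mul_of_nonneg_left (Real.exp_le_exp.2 ?_) hc.le
        rw [hβ2]
        nlinarith [mul_le_mul_of_nonneg_left hγ1 (sq_nonneg D)]
    _ ≤ c / (1 + β) * Real.exp (-β ^ 2 / 8) := by
        gcongr
        rw [div_eq_mul_one_div]
        gcongr

/-- With |H| constant equal to |c| the equalizer SNR is exactly P_x c²/N₀, so the scalar gain is
|c|; the sign is irrelevant because the noise is symmetric. -/
theorem shamaiLaroia_le_achievableRate_single (hentropy : Summable (entropyTerm p))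
    (hP : 0 < inputPower p) (j : Fin L) (c : ℝ) {N₀ : ℝ} (hN : 0 < N₀) :
    (shamaiLaroia p (Pi.single j c) N₀).toReal ≤ achievableRate p (Pi.single j c) N₀ := by
  have hpi := Real.pi_pos
  have hs0 : 0 < inputPower p / N₀ := div_pos hP hN
  have hsnr : snrDFEU p (Pi.single j c) N₀ = inputPower p / N₀ * c ^ 2 := by
    have h1 : logGain (Pi.single j c) (inputPower p / N₀)
        = Real.log (1 + inputPower p / N₀ * c ^ 2) := by
      simp only [logGain, norm_transfer_single, sq_abs]
      rw [intervalIntegral.integral_const, smul_eq_mul]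
      field_simp
      ring
    rw [snrDFEU_eq, h1, Real.exp_log (by positivity)]
    ring
  have hgain : √(snrDFEU p (Pi.single j c) N₀ * N₀ / inputPower p) = |c| := by
    rw [hsnr, ← Real.sqrt_sq_eq_abs]
    congr 1
    field_simp
  rw [shamaiLaroia_eq, hgain]
  exact (ENNReal.toReal_mono (gainInfo_ne_top p c _ hentropy) (gainInfo_abs_le p c _)).trans
    (gainInfo_le_achievableRate p hentropy j c hN)

theorem exists_forall_mul_exp_le {C c κ K γ : ℝ} (hC : 0 < C) (hc : 0 < c) (hκ : 0 < κ)
    (hγ : 0 < γ) : ∃ s₀ : ℝ, ∀ s ≥ s₀,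
      C ≤ c * Real.exp (γ * s - K * s ^ (1 - κ)) := by
  have h1 : ∀ᶠ s : ℝ in atTop, K * s ^ (-κ) ≤ γ / 2 := by
    have := (tendsto_rpow_neg_atTop hκ).const_mul K
    rw [mul_zero] at this
    exact this.eventually_le_const (by linarith)
  have h2 : ∀ᶠ s : ℝ in atTop, Real.log (C / c) ≤ γ / 2 * s :=
    (tendsto_id.const_mul_atTop (by linarith : 0 < γ / 2)).eventually_ge_atTop _
  obtain ⟨s₀, hs₀⟩ := eventually_atTop.1 ((h1.and h2).and (eventually_gt_atTop 0))
  refine ⟨s₀, fun s hs => ?_⟩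
  obtain ⟨⟨h3, h4⟩, h5⟩ := hs₀ s hs
  have h6 : s ^ (1 - κ) = s * s ^ (-κ) := by
    rw [sub_eq_add_neg, Real.rpow_add h5, Real.rpow_one]
  have h7 : Real.log (C / c) ≤ γ * s - K * s ^ (1 - κ) := by
    rw [h6]
    nlinarith [mul_le_mul_of_nonneg_left h3 h5.le]
  have h8 := Real.exp_le_exp.2 h7
  rw [Real.exp_log (div_pos hC hc), div_le_iff₀ hc] at h8
  linarith

/-- The Shamai-Laroia expression bounds the achievable rate from below at high SNR. -/
theorem exists_shamaiLaroia_le_achievableRate (hentropy : Summable (entropyTerm p))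
    (hpower : Integrable (fun a : ℝ => a ^ 2) p.toMeasure)
    (hdist : IsLeast (inputDistances p) (minDist p)) (hh : h ≠ 0) :
    ∃ s₀ : ℝ, ∀ N₀ : ℝ, 0 < N₀ → s₀ ≤ inputPower p / N₀ →
      (shamaiLaroia p h N₀).toReal ≤ achievableRate p h N₀ := by
  have hP := inputPower_pos hdist hpower
  -- With a single tap there is no strict gap between the exponents to exploit, so the direct
  -- comparison, valid at every SNR, is used instead.
  by_cases hroots : ∀ a ∈ (toPoly h).roots, a = 0
  · obtain ⟨j, c, -, rfl⟩ := exists_eq_single h hh hroots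
    exact ⟨0, fun N₀ hN _ => shamaiLaroia_le_achievableRate_single p hentropy hP j c hN⟩
  push Not at hroots
  obtain ⟨a, ha, ha0⟩ := hroots
  have hlt := gZFDFE_lt_deltaMinSq h hdist hh ha ha0
  obtain ⟨C, hC, hup⟩ := exists_inputEntropy_sub_achievableRate_le h p hentropy hpower hdist hh
  obtain ⟨c, κ, K, hc, hκ, -, -, hlow⟩ :=
    exists_le_inputEntropy_sub_shamaiLaroia p h hentropy hpower hdist hh
  have hD : 0 < normMinDist p := div_pos (minDist_pos hdist) (Real.sqrt_pos.2 hP)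
  obtain ⟨s₀, hs₀⟩ := exists_forall_mul_exp_le (K := K) hC hc hκ
    (γ := normMinDist p ^ 2 / 8 * (deltaMinSq p h - gZFDFE h))
    (mul_pos (by positivity) (sub_pos.2 hlt))
  refine ⟨s₀, fun N₀ hN hs => ?_⟩
  have h1 := hup N₀ hN
  have h2 := hlow N₀ hN
  have e1 := inputPower_mul_normMinDist_sq hdist hpower N₀
  set s := inputPower p / N₀ with hsdef
  have e2 : inputPower p / (2 * N₀) = s / 2 := by
    rw [hsdef]
    field_simp
  rw [e2] at e1 h2
  have h3 := mul_le_mul_of_nonneg_right (hs₀ s hs)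
    (Real.exp_pos (-(1 / (8 * N₀)) * (minDist p ^ 2 * deltaMinSq p h))).le
  rw [mul_assoc c, ← Real.exp_add] at h3
  have e3 : normMinDist p ^ 2 / 8 * (deltaMinSq p h - gZFDFE h) * s - K * s ^ (1 - κ)
      + -(1 / (8 * N₀)) * (minDist p ^ 2 * deltaMinSq p h)
      = -(s / 2) * (normMinDist p / 2) ^ 2 * gZFDFE h - K * s ^ (1 - κ) := by
    have : -(1 / (8 * N₀)) * (minDist p ^ 2 * deltaMinSq p h)
        = -(s / 2 * (normMinDist p / 2) ^ 2) * deltaMinSq p h := by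
      rw [e1]
      ring
    rw [this]
    ring
  rw [e3] at h3
  linarith

end Comparison

end ISI

end

/-! ### The main theorem -/

theorem theorem2 (p : PMF ℝ)
    (hentropy : Summable (ISI.entropyTerm p))
    (hpower : Integrable (fun a : ℝ => a ^ 2) p.toMeasure)
    (hdist : IsLeast (ISI.inputDistances p) (ISI.minDist p))
    {L : ℕ} (h : Fin L → ℝ) (hh : h ≠ 0) :
    -- the information quantities are finite, and the limit defining the achievable rate exists
    (∀ N₀ : ℝ, 0 < N₀ →
      (∀ N : ℕ, ISI.blockInfo p h N₀ N ≠ ∞) ∧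
      Tendsto (ISI.blockRate p h N₀) atTop (𝓝 (ISI.achievableRate p h N₀)) ∧
      ISI.shamaiLaroia p h N₀ ≠ ∞) ∧
    -- the rate of convergence of the achievable rate to the input entropy
    (∃ F : Polynomial ℝ, (∀ s : ℝ, 0 < s → 0 < F.eval s) ∧
      ∀ N₀ : ℝ, 0 < N₀ →
        ISI.inputEntropy p - ISI.achievableRate p h N₀ ≤
          F.eval (ISI.inputPower p / N₀) *
            Real.exp (-(ISI.inputPower p / (2 * N₀)) * (ISI.normMinDist p / 2) ^ 2 *
              ISI.deltaMinSq p h)) ∧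
    -- comparison of the two gain factors
    ISI.gZFDFE h ≤ ISI.deltaMinSq p h ∧
    ((¬ ∃ c : ℝ, ∀ θ : ℝ, ‖ISI.transfer h θ‖ = c) → ISI.gZFDFE h < ISI.deltaMinSq p h) ∧
    -- the rate of convergence of the Shamai-Laroia expression to the input entropy
    (∃ (G : Polynomial ℝ) (ε K : ℝ), (∀ s : ℝ, 0 < s → 0 < G.eval s) ∧
      0 < ε ∧ ε < 1 ∧ 0 < K ∧
      ∀ N₀ : ℝ, 0 < N₀ →
        G.eval (ISI.inputPower p / N₀) *
            Real.exp (-(ISI.inputPower p / (2 * N₀)) * (ISI.normMinDist p / 2) ^ 2 *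
              ISI.gZFDFE h - K * (ISI.inputPower p / N₀) ^ (1 - ε)) ≤
          ISI.inputEntropy p - (ISI.shamaiLaroia p h N₀).toReal) ∧
    -- the achievable rate is at least the Shamai-Laroia expression at all sufficiently high SNRs
    (∃ s₀ : ℝ, ∀ N₀ : ℝ, 0 < N₀ → s₀ ≤ ISI.inputPower p / N₀ →
      (ISI.shamaiLaroia p h N₀).toReal ≤ ISI.achievableRate p h N₀) := by
  refine ⟨fun N₀ hN => ⟨fun N => ?_, ISI.tendsto_blockRate p h N₀ hentropy,
    ISI.shamaiLaroia_ne_top p h hentropy N₀⟩, ?_, ISI.gZFDFE_le_deltaMinSq h hdist hh, fun hconst => ?_, ?_,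
    ISI.exists_shamaiLaroia_le_achievableRate p h hentropy hpower hdist hh⟩
  · rw [ISI.blockInfo_eq_windowInfo]
    exact (ISI.windowInfo_le p h N₀ hentropy _).1
  · obtain ⟨C, hC, hbound⟩ :=
      ISI.exists_inputEntropy_sub_achievableRate_le h p hentropy hpower hdist hh
    refine ⟨Polynomial.C C, fun s _ => by simpa using hC, fun N₀ hN => ?_⟩
    have e : -(ISI.inputPower p / (2 * N₀)) * (ISI.normMinDist p / 2) ^ 2 * ISI.deltaMinSq p h
        = -(1 / (8 * N₀)) * (ISI.minDist p ^ 2 * ISI.deltaMinSq p h) := by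
      rw [neg_mul, ISI.inputPower_mul_normMinDist_sq hdist hpower]
      ring
    rw [Polynomial.eval_C, e]
    exact hbound N₀ hN
  · by_cases hroots : ∀ a ∈ (ISI.toPoly h).roots, a = 0
    · obtain ⟨j, c, -, rfl⟩ := ISI.exists_eq_single h hh hroots
      exact absurd ⟨|c|, ISI.norm_transfer_single j c⟩ hconst
    · push Not at hroots
      obtain ⟨a, ha, ha0⟩ := hroots
      exact ISI.gZFDFE_lt_deltaMinSq h hdist hh ha ha0
  · obtain ⟨c, κ, K, hc, hκ0, hκ1, hK, hbound⟩ :=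
      ISI.exists_le_inputEntropy_sub_shamaiLaroia p h hentropy hpower hdist hh
    refine ⟨Polynomial.C c, κ, K, fun s _ => by simpa using hc, hκ0, by linarith, hK, fun N₀ hN => ?_⟩
    rw [Polynomial.eval_C]
    exact hbound N₀ hN
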